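/- Let $d\ge 2$, $J>0$ and $\delta>1$. Put $\mathbb H^d_+=\{i\in\mathbb Z^d: i_d\ge 1\}$, with nearest-neighbour relation $i\sim j$ iff $\|i-j\|_1=1$, and $\Omega=\{-1,+1\}^{\mathbb H^d_+}$. For $\lambda\ge 0$ let $\widehat{\boldsymbol\lambda}$ be the external field $i\mapsto \lambda/i_d^{\delta}$ on $\mathbb H^d_+$, and for finite $\Lambda\subset\mathbb H^d_+$ consider the semi-infinite Ising Hamiltonian $$\mathcal H_{\Lambda;\widehat{\boldsymbol\lambda}}(\sigma)=-\sum_{i\sim j,\ \{i,j\}\cap\Lambda\ne\emptyset}J\sigma_i\sigma_j-\sum_{i\in\Lambda}\frac{\lambda}{i_d^{\delta}}\,\sigma_i ,$$ where the first sum is over unordered pairs in $\mathbb H^d_+$. For $\eta\in\Omega$ let $\mathcal Z^{\eta}_{\Lambda;\widehat{\boldsymbol\lambda}}$ be the sum of $e^{-\mathcal H_{\Lambda;\widehat{\boldsymbol\lambda}}(\sigma)}$ over all $\sigma\in\Omega$ that equal $\eta$ off $\Lambda$, and let $\mu^{\eta}_{\Lambda;\widehat{\boldsymbol\lambda}}$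 be the corresponding finite-volume Gibbs measure. A sequence of finite sets invades $\mathbb H^d_+$ if it eventually contains each finite subset. The set of Gibbs measures is the weak$^*$-closed convex hull of all weak$^*$ limits of $\mu^{\eta}_{\Lambda_k';\widehat{\boldsymbol\lambda}}$, where $\eta\in\Omega$ and $(\Lambda_k')_k$ invades $\mathbb H^d_+$. Let $\Lambda_n=[-n,n]^{d-1}\times[1,n]$, $\mathcal W_n=[-n,n]^{d-1}\times\{1\}$ and $\Delta_n=[-n,n]^{d-1}\times[1-n,n]$ (integer boxes), and let $Q^{\pm}_{\Delta_n}$ be the partition function of the Ising model on $\mathbb Z^d$ in $\Delta_n$ with interaction $J$, zero field and $\pm$ boundary condition. Define $$\langle\cdot\rangle^{\pm}_{J,\widehat{\boldsymbol\lambda}}=\lim_{n\to\infty}\mu^{\pm}_{\Lambda_n;\widehat{\boldsymbol\lambda}},\qquad F^{\pm}(J,\widehat{\boldsymbol\lambda})=\lim_{n\to\infty}-\frac1{2|\mathcal W_n|}\ln\frac{\bigl(\mathcal Z^{\pm}_{\Lambda_n;\widehat{\boldsymbol\lambda}}\bigr)^2}{Q^{\pm}_{\Delta_n}},\qquad \tau_w(J,\widehat{\boldsymbol\lambda})=F^-(J,\widehat{\boldsymbol\lambda})-F^+(J,\widehat{\boldsymbol\lambda}),$$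 $$\overline\lambda_c=\inf\Bigl\{\lambda\ge 0:\ \tau_w(J,\widehat{\boldsymbol\lambda})=\max_{s\ge 0}\tau_w(J,\widehat{\boldsymbol s})\Bigr\},$$ where the limits defining $\langle\cdot\rangle^\pm$ are in the weak$^*$ sense. Then these limits exist for every $\lambda\ge0$, the maximum is attained (so $\overline\lambda_c$ is a well-defined finite number), and: 1. for every $0\le\lambda<\overline\lambda_c$, $\ \langle\cdot\rangle^{+}_{J,\widehat{\boldsymbol\lambda}}\neq\langle\cdot\rangle^{-}_{J,\widehat{\boldsymbol\lambda}}$; 2. for every $\lambda>\overline\lambda_c$, $\ \langle\cdot\rangle^{+}_{J,\widehat{\boldsymbol\lambda}}=\langle\cdot\rangle^{-}_{J,\widehat{\boldsymbol\lambda}}$, and there is exactly one Gibbs measure. -/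

import Mathlib

open MeasureTheory Filter Topology

namespace SemiInfIsing

noncomputable section

/-! ### Ising models on a locally finite graph

A configuration is a map `V → Bool`; `true` stands for spin `+1` and `false` for spin `-1`. -/

/-- The value `±1` of a spin. -/
def spin (b : Bool) : ℝ := if b then 1 else -1

/-- Configurations on the vertex set `V`, with the product topology and product `σ`-algebra. -/
abbrev Config (V : Type) : Type := V → Bool

/-- The product `σ_i σ_j` along the unordered pair `{i, j}`. -/
def bondProduct {V : Type} (σ : Config V) : Sym2 V → ℝ :=
  Sym2.lift ⟨fun i j => spin (σ i) * spin (σ j), fun _ _ => mul_comm _ _⟩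

open Classical in
/-- The edges `{i, j}` of `G` with `{i, j} ∩ Λ ≠ ∅`. -/
def edgesMeeting {V : Type} (G : SimpleGraph V) [G.LocallyFinite] (Λ : Finset V) :
    Finset (Sym2 V) :=
  Λ.biUnion fun i => G.incidenceFinset i

/-- The Ising Hamiltonian in `Λ`, with uniform interaction `J` and external field `h`. -/
def isingHamiltonian {V : Type} (G : SimpleGraph V) [G.LocallyFinite] (J : ℝ) (h : V → ℝ)
    (Λ : Finset V) (σ : Config V) : ℝ :=
  -(∑ e ∈ edgesMeeting G Λ, J * bondProduct σ e) - ∑ i ∈ Λ, h i * spin (σ i)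

open Classical in
/-- The configuration equal to `τ` in `Λ` and to `η` outside `Λ`. As `τ` varies, these are
exactly the elements of `Ω_Λ^η`, each obtained once. -/
def glue {V : Type} (Λ : Finset V) (η : Config V) (τ : Λ → Bool) : Config V :=
  fun i => if hi : i ∈ Λ then τ ⟨i, hi⟩ else η i

open Classical in
/-- The partition function in `Λ` with boundary condition `η` for the energy `E`
(inverse temperature `1`). -/
def partitionFn {V : Type} (E : Config V → ℝ) (Λ : Finset V) (η : Config V) : ℝ :=
  ∑ τ : Λ → Bool, Real.exp (-E (glue Λ η τ))

lemma partitionFn_pos {V : Type} (E : Config V → ℝ) (Λ : Finset V) (η : Config V) :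
    0 < partitionFn E Λ η := by
  classical
  unfold partitionFn
  exact Finset.sum_pos (fun _ _ => Real.exp_pos _) Finset.univ_nonempty

open Classical in
/-- The measure giving mass `exp (-E σ) / Z` to each `σ ∈ Ω_Λ^η`. -/
def gibbsMeasureAux {V : Type} (E : Config V → ℝ) (Λ : Finset V) (η : Config V) :
    Measure (Config V) :=
  ∑ τ : Λ → Bool,
    ENNReal.ofReal (Real.exp (-E (glue Λ η τ)) / partitionFn E Λ η) •
      Measure.dirac (glue Λ η τ)

lemma isProbabilityMeasure_gibbsMeasureAux {V : Type} (E : Config V → ℝ) (Λ : Finset V)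
    (η : Config V) : IsProbabilityMeasure (gibbsMeasureAux E Λ η) := by
  classical
  refine ⟨?_⟩
  have hZ := partitionFn_pos E Λ η
  simp only [gibbsMeasureAux, Measure.coe_finsetSum, Finset.sum_apply, Measure.smul_apply,
    measure_univ, smul_eq_mul, mul_one]
  rw [← ENNReal.ofReal_sum_of_nonneg (fun τ _ => div_nonneg (Real.exp_pos _).le hZ.le),
    ← Finset.sum_div]
  have : (∑ τ : Λ → Bool, Real.exp (-E (glue Λ η τ))) = partitionFn E Λ η := by
    unfold partitionFn
    congr!
  rw [this, div_self hZ.ne', ENNReal.ofReal_one]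

/-- The finite-volume Gibbs measure in `Λ` with boundary condition `η` for the energy `E`. -/
def gibbsMeasure {V : Type} (E : Config V → ℝ) (Λ : Finset V) (η : Config V) :
    ProbabilityMeasure (Config V) :=
  ⟨gibbsMeasureAux E Λ η, isProbabilityMeasure_gibbsMeasureAux E Λ η⟩

/-- The all-plus configuration. -/
def plusConfig (V : Type) : Config V := fun _ => true

/-- The all-minus configuration. -/
def minusConfig (V : Type) : Config V := fun _ => false

/-! ### The lattices `ℤ^d` and `ℍ^d_+` -/

/-- The lattice `ℤ^d = ℤ^(d-1) × ℤ`; the second component is the last coordinate `i_d`. -/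
abbrev Lattice (d : ℕ) : Type := (Fin (d - 1) → ℤ) × ℤ

/-- The nearest neighbour graph of `ℤ^d`: `i ∼ j` iff their `ℓ¹`-distance is `1`. -/
def latticeGraph (d : ℕ) : SimpleGraph (Lattice d) where
  Adj i j := (∑ k, |i.1 k - j.1 k|) + |i.2 - j.2| = 1
  symm := ⟨fun i j hij => by
    simpa only [abs_sub_comm] using hij⟩
  loopless := ⟨fun i hi => by simp at hi⟩

lemma finite_neighborSet_latticeGraph (d : ℕ) (i : Lattice d) :
    ((latticeGraph d).neighborSet i).Finite := by
  have hfin : ((Set.Icc (fun k => i.1 k - 1) (fun k => i.1 k + 1)) ×ˢ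
      (Set.Icc (i.2 - 1) (i.2 + 1)) : Set (Lattice d)).Finite :=
    (Set.finite_Icc _ _).prod (Set.finite_Icc _ _)
  refine hfin.subset ?_
  intro j hj
  have hj' : (∑ k, |i.1 k - j.1 k|) + |i.2 - j.2| = 1 := hj
  have h0 : 0 ≤ ∑ k, |i.1 k - j.1 k| := Finset.sum_nonneg fun _ _ => abs_nonneg _
  have hk : ∀ k, |i.1 k - j.1 k| ≤ 1 := fun k => by
    have := Finset.single_le_sum (f := fun k => |i.1 k - j.1 k|)
      (fun _ _ => abs_nonneg _) (Finset.mem_univ k)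
    have h2 := abs_nonneg (i.2 - j.2)
    linarith
  have h2 : |i.2 - j.2| ≤ 1 := by linarith
  rw [abs_le] at h2
  refine ⟨⟨fun k => ?_, fun k => ?_⟩, ?_, ?_⟩
  · have := abs_le.1 (hk k); simp only; linarith
  · have := abs_le.1 (hk k); simp only; linarith
  · linarith
  · linarith

instance (d : ℕ) : (latticeGraph d).LocallyFinite :=
  fun i => (finite_neighborSet_latticeGraph d i).fintype

/-- The half-space `ℍ^d_+ = {i ∈ ℤ^d : i_d ≥ 1}`. -/
abbrev HalfSpace (d : ℕ) : Type := {i : Lattice d // 1 ≤ i.2}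

/-- The nearest neighbour graph of `ℍ^d_+`. -/
def halfGraph (d : ℕ) : SimpleGraph (HalfSpace d) := (latticeGraph d).comap Subtype.val

instance (d : ℕ) : (halfGraph d).LocallyFinite := fun i =>
  ((finite_neighborSet_latticeGraph d i.1).preimage
    (Subtype.val_injective.injOn) : ((halfGraph d).neighborSet i).Finite).fintype

/-- The box `Λ_n = {i ∈ ℍ^d_+ : i_d ≤ n, -n ≤ i_k ≤ n for k < d}`. -/
def box (d n : ℕ) : Finset (HalfSpace d) :=
  Finset.subtype (fun i : Lattice d => 1 ≤ i.2)
    (Finset.Icc (fun _ => -(n : ℤ)) (fun _ => (n : ℤ)) ×ˢ Finset.Icc (1 : ℤ) n)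

/-- The extended box `Δ_n`: the union of `Λ_n` and its reflection through `i_d = 1/2`, that is
`[-n, n]^(d-1) × [1 - n, n]`. -/
def doubleBox (d n : ℕ) : Finset (Lattice d) :=
  Finset.Icc (fun _ => -(n : ℤ)) (fun _ => (n : ℤ)) ×ˢ Finset.Icc (1 - (n : ℤ)) n

/-- The wall `𝒲_n = [-n, n]^(d-1) × {1}` of the box `Λ_n`. -/
def wallBox (d n : ℕ) : Finset (Lattice d) :=
  Finset.Icc (fun _ => -(n : ℤ)) (fun _ => (n : ℤ)) ×ˢ {(1 : ℤ)}

/-! ### The semi-infinite Ising model -/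

/-- The Hamiltonian of the semi-infinite model in `Λ`, with interaction `J`, wall influence
`wall` and external field `h`. -/
def hamiltonian (d : ℕ) (J wall : ℝ) (h : HalfSpace d → ℝ) (Λ : Finset (HalfSpace d))
    (σ : Config (HalfSpace d)) : ℝ :=
  isingHamiltonian (halfGraph d) J h Λ σ - ∑ i ∈ Λ with i.1.2 = 1, wall * spin (σ i)

/-- The partition function of the semi-infinite model. -/
def halfPartition (d : ℕ) (J wall : ℝ) (h : HalfSpace d → ℝ) (Λ : Finset (HalfSpace d))
    (η : Config (HalfSpace d)) : ℝ :=
  partitionFn (hamiltonian d J wall h Λ) Λ η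

/-- The partition function `Q` of the Ising model on `ℤ^d`. -/
def fullPartition (d : ℕ) (J : ℝ) (h : Lattice d → ℝ) (Λ : Finset (Lattice d))
    (η : Config (Lattice d)) : ℝ :=
  partitionFn (isingHamiltonian (latticeGraph d) J h Λ) Λ η

/-- The finite-volume Gibbs measure of the semi-infinite model. -/
def halfGibbs (d : ℕ) (J wall : ℝ) (h : HalfSpace d → ℝ) (Λ : Finset (HalfSpace d))
    (η : Config (HalfSpace d)) : ProbabilityMeasure (Config (HalfSpace d)) :=
  gibbsMeasure (hamiltonian d J wall h Λ) Λ η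

/-- A sequence of finite sets invades `V` if it eventually contains every finite subset. -/
def Invades {V : Type} (Λ : ℕ → Finset V) : Prop :=
  ∀ A : Finset V, ∃ N, ∀ n, N < n → A ⊆ Λ n

/-- Weak limits of finite-volume Gibbs measures along sequences invading the half-space. -/
def limitGibbs (d : ℕ) (J wall : ℝ) (h : HalfSpace d → ℝ) :
    Set (ProbabilityMeasure (Config (HalfSpace d))) :=
  {μ | ∃ (η : Config (HalfSpace d)) (Λ : ℕ → Finset (HalfSpace d)), Invades Λ ∧
    Tendsto (fun n => halfGibbs d J wall h (Λ n) η) atTop (𝓝 μ)}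

/-- The set of Gibbs measures: the weakly closed convex hull of the limits above. (The hull is
taken among finite measures, where convex combinations make sense.) -/
def gibbsSet (d : ℕ) (J wall : ℝ) (h : HalfSpace d → ℝ) :
    Set (ProbabilityMeasure (Config (HalfSpace d))) :=
  {μ | μ.toFiniteMeasure ∈ closure
    (convexHull NNReal (ProbabilityMeasure.toFiniteMeasure '' limitGibbs d J wall h))}

/-- The plus state: the weak limit of the Gibbs measures in `Λ_n` with plus boundary condition. -/
def plusState (d : ℕ) (J wall : ℝ) (h : HalfSpace d → ℝ) :
    ProbabilityMeasure (Config (HalfSpace d)) :=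
  limUnder atTop fun n => halfGibbs d J wall h (box d n) (plusConfig _)

/-- The minus state: the weak limit of the Gibbs measures in `Λ_n` with minus boundary
condition. -/
def minusState (d : ℕ) (J wall : ℝ) (h : HalfSpace d → ℝ) :
    ProbabilityMeasure (Config (HalfSpace d)) :=
  limUnder atTop fun n => halfGibbs d J wall h (box d n) (minusConfig _)

/-! ### Wall free energy and critical value -/

/-- The sequence whose limit is the surface free energy `F⁺`. -/
def surfacePlusSeq (d : ℕ) (J wall : ℝ) (h : HalfSpace d → ℝ) (n : ℕ) : ℝ :=
  -(1 / (2 * ((wallBox d n).card : ℝ))) *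
    Real.log (halfPartition d J wall h (box d n) (plusConfig _) ^ 2 /
      fullPartition d J 0 (doubleBox d n) (plusConfig _))

/-- The sequence whose limit is the surface free energy `F⁻`. -/
def surfaceMinusSeq (d : ℕ) (J wall : ℝ) (h : HalfSpace d → ℝ) (n : ℕ) : ℝ :=
  -(1 / (2 * ((wallBox d n).card : ℝ))) *
    Real.log (halfPartition d J wall h (box d n) (minusConfig _) ^ 2 /
      fullPartition d J 0 (doubleBox d n) (minusConfig _))

/-- The surface free energy `F⁺`. -/
def surfacePlus (d : ℕ) (J wall : ℝ) (h : HalfSpace d → ℝ) : ℝ :=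
  limUnder atTop (surfacePlusSeq d J wall h)

/-- The surface free energy `F⁻`. -/
def surfaceMinus (d : ℕ) (J wall : ℝ) (h : HalfSpace d → ℝ) : ℝ :=
  limUnder atTop (surfaceMinusSeq d J wall h)

/-- The wall free energy `τ_w = F⁻ - F⁺`. -/
def wallFreeEnergy (d : ℕ) (J wall : ℝ) (h : HalfSpace d → ℝ) : ℝ :=
  surfaceMinus d J wall h - surfacePlus d J wall h

/-- The decaying field `i ↦ lam / i_d ^ δ`. -/
def decayField (d : ℕ) (δ lam : ℝ) : HalfSpace d → ℝ :=
  fun i => lam / (i.1.2 : ℝ) ^ δ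

/-- The `lam ≥ 0` at which the wall free energy of the decaying field attains its maximum over
`[0, ∞)`. The first layer of the field plays the role of the wall influence, so the separate
parameter `wall` is `0`. -/
def maximizers (d : ℕ) (J δ : ℝ) : Set ℝ :=
  {lam | 0 ≤ lam ∧ ∀ s, 0 ≤ s →
    wallFreeEnergy d J 0 (decayField d δ s) ≤ wallFreeEnergy d J 0 (decayField d δ lam)}

/-- The critical value: the infimum of the maximizers. -/
def criticalValue (d : ℕ) (J δ : ℝ) : ℝ := sInf (maximizers d J δ)

end

end SemiInfIsing

open MeasureTheory Filter Topology

namespace SemiInfIsing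

/-! ### Finite-volume expectations -/

section Basic

open scoped Classical

noncomputable section

variable {V : Type}

/-! The wall free energy is the integral of a magnetisation gap. Spin flip gives `Q⁺ = Q⁻`, so
`τ_w(lam)` is the limit of `log (Z⁺ / Z⁻)` per wall site. This logarithm vanishes at zero field, and
differentiating in the field strength gives `τ_w(lam) = ∫ t in 0..lam, g t`
(`wallFreeEnergy_eq_integral`). Here `g = wallGap` sums over the layers `ℓ` the weight `1 / (ℓ + 1)
^ δ` times the difference of the magnetisations in that layer between the plus and minus states.
Summability, that is `δ > 1`, makes the field a surface perturbation.

Three properties of `g` carry the theorem. It is nonnegative by FKG. It is antitone on `[0, ∞)` by a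
four-replica correlation inequality (`gibbsAvg_plus_sub_minus_antitone`), so `τ_w` is nondecreasing
and concave there. It vanishes beyond `J` (`gapLim_decayField_eq_zero`), so the maximum is attained.
Hence a zero of `g` on `[0, ∞)` is a maximizer, and `g` vanishes strictly to the right of any
maximizer. Finally `g lam = 0` says that the magnetisation gap vanishes at every site, which by FKG
is equivalent to equality of the plus and minus states and then leaves a single Gibbs measure.

Vanishing beyond `J` is a free energy comparison. Such a field dominates a wall field `J` plus some
`s > 0` on the lowest `L` layers. The extra `s` raises `log (Z⁺ / Z⁻)` by at least `s` times the gap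
per wall site. On the other hand, the event that these layers are all plus is more likely under plus
than under minus boundary conditions. On that event the box above sees a wall of plus spins, which
is a wall field `J`, so up to a lateral boundary term `log (Z⁺ / Z⁻)` is at most its value for the
wall field `J` alone (`logRatio_halfBox_le`). The gap is therefore zero.

Existence of the surface free energies uses two interpolations. At zero field, the bonds crossing
the midplane of the double box are switched on from `0`, where the partition function is the square
of the half-space one, to full strength (`exists_tendsto_zero_field`); then the decaying field is
switched on. Both derivatives are spatial averages of local expectations, which converge by
monotonicity in the volume and horizontal translation invariance (`tendsto_cube_avg_of_antitone`).
-/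

lemma spin_true : spin true = 1 := rfl

lemma spin_false : spin false = -1 := rfl

lemma abs_spin (b : Bool) : |spin b| = 1 := by cases b <;> simp [spin]

lemma spin_not (b : Bool) : spin (!b) = -spin b := by cases b <;> simp [spin]

lemma spin_mono : Monotone spin := by
  intro a b hab
  cases a <;> cases b <;> first | exact absurd hab (by decide) | norm_num [spin]

lemma glue_of_mem {Λ : Finset V} {η : Config V} {τ : Λ → Bool} {i : V} (hi : i ∈ Λ) :
    glue Λ η τ i = τ ⟨i, hi⟩ := by simp [glue, hi]

lemma glue_of_notMem {Λ : Finset V} {η : Config V} {τ : Λ → Bool} {i : V} (hi : i ∉ Λ) :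
    glue Λ η τ i = η i := by simp [glue, hi]

lemma glue_congr {Λ : Finset V} {η η' : Config V} (h : ∀ i, i ∉ Λ → η i = η' i) (τ : Λ → Bool) :
    glue Λ η τ = glue Λ η' τ := by
  funext i
  by_cases hi : i ∈ Λ
  · simp [glue, hi]
  · simp [glue, hi, h i hi]

lemma glue_inf (Λ : Finset V) (η η' : Config V) (τ τ' : Λ → Bool) :
    glue Λ (η ⊓ η') (τ ⊓ τ') = glue Λ η τ ⊓ glue Λ η' τ' := by
  funext i
  by_cases hi : i ∈ Λ <;> simp [glue, hi]

lemma glue_sup (Λ : Finset V) (η η' : Config V) (τ τ' : Λ → Bool) :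
    glue Λ (η ⊔ η') (τ ⊔ τ') = glue Λ η τ ⊔ glue Λ η' τ' := by
  funext i
  by_cases hi : i ∈ Λ <;> simp [glue, hi]

lemma glue_mono {Λ : Finset V} {η η' : Config V} (hη : η ≤ η') {τ τ' : Λ → Bool} (hτ : τ ≤ τ') :
    glue Λ η τ ≤ glue Λ η' τ' := by
  intro i
  by_cases hi : i ∈ Λ
  · simpa [glue, hi] using hτ ⟨i, hi⟩
  · simpa [glue, hi] using hη i

/-- The unnormalised expectation of `f`. -/
def boltzSum (E : Config V → ℝ) (Λ : Finset V) (η : Config V) (f : Config V → ℝ) : ℝ :=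
  ∑ τ : Λ → Bool, Real.exp (-E (glue Λ η τ)) * f (glue Λ η τ)

/-- The finite-volume expectation of `f`. -/
def gibbsAvg (E : Config V → ℝ) (Λ : Finset V) (η : Config V) (f : Config V → ℝ) : ℝ :=
  boltzSum E Λ η f / partitionFn E Λ η

lemma boltzSum_one (E : Config V → ℝ) (Λ : Finset V) (η : Config V) :
    boltzSum E Λ η (fun _ => 1) = partitionFn E Λ η := by
  simp [boltzSum, partitionFn]

lemma gibbsAvg_const (E : Config V → ℝ) (Λ : Finset V) (η : Config V) (a : ℝ) :
    gibbsAvg E Λ η (fun _ => a) = a := by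
  have h := (partitionFn_pos E Λ η).ne'
  have : boltzSum E Λ η (fun _ => a) = a * partitionFn E Λ η := by
    simp [boltzSum, partitionFn, Finset.mul_sum, mul_comm]
  rw [gibbsAvg, this, mul_div_cancel_right₀ _ h]

lemma gibbsAvg_add (E : Config V → ℝ) (Λ : Finset V) (η : Config V) (f g : Config V → ℝ) :
    gibbsAvg E Λ η (fun σ => f σ + g σ) = gibbsAvg E Λ η f + gibbsAvg E Λ η g := by
  simp [gibbsAvg, boltzSum, mul_add, Finset.sum_add_distrib, add_div]

lemma gibbsAvg_mul_left (E : Config V → ℝ) (Λ : Finset V) (η : Config V) (a : ℝ)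
    (f : Config V → ℝ) : gibbsAvg E Λ η (fun σ => a * f σ) = a * gibbsAvg E Λ η f := by
  simp only [gibbsAvg, boltzSum, ← mul_div_assoc, Finset.mul_sum]
  congr 1
  exact Finset.sum_congr rfl fun _ _ => by ring

lemma gibbsAvg_neg (E : Config V → ℝ) (Λ : Finset V) (η : Config V) (f : Config V → ℝ) :
    gibbsAvg E Λ η (fun σ => -f σ) = -gibbsAvg E Λ η f := by
  simpa using gibbsAvg_mul_left E Λ η (-1) f

lemma gibbsAvg_sub (E : Config V → ℝ) (Λ : Finset V) (η : Config V) (f g : Config V → ℝ) :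
    gibbsAvg E Λ η (fun σ => f σ - g σ) = gibbsAvg E Λ η f - gibbsAvg E Λ η g := by
  simp only [sub_eq_add_neg]
  rw [gibbsAvg_add, gibbsAvg_neg]

lemma gibbsAvg_sum {ι : Type*} (E : Config V → ℝ) (Λ : Finset V) (η : Config V) (s : Finset ι)
    (f : ι → Config V → ℝ) :
    gibbsAvg E Λ η (fun σ => ∑ i ∈ s, f i σ) = ∑ i ∈ s, gibbsAvg E Λ η (f i) := by
  simp only [gibbsAvg, boltzSum, Finset.mul_sum, Finset.sum_div]
  rw [Finset.sum_comm]

lemma gibbsAvg_mono_fun (E : Config V → ℝ) (Λ : Finset V) (η : Config V) {f g : Config V → ℝ}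
    (h : ∀ σ, f σ ≤ g σ) : gibbsAvg E Λ η f ≤ gibbsAvg E Λ η g := by
  refine div_le_div_of_nonneg_right ?_ (partitionFn_pos E Λ η).le
  exact Finset.sum_le_sum fun τ _ => mul_le_mul_of_nonneg_left (h _) (Real.exp_pos _).le

lemma abs_gibbsAvg_le (E : Config V → ℝ) (Λ : Finset V) (η : Config V) {f : Config V → ℝ} {C : ℝ}
    (h : ∀ σ, |f σ| ≤ C) : |gibbsAvg E Λ η f| ≤ C := by
  rw [abs_le]
  constructor
  · rw [← gibbsAvg_const E Λ η (-C)]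
    exact gibbsAvg_mono_fun E Λ η fun σ => (abs_le.1 (h σ)).1
  · rw [← gibbsAvg_const E Λ η C]
    exact gibbsAvg_mono_fun E Λ η fun σ => (abs_le.1 (h σ)).2

lemma abs_gibbsAvg_spin_le (E : Config V → ℝ) (Λ : Finset V) (η : Config V) (i : V) :
    |gibbsAvg E Λ η (fun σ => spin (σ i))| ≤ 1 :=
  abs_gibbsAvg_le E Λ η fun _ => (abs_spin _).le

/-- The Ising energy with edge-dependent couplings `c` and field `h`. -/
def edgeEnergy (G : SimpleGraph V) [G.LocallyFinite] (c : Sym2 V → ℝ) (h : V → ℝ)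
    (Λ : Finset V) (σ : Config V) : ℝ :=
  -(∑ e ∈ edgesMeeting G Λ, c e * bondProduct σ e) - ∑ i ∈ Λ, h i * spin (σ i)

variable (G : SimpleGraph V) [G.LocallyFinite]

lemma mem_edgesMeeting {Λ : Finset V} {e : Sym2 V} :
    e ∈ edgesMeeting G Λ ↔ e ∈ G.edgeSet ∧ ∃ i ∈ Λ, i ∈ e := by
  simp only [edgesMeeting, Finset.mem_biUnion, SimpleGraph.mem_incidenceFinset,
    SimpleGraph.incidenceSet, Set.mem_ofPred_eq]
  tauto

lemma edgesMeeting_mono {Λ Λ' : Finset V} (h : Λ ⊆ Λ') : edgesMeeting G Λ ⊆ edgesMeeting G Λ' := by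
  intro e he
  rw [mem_edgesMeeting] at he ⊢
  obtain ⟨h1, i, hi, hie⟩ := he
  exact ⟨h1, i, h hi, hie⟩

lemma bondProduct_mk (σ : Config V) (i j : V) :
    bondProduct σ s(i, j) = spin (σ i) * spin (σ j) := rfl

lemma abs_bondProduct (σ : Config V) (e : Sym2 V) : |bondProduct σ e| = 1 := by
  induction e with | _ i j => rw [bondProduct_mk, abs_mul, abs_spin, abs_spin, one_mul]

lemma bondProduct_congr {σ σ' : Config V} {e : Sym2 V} (h : ∀ i ∈ e, σ i = σ' i) :
    bondProduct σ e = bondProduct σ' e := by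
  induction e with
  | _ i j => rw [bondProduct_mk, bondProduct_mk, h i (by simp), h j (by simp)]

/-- The part of the energy in `Λ'` that does not involve the spins in `Λ`. -/
def restEnergy (c : Sym2 V → ℝ) (h : V → ℝ) (Λ Λ' : Finset V) (σ : Config V) : ℝ :=
  -(∑ e ∈ edgesMeeting G Λ' \ edgesMeeting G Λ, c e * bondProduct σ e) -
    ∑ i ∈ Λ' \ Λ, h i * spin (σ i)

lemma edgeEnergy_eq_add_rest (c : Sym2 V → ℝ) (h : V → ℝ) {Λ Λ' : Finset V} (hΛ : Λ ⊆ Λ')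
    (σ : Config V) :
    edgeEnergy G c h Λ' σ = edgeEnergy G c h Λ σ + restEnergy G c h Λ Λ' σ := by
  simp only [edgeEnergy, restEnergy]
  rw [← Finset.sum_sdiff hΛ, ← Finset.sum_sdiff (edgesMeeting_mono G hΛ)]
  ring

lemma restEnergy_congr (c : Sym2 V → ℝ) (h : V → ℝ) (Λ Λ' : Finset V)
    {σ σ' : Config V} (hσ : ∀ i, i ∉ Λ → σ i = σ' i) :
    restEnergy G c h Λ Λ' σ = restEnergy G c h Λ Λ' σ' := by
  simp only [restEnergy]
  congr 1
  · congr 1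
    refine Finset.sum_congr rfl fun e he => ?_
    rw [Finset.mem_sdiff, mem_edgesMeeting, mem_edgesMeeting] at he
    rw [bondProduct_congr (σ' := σ')]
    intro i hi
    exact hσ i fun hiΛ => he.2 ⟨he.1.1, i, hiΛ, hi⟩
  · refine Finset.sum_congr rfl fun i hi => ?_
    rw [hσ i (Finset.mem_sdiff.1 hi).2]

/-- Summing over the configurations in `Λ'` that agree with `η` off `Λ`. -/
lemma sum_glue_restrict {Λ Λ' : Finset V} (hΛ : Λ ⊆ Λ') (η : Config V) (F : Config V → ℝ) :
    (∑ τ : Λ' → Bool, if ∀ i : Λ', i.1 ∉ Λ → τ i = η i then F (glue Λ' η τ) else 0) =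
      ∑ τ : Λ → Bool, F (glue Λ η τ) := by
  rw [← Finset.sum_filter]
  refine Finset.sum_bij' (fun τ _ => fun i : Λ => τ ⟨i.1, hΛ i.2⟩)
    (fun τ _ => fun i : Λ' => glue Λ η τ i) ?_ ?_ ?_ ?_ ?_
  · simp
  · intro τ _
    simp only [Finset.mem_filter, Finset.mem_univ, true_and]
    exact fun i hi => glue_of_notMem hi
  · intro τ hτ
    simp only [Finset.mem_filter, Finset.mem_univ, true_and] at hτ
    funext i
    by_cases hi : i.1 ∈ Λ
    · rw [glue_of_mem hi]
    · rw [glue_of_notMem hi, hτ i hi]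
  · intro τ _
    funext i
    simp only
    rw [glue_of_mem i.2]
  · intro τ hτ
    simp only [Finset.mem_filter, Finset.mem_univ, true_and] at hτ
    congr 1
    funext i
    by_cases hi : i ∈ Λ
    · rw [glue_of_mem hi, glue_of_mem (hΛ hi)]
    · rw [glue_of_notMem hi]
      by_cases hi' : i ∈ Λ'
      · rw [glue_of_mem hi', hτ ⟨i, hi'⟩ hi]
      · rw [glue_of_notMem hi']

/-- The Gibbs property: once the spins of `Λ' \ Λ` are frozen, the energy terms that do not touch
`Λ` are constant and factor out. -/
lemma boltzSum_restrict (c : Sym2 V → ℝ) (h : V → ℝ) {Λ Λ' : Finset V} (hΛ : Λ ⊆ Λ')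
    (η : Config V) (f : Config V → ℝ) :
    boltzSum (edgeEnergy G c h Λ') Λ' η
        (fun σ => if ∀ i ∈ Λ', i ∉ Λ → σ i = η i then f σ else 0) =
      Real.exp (-restEnergy G c h Λ Λ' η) * boltzSum (edgeEnergy G c h Λ) Λ η f := by
  have key := sum_glue_restrict hΛ η
    (fun σ => Real.exp (-edgeEnergy G c h Λ' σ) * f σ)
  rw [boltzSum, boltzSum, Finset.mul_sum]
  refine Eq.trans (Finset.sum_congr rfl fun τ _ => ?_) (key.trans
    (Finset.sum_congr rfl fun τ _ => ?_))
  · have : (∀ i ∈ Λ', i ∉ Λ → glue Λ' η τ i = η i) ↔ ∀ i : Λ', i.1 ∉ Λ → τ i = η i := by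
      constructor
      · intro H i hi
        rw [← H i.1 i.2 hi, glue_of_mem i.2]
      · intro H i hi hi'
        rw [glue_of_mem hi, H ⟨i, hi⟩ hi']
    simp only [this, mul_ite, mul_zero]
  · rw [edgeEnergy_eq_add_rest G c h hΛ, restEnergy_congr G c h Λ Λ' (σ' := η)
      (fun i hi => glue_of_notMem hi), neg_add, Real.exp_add]
    ring

/-! ### The FKG inequality -/

/-- Holley's inequality for unnormalised weights. Two functions `f ≤ g` are allowed because an
observable, read on the spins inside the volume, changes with the boundary condition. -/
lemma holley_div {α : Type*} [DistribLattice α] [Fintype α] {w₁ w₂ f g : α → ℝ}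
    (h₁ : ∀ a, 0 ≤ w₁ a) (h₂ : ∀ a, 0 ≤ w₂ a) (p₁ : 0 < ∑ a, w₁ a) (p₂ : 0 < ∑ a, w₂ a)
    (hw : ∀ a b, w₁ a * w₂ b ≤ w₁ (a ⊓ b) * w₂ (a ⊔ b)) (hg : Monotone g) (hfg : ∀ a, f a ≤ g a) :
    (∑ a, w₁ a * f a) / (∑ a, w₁ a) ≤ (∑ a, w₂ a * g a) / ∑ a, w₂ a := by
  set Z₁ := ∑ a, w₁ a
  set Z₂ := ∑ a, w₂ a
  -- `holley` asks for a nonnegative function. The shift by `C` provides it and cancels at the end,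
  -- since both weights are normalised.
  set C := ∑ a, |g a|
  have hC : ∀ a, 0 ≤ g a + C := fun a => by
    have h1 : |g a| ≤ C := Finset.single_le_sum (f := fun a => |g a|)
      (fun _ _ => abs_nonneg _) (Finset.mem_univ a)
    have := neg_abs_le (g a)
    linarith
  have key := holley (μ := fun a => g a + C) (f := fun a => w₁ a / Z₁) (g := fun a => w₂ a / Z₂)
    hC (fun a => div_nonneg (h₁ a) p₁.le) (fun a => div_nonneg (h₂ a) p₂.le)
    (fun a b hab => by simpa using hg hab)
    (by rw [← Finset.sum_div, ← Finset.sum_div, div_self p₁.ne', div_self p₂.ne'])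
    (fun a b => by
      simp only [div_mul_div_comm]
      exact div_le_div_of_nonneg_right (hw a b) (mul_nonneg p₁.le p₂.le))
  have e : ∀ (w : α → ℝ) (Z : ℝ), Z = ∑ a, w a → 0 < Z →
      ∑ a, (g a + C) * (w a / Z) = (∑ a, w a * g a) / Z + C := by
    intro w Z hZ hp
    have h1 : ∀ a, (g a + C) * (w a / Z) = (w a * g a) / Z + C * (w a / Z) := fun a => by ring
    simp only [h1, Finset.sum_add_distrib, ← Finset.sum_div, ← Finset.mul_sum]
    rw [← hZ, div_self hp.ne', mul_one]
  rw [e w₁ Z₁ rfl p₁, e w₂ Z₂ rfl p₂] at key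
  have h3 : (∑ a, w₁ a * f a) / Z₁ ≤ (∑ a, w₁ a * g a) / Z₁ :=
    div_le_div_of_nonneg_right
      (Finset.sum_le_sum fun a _ => mul_le_mul_of_nonneg_left (hfg a) (h₁ a)) p₁.le
  linarith

lemma bondProduct_supermodular (a b : Config V) (e : Sym2 V) :
    bondProduct a e + bondProduct b e ≤ bondProduct (a ⊓ b) e + bondProduct (a ⊔ b) e := by
  induction e with
  | _ i j =>
    simp only [bondProduct_mk, Pi.inf_apply, Pi.sup_apply]
    cases a i <;> cases a j <;> cases b i <;> cases b j <;> simp [spin] <;> norm_num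

/-- The lattice condition of Holley's inequality. Bonds contribute by ferromagnetism. In the field
term only sites with `a` plus and `b` minus matter: there the exchange trades `h - h'` for `h' - h`.
-/
lemma edgeEnergy_submodular {c : Sym2 V → ℝ} (hc : ∀ e, 0 ≤ c e) {h h' : V → ℝ} {Λ : Finset V}
    (hh : ∀ i ∈ Λ, h i ≤ h' i) (a b : Config V) :
    edgeEnergy G c h Λ (a ⊓ b) + edgeEnergy G c h' Λ (a ⊔ b) ≤
      edgeEnergy G c h Λ a + edgeEnergy G c h' Λ b := by
  have h1 : ∑ e ∈ edgesMeeting G Λ, (c e * bondProduct a e + c e * bondProduct b e) ≤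
      ∑ e ∈ edgesMeeting G Λ, (c e * bondProduct (a ⊓ b) e + c e * bondProduct (a ⊔ b) e) := by
    refine Finset.sum_le_sum fun e _ => ?_
    have := mul_le_mul_of_nonneg_left (bondProduct_supermodular a b e) (hc e)
    linarith
  have h2 : ∑ i ∈ Λ, (h i * spin (a i) + h' i * spin (b i)) ≤
      ∑ i ∈ Λ, (h i * spin ((a ⊓ b) i) + h' i * spin ((a ⊔ b) i)) := by
    refine Finset.sum_le_sum fun i hi => ?_
    have := hh i hi
    simp only [Pi.inf_apply, Pi.sup_apply]
    cases a i <;> cases b i <;> simp [spin] <;> linarith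
  simp only [Finset.sum_add_distrib] at h1 h2
  simp only [edgeEnergy]
  linarith

theorem gibbsAvg_mono {c : Sym2 V → ℝ} (hc : ∀ e, 0 ≤ c e) {h h' : V → ℝ} {Λ : Finset V}
    (hh : ∀ i ∈ Λ, h i ≤ h' i) {η η' : Config V} (hη : η ≤ η') {f : Config V → ℝ}
    (hf : Monotone f) :
    gibbsAvg (edgeEnergy G c h Λ) Λ η f ≤ gibbsAvg (edgeEnergy G c h' Λ) Λ η' f := by
  unfold gibbsAvg boltzSum partitionFn
  refine holley_div (fun _ => (Real.exp_pos _).le) (fun _ => (Real.exp_pos _).le)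
    (partitionFn_pos (edgeEnergy G c h Λ) Λ η) (partitionFn_pos (edgeEnergy G c h' Λ) Λ η')
    (fun a b => ?_)
    (fun a b hab => hf (glue_mono le_rfl hab)) (fun a => hf (glue_mono hη le_rfl))
  rw [← Real.exp_add, ← Real.exp_add, Real.exp_le_exp]
  have := edgeEnergy_submodular G hc hh (glue Λ η a) (glue Λ η' b)
  rw [← glue_inf, ← glue_sup, inf_eq_left.2 hη, sup_eq_right.2 hη] at this
  linarith

/-- Enlarging the volume lowers the expectation of an increasing function under the plus
boundary condition. -/
theorem gibbsAvg_plus_antitone {c : Sym2 V → ℝ} (hc : ∀ e, 0 ≤ c e) (h : V → ℝ)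
    {Λ Λ' : Finset V} (hΛ : Λ ⊆ Λ') {f : Config V → ℝ} (hf : Monotone f) :
    gibbsAvg (edgeEnergy G c h Λ') Λ' (plusConfig V) f ≤
      gibbsAvg (edgeEnergy G c h Λ) Λ (plusConfig V) f := by
  set η := plusConfig V
  set E := edgeEnergy G c h Λ'
  -- The plus measure in `Λ` is the one in `Λ'` conditioned on plus spins in `Λ' \ Λ`. This event is
  -- increasing, so multiplying the second weight by its indicator preserves Holley's condition.
  let χ : Config V → ℝ := fun σ => if ∀ i ∈ Λ', i ∉ Λ → σ i = η i then 1 else 0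
  have hχ0 : ∀ σ, 0 ≤ χ σ := fun σ => by simp only [χ]; split_ifs <;> norm_num
  have hχ : ∀ a b, χ b ≤ χ (a ⊔ b) := fun a b => by
    simp only [χ]
    by_cases hb : ∀ i ∈ Λ', i ∉ Λ → b i = η i
    · rw [if_pos hb, if_pos]
      intro i hi hi'
      simp [hb i hi hi', η, plusConfig]
    · rw [if_neg hb]; split_ifs <;> norm_num
  have e : ∀ f : Config V → ℝ, ∑ τ : Λ' → Bool,
      Real.exp (-E (glue Λ' η τ)) * χ (glue Λ' η τ) * f (glue Λ' η τ) =
        Real.exp (-restEnergy G c h Λ Λ' η) * boltzSum (edgeEnergy G c h Λ) Λ η f := by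
    intro f
    rw [← boltzSum_restrict G c h hΛ η f]
    refine Finset.sum_congr rfl fun τ _ => ?_
    simp only [χ]
    split_ifs <;> ring
  have e1 : ∑ τ : Λ' → Bool, Real.exp (-E (glue Λ' η τ)) * χ (glue Λ' η τ) =
      Real.exp (-restEnergy G c h Λ Λ' η) * partitionFn (edgeEnergy G c h Λ) Λ η := by
    have := e fun _ => 1
    simpa [boltzSum_one] using this
  have key := holley_div (α := Λ' → Bool) (w₁ := fun τ => Real.exp (-E (glue Λ' η τ)))
    (w₂ := fun τ => Real.exp (-E (glue Λ' η τ)) * χ (glue Λ' η τ))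
    (f := fun τ => f (glue Λ' η τ)) (g := fun τ => f (glue Λ' η τ))
    (fun _ => (Real.exp_pos _).le) (fun _ => mul_nonneg (Real.exp_pos _).le (hχ0 _))
    (partitionFn_pos E Λ' η)
    (by rw [e1]; exact mul_pos (Real.exp_pos _) (partitionFn_pos _ _ _))
    (fun a b => by
      rw [← mul_assoc, ← mul_assoc, ← Real.exp_add, ← Real.exp_add]
      have h1 := edgeEnergy_submodular G hc (h := h) (h' := h) (Λ := Λ') (fun _ _ => le_rfl)
        (glue Λ' η a) (glue Λ' η b)
      have h2 := hχ (glue Λ' η a) (glue Λ' η b)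
      rw [← glue_sup, sup_idem] at h1 h2
      rw [← glue_inf, inf_idem] at h1
      refine mul_le_mul (Real.exp_le_exp.2 ?_) h2 (hχ0 _) (Real.exp_pos _).le
      simp only [E]
      linarith)
    (fun a b hab => hf (glue_mono le_rfl hab)) (fun _ => le_rfl)
  rw [e f, e1, mul_div_mul_left _ _ (Real.exp_pos _).ne'] at key
  exact key

/-! ### Spin flip -/

/-- The configuration with all spins flipped. -/
def flip (σ : Config V) : Config V := fun i => !σ i

lemma flip_antitone : Antitone (flip : Config V → Config V) := by
  intro a b hab i
  have := hab i
  simp only [flip]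
  cases h1 : a i <;> cases h2 : b i <;> simp_all

lemma flip_plusConfig : flip (plusConfig V) = minusConfig V := rfl

lemma edgeEnergy_flip (c : Sym2 V → ℝ) (h : V → ℝ) (Λ : Finset V) (σ : Config V) :
    edgeEnergy G c h Λ (flip σ) = edgeEnergy G c (fun i => -h i) Λ σ := by
  have h1 : ∀ e, bondProduct (flip σ) e = bondProduct σ e := fun e => by
    induction e with | _ i j => simp [bondProduct_mk, flip, spin_not]
  simp only [edgeEnergy, h1]
  simp [flip, spin_not]

lemma sum_glue_flip (Λ : Finset V) (η : Config V) (F : Config V → ℝ) :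
    ∑ τ : Λ → Bool, F (glue Λ (flip η) τ) = ∑ τ : Λ → Bool, F (flip (glue Λ η τ)) := by
  refine Finset.sum_bij' (fun τ _ => fun i => !τ i) (fun τ _ => fun i => !τ i) ?_ ?_ ?_ ?_ ?_
  · simp
  · simp
  · simp
  · simp
  · intro τ _
    congr 1
    funext i
    by_cases hi : i ∈ Λ <;> simp [glue, flip, hi]

lemma boltzSum_flip (c : Sym2 V → ℝ) (h : V → ℝ) (Λ : Finset V) (η : Config V)
    (f : Config V → ℝ) :
    boltzSum (edgeEnergy G c h Λ) Λ (flip η) f =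
      boltzSum (edgeEnergy G c (fun i => -h i) Λ) Λ η (fun σ => f (flip σ)) := by
  simp only [boltzSum]
  rw [sum_glue_flip Λ η (fun σ => Real.exp (-edgeEnergy G c h Λ σ) * f σ)]
  simp only [edgeEnergy_flip]

lemma partitionFn_flip (c : Sym2 V → ℝ) (h : V → ℝ) (Λ : Finset V) (η : Config V) :
    partitionFn (edgeEnergy G c h Λ) Λ (flip η) =
      partitionFn (edgeEnergy G c (fun i => -h i) Λ) Λ η := by
  simpa only [boltzSum_one] using boltzSum_flip G c h Λ η fun _ => 1

lemma partitionFn_minus_eq_plus (c : Sym2 V → ℝ) (Λ : Finset V) :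
    partitionFn (edgeEnergy G c 0 Λ) Λ (minusConfig V) =
      partitionFn (edgeEnergy G c 0 Λ) Λ (plusConfig V) := by
  rw [← flip_plusConfig, partitionFn_flip]
  simp [Pi.zero_def]

lemma gibbsAvg_flip (c : Sym2 V → ℝ) (h : V → ℝ) (Λ : Finset V) (η : Config V)
    (f : Config V → ℝ) :
    gibbsAvg (edgeEnergy G c h Λ) Λ (flip η) f =
      gibbsAvg (edgeEnergy G c (fun i => -h i) Λ) Λ η (fun σ => f (flip σ)) := by
  rw [gibbsAvg, gibbsAvg, partitionFn_flip, boltzSum_flip]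

/-- The spin flip carries the minus condition with field `h` to the plus condition with field `-h`,
and the plus version places no sign condition on the field. -/
theorem gibbsAvg_minus_monotone {c : Sym2 V → ℝ} (hc : ∀ e, 0 ≤ c e) (h : V → ℝ)
    {Λ Λ' : Finset V} (hΛ : Λ ⊆ Λ') {f : Config V → ℝ} (hf : Monotone f) :
    gibbsAvg (edgeEnergy G c h Λ) Λ (minusConfig V) f ≤
      gibbsAvg (edgeEnergy G c h Λ') Λ' (minusConfig V) f := by
  have hf' : Monotone fun σ : Config V => -f (flip σ) := fun a b hab =>
    neg_le_neg (hf (flip_antitone hab))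
  have := gibbsAvg_plus_antitone G hc (fun i => -h i) hΛ hf'
  rw [gibbsAvg_neg, gibbsAvg_neg, ← gibbsAvg_flip, ← gibbsAvg_flip, flip_plusConfig] at this
  linarith

lemma minusConfig_le (η : Config V) : minusConfig V ≤ η := fun i => by simp [minusConfig]

lemma le_plusConfig (η : Config V) : η ≤ plusConfig V := fun i => by
  simp [plusConfig, Bool.le_true]

lemma monotone_spin_apply (i : V) : Monotone fun σ : Config V => spin (σ i) :=
  fun _ _ hab => spin_mono (hab i)

end

end Basic

/-! ### A four-replica correlation inequality -/

section PositiveCone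

noncomputable section

variable {ι S : Type*} [Fintype ι]

/-- The nonnegative multiples of products of one-site functions taken from `Q`. -/
def siteMonomials (ι : Type*) [Fintype ι] {S : Type*} (Q : Submonoid (S → ℝ)) :
    Submonoid ((ι → S) → ℝ) where
  carrier := {f | ∃ r : ℝ, 0 ≤ r ∧ ∃ q : ι → S → ℝ, (∀ i, q i ∈ Q) ∧
    f = fun x => r * ∏ i, q i (x i)}
  one_mem' := ⟨1, zero_le_one, fun _ => 1, fun _ => Q.one_mem, by funext x; simp⟩
  mul_mem' := by
    rintro f g ⟨r, hr, q, hq, rfl⟩ ⟨r', hr', q', hq', rfl⟩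
    refine ⟨r * r', mul_nonneg hr hr', fun i => q i * q' i, fun i => Q.mul_mem (hq i) (hq' i), ?_⟩
    funext x
    simp only [Pi.mul_apply, Finset.prod_mul_distrib]
    ring

/-- The convex cone generated by products of one-site functions taken from `Q`. -/
def siteCone (ι : Type*) [Fintype ι] {S : Type*} (Q : Submonoid (S → ℝ)) :
    Subsemiring ((ι → S) → ℝ) :=
  (siteMonomials ι Q).subsemiringClosure

lemma const_mem_siteCone (Q : Submonoid (S → ℝ)) {r : ℝ} (hr : 0 ≤ r) :
    (fun _ => r) ∈ siteCone ι Q := by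
  refine (Submonoid.subsemiringClosure_mem _).2 (AddSubmonoid.subset_closure ?_)
  exact ⟨r, hr, fun _ => 1, fun _ => Q.one_mem, by funext x; simp⟩

lemma apply_mem_siteCone [DecidableEq ι] (Q : Submonoid (S → ℝ)) {q : S → ℝ} (hq : q ∈ Q)
    (i : ι) : (fun x => q (x i)) ∈ siteCone ι Q := by
  refine (Submonoid.subsemiringClosure_mem _).2 (AddSubmonoid.subset_closure ?_)
  refine ⟨1, zero_le_one, fun j => if j = i then q else 1, fun j => ?_, ?_⟩
  · dsimp only
    split_ifs
    exacts [hq, Q.one_mem]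
  · funext x
    rw [Finset.prod_eq_single i] <;> simp +contextual

/-- On a generator, the sum over configurations factorises into a product of one-site sums. -/
lemma sum_nonneg_of_mem_siteCone [DecidableEq ι] [Fintype S] {Q : Submonoid (S → ℝ)}
    (hQ : ∀ q ∈ Q, 0 ≤ ∑ s, q s) {f : (ι → S) → ℝ} (hf : f ∈ siteCone ι Q) : 0 ≤ ∑ x, f x := by
  have hf' := (Submonoid.subsemiringClosure_mem _).1 hf
  clear hf
  induction hf' using AddSubmonoid.closure_induction with
  | mem f h =>
    obtain ⟨r, hr, q, hq, rfl⟩ := h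
    rw [← Finset.mul_sum]
    refine mul_nonneg hr ?_
    have := Fintype.piFinset_univ (α := ι) (β := fun _ => S)
    rw [← this, ← Finset.prod_univ_sum]
    exact Finset.prod_nonneg fun i _ => hQ _ (hq i)
  | zero => simp
  | add f g hf hg ihf ihg =>
    simp only [Pi.add_apply, Finset.sum_add_distrib]
    exact add_nonneg ihf ihg

/-- The cone is closed under products and sums, so it contains `f` times each partial sum of the
exponential series of `g`. This is Ginibre's method for correlation inequalities. -/
lemma sum_mul_exp_nonneg [DecidableEq ι] [Fintype S] {Q : Submonoid (S → ℝ)}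
    (hQ : ∀ q ∈ Q, 0 ≤ ∑ s, q s) {f g : (ι → S) → ℝ} (hf : f ∈ siteCone ι Q)
    (hg : g ∈ siteCone ι Q) : 0 ≤ ∑ x, f x * Real.exp (g x) := by
  have hlim : Tendsto (fun n : ℕ => ∑ x, f x * ∑ k ∈ Finset.range n, g x ^ k / k.factorial) atTop
      (𝓝 (∑ x, f x * Real.exp (g x))) := by
    refine tendsto_finsetSum _ fun x _ => Tendsto.const_mul _ ?_
    have := NormedSpace.expSeries_div_hasSum_exp (𝔸 := ℝ) (g x)
    rw [← Real.exp_eq_exp_ℝ] at this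
    exact this.tendsto_sum_nat
  refine ge_of_tendsto' hlim fun n => ?_
  have hmem : (f * ∑ k ∈ Finset.range n, (fun _ => (1 / k.factorial : ℝ)) * g ^ k) ∈
      siteCone ι Q := by
    refine Subsemiring.mul_mem _ hf (Subsemiring.sum_mem _ fun k _ => ?_)
    exact Subsemiring.mul_mem _ (const_mem_siteCone Q (by positivity)) (Subsemiring.pow_mem _ hg k)
  have := sum_nonneg_of_mem_siteCone hQ hmem
  convert! this using 2 with x
  simp only [Pi.mul_apply, Finset.sum_apply, Pi.pow_apply]
  congr 1
  exact Finset.sum_congr rfl fun k _ => by ring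

end

end PositiveCone

/-! ### Positivity of moments of four replicas and monotonicity of the magnetisation gap. -/

section Replicas

open scoped Classical

noncomputable section

/-- The spins of four replicas at one site. -/
abbrev FourSpins : Type := Bool × Bool × Bool × Bool

/-- `σ₁ + σ₂ + σ₃ + σ₄`. -/
def comb₁ (s : FourSpins) : ℝ := spin s.1 + spin s.2.1 + spin s.2.2.1 + spin s.2.2.2

/-- `σ₁ + σ₂ - σ₃ - σ₄`. -/
def comb₂ (s : FourSpins) : ℝ := spin s.1 + spin s.2.1 - spin s.2.2.1 - spin s.2.2.2

/-- `σ₁ - σ₂ + σ₃ - σ₄`. -/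
def comb₃ (s : FourSpins) : ℝ := spin s.1 - spin s.2.1 + spin s.2.2.1 - spin s.2.2.2

/-- `-σ₁ + σ₂ + σ₃ - σ₄`. -/
def comb₄ (s : FourSpins) : ℝ := -spin s.1 + spin s.2.1 + spin s.2.2.1 - spin s.2.2.2

/-- The monomials in the four combinations. -/
def fourMonomials : Submonoid (FourSpins → ℝ) where
  carrier := {q | ∃ a b c d : ℕ, q = comb₁ ^ a * comb₂ ^ b * comb₃ ^ c * comb₄ ^ d}
  one_mem' := ⟨0, 0, 0, 0, by simp⟩
  mul_mem' := by
    rintro _ _ ⟨a, b, c, d, rfl⟩ ⟨a', b', c', d', rfl⟩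
    exact ⟨a + a', b + b', c + c', d + d', by ring⟩

/-- Of the sixteen spin values, eight have an even number of minus signs: there exactly one
combination is nonzero, and it equals `4` or `-4`. On the other eight every combination is `2` or
`-2`, with sign patterns exactly those having an even number of minus signs. The overall sign chosen
in `comb₄` matters: reversing it would make the sum of the product of all four combinations
negative. -/
lemma sum_fourMonomials_nonneg {q : FourSpins → ℝ} (hq : q ∈ fourMonomials) : 0 ≤ ∑ s, q s := by
  obtain ⟨a, b, c, d, rfl⟩ := hq
  have hm : ∀ (x : ℝ) (n : ℕ), (-x) ^ n = (-1) ^ n * x ^ n := fun x n => by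
    rw [← neg_one_mul, mul_pow]
  have h1 : ∀ n : ℕ, (-1 : ℝ) ^ n = 1 ∨ (-1 : ℝ) ^ n = -1 := fun n => neg_one_pow_eq_or ℝ n
  have h2 : ∀ n : ℕ, (0 : ℝ) ≤ 1 + (-1) ^ n := fun n => by
    rcases h1 n with h | h <;> rw [h] <;> norm_num
  simp only [Fintype.sum_prod_type, Fintype.sum_bool, Pi.mul_apply, Pi.pow_apply, comb₁, comb₂,
    comb₃, comb₄, spin_true, spin_false]
  norm_num only
  rw [hm 4 a, hm 4 b, hm 4 c, hm 4 d, hm 2 a, hm 2 b, hm 2 c, hm 2 d]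
  have Pa : (0 : ℝ) ≤ (1 + (-1) ^ a) * (4 ^ a * 0 ^ b * 0 ^ c * 0 ^ d) :=
    mul_nonneg (h2 a) (by positivity)
  have Pb : (0 : ℝ) ≤ (1 + (-1) ^ b) * (0 ^ a * 4 ^ b * 0 ^ c * 0 ^ d) :=
    mul_nonneg (h2 b) (by positivity)
  have Pc : (0 : ℝ) ≤ (1 + (-1) ^ c) * (0 ^ a * 0 ^ b * 4 ^ c * 0 ^ d) :=
    mul_nonneg (h2 c) (by positivity)
  have Pd : (0 : ℝ) ≤ (1 + (-1) ^ d) * (0 ^ a * 0 ^ b * 0 ^ c * 4 ^ d) :=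
    mul_nonneg (h2 d) (by positivity)
  -- The sum over even sign patterns. With `x` running over the four signs, it is half of `∏ (1 + x)
  -- + ∏ (1 - x)`.
  have h3 : (0 : ℝ) ≤ 1 + (-1) ^ a * (-1) ^ b + (-1) ^ a * (-1) ^ c + (-1) ^ a * (-1) ^ d +
      (-1) ^ b * (-1) ^ c + (-1) ^ b * (-1) ^ d + (-1) ^ c * (-1) ^ d +
      (-1) ^ a * (-1) ^ b * (-1) ^ c * (-1) ^ d := by
    rcases h1 a with ha | ha <;> rcases h1 b with hb | hb <;> rcases h1 c with hc | hc <;>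
      rcases h1 d with hd | hd <;> rw [ha, hb, hc, hd] <;> norm_num
  have P := mul_nonneg h3 (by positivity : (0 : ℝ) ≤ 2 ^ a * 2 ^ b * 2 ^ c * 2 ^ d)
  refine (add_nonneg (add_nonneg (add_nonneg (add_nonneg Pa Pb) Pc) Pd) P).trans_eq ?_
  generalize (-1 : ℝ) ^ a = A
  generalize (-1 : ℝ) ^ b = B
  generalize (-1 : ℝ) ^ c = C
  generalize (-1 : ℝ) ^ d = D
  generalize (2 : ℝ) ^ a = a2, (2 : ℝ) ^ b = b2, (2 : ℝ) ^ c = c2, (2 : ℝ) ^ d = d2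
  generalize (4 : ℝ) ^ a = a4, (4 : ℝ) ^ b = b4, (4 : ℝ) ^ c = c4, (4 : ℝ) ^ d = d4
  generalize (0 : ℝ) ^ a = a0, (0 : ℝ) ^ b = b0, (0 : ℝ) ^ c = c0, (0 : ℝ) ^ d = d0
  ring

variable {V : Type} (G : SimpleGraph V) [G.LocallyFinite]

lemma sum_fourSpins {Λ : Finset V} (F : (Λ → FourSpins) → ℝ) :
    ∑ x, F x = ∑ τ₁ : Λ → Bool, ∑ τ₂ : Λ → Bool, ∑ τ₃ : Λ → Bool, ∑ τ₄ : Λ → Bool,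
      F fun i => (τ₁ i, τ₂ i, τ₃ i, τ₄ i) := by
  simp only [← Fintype.sum_prod_type']
  refine Finset.sum_bij' (fun x _ => ((fun i => (x i).1), (fun i => (x i).2.1),
      (fun i => (x i).2.2.1), (fun i => (x i).2.2.2)))
    (fun t _ => fun i => (t.1 i, t.2.1 i, t.2.2.1 i, t.2.2.2 i)) ?_ ?_ ?_ ?_ ?_ <;> simp

/-- The difference of the magnetisations under plus and minus boundary conditions decreases when
a nonnegative field is increased. -/
theorem gibbsAvg_plus_sub_minus_antitone {c : Sym2 V → ℝ} (hc : ∀ e, 0 ≤ c e) {h h' : V → ℝ}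
    {Λ : Finset V} (h0 : ∀ i ∈ Λ, 0 ≤ h i) (hh : ∀ i ∈ Λ, h i ≤ h' i) (i : V) :
    gibbsAvg (edgeEnergy G c h' Λ) Λ (plusConfig V) (fun σ => spin (σ i)) -
        gibbsAvg (edgeEnergy G c h' Λ) Λ (minusConfig V) (fun σ => spin (σ i)) ≤
      gibbsAvg (edgeEnergy G c h Λ) Λ (plusConfig V) (fun σ => spin (σ i)) -
        gibbsAvg (edgeEnergy G c h Λ) Λ (minusConfig V) (fun σ => spin (σ i)) := by
  let C := siteCone Λ fourMonomials
  -- Replicas 1 and 2 carry the larger field `h'`, replicas 3 and 4 the field `h`, with plus, minus,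
  -- plus, minus boundary conditions. The mean of `Δ` is then the gap at `h` minus the gap at `h'`.
  let σ₁ : (Λ → FourSpins) → Config V := fun x => glue Λ (plusConfig V) fun i => (x i).1
  let σ₂ : (Λ → FourSpins) → Config V := fun x => glue Λ (minusConfig V) fun i => (x i).2.1
  let σ₃ : (Λ → FourSpins) → Config V := fun x => glue Λ (plusConfig V) fun i => (x i).2.2.1
  let σ₄ : (Λ → FourSpins) → Config V := fun x => glue Λ (minusConfig V) fun i => (x i).2.2.2
  let A : V → (Λ → FourSpins) → ℝ := fun v x =>
    spin (σ₁ x v) + spin (σ₂ x v) + spin (σ₃ x v) + spin (σ₄ x v)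
  let B : V → (Λ → FourSpins) → ℝ := fun v x =>
    spin (σ₁ x v) + spin (σ₂ x v) - spin (σ₃ x v) - spin (σ₄ x v)
  let Γ : V → (Λ → FourSpins) → ℝ := fun v x =>
    spin (σ₁ x v) - spin (σ₂ x v) + spin (σ₃ x v) - spin (σ₄ x v)
  let Δ : V → (Λ → FourSpins) → ℝ := fun v x =>
    -spin (σ₁ x v) + spin (σ₂ x v) + spin (σ₃ x v) - spin (σ₄ x v)
  -- Off `Λ` the boundary spins give the constants `A = B = Δ = 0` and `Γ = 4`. None is negative, so
  -- boundary bonds also stay in the cone.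
  have hmem : ∀ v, A v ∈ C ∧ B v ∈ C ∧ Γ v ∈ C ∧ Δ v ∈ C := by
    intro v
    by_cases hv : v ∈ Λ
    · have m1 : comb₁ ∈ fourMonomials := ⟨1, 0, 0, 0, by simp⟩
      have m2 : comb₂ ∈ fourMonomials := ⟨0, 1, 0, 0, by simp⟩
      have m3 : comb₃ ∈ fourMonomials := ⟨0, 0, 1, 0, by simp⟩
      have m4 : comb₄ ∈ fourMonomials := ⟨0, 0, 0, 1, by simp⟩
      refine ⟨?_, ?_, ?_, ?_⟩
      · convert! apply_mem_siteCone fourMonomials m1 (⟨v, hv⟩ : Λ) using 1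
        funext x; simp [A, σ₁, σ₂, σ₃, σ₄, glue, hv, comb₁]
      · convert! apply_mem_siteCone fourMonomials m2 (⟨v, hv⟩ : Λ) using 1
        funext x; simp [B, σ₁, σ₂, σ₃, σ₄, glue, hv, comb₂]
      · convert! apply_mem_siteCone fourMonomials m3 (⟨v, hv⟩ : Λ) using 1
        funext x; simp [Γ, σ₁, σ₂, σ₃, σ₄, glue, hv, comb₃]
      · convert! apply_mem_siteCone fourMonomials m4 (⟨v, hv⟩ : Λ) using 1
        funext x; simp [Δ, σ₁, σ₂, σ₃, σ₄, glue, hv, comb₄]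
    · have z : (fun _ => (0 : ℝ)) ∈ C := const_mem_siteCone _ le_rfl
      have f : (fun _ => (4 : ℝ)) ∈ C := const_mem_siteCone _ (by norm_num)
      refine ⟨?_, ?_, ?_, ?_⟩
      · convert! z using 1
        funext x; simp [A, σ₁, σ₂, σ₃, σ₄, glue, hv, plusConfig, minusConfig, spin]
      · convert! z using 1
        funext x; simp [B, σ₁, σ₂, σ₃, σ₄, glue, hv, plusConfig, minusConfig, spin]
      · convert! f using 1
        funext x; simp [Γ, σ₁, σ₂, σ₃, σ₄, glue, hv, plusConfig, minusConfig, spin]; norm_num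
      · convert! z using 1
        funext x; simp [Δ, σ₁, σ₂, σ₃, σ₄, glue, hv, plusConfig, minusConfig, spin]
  let E := edgeEnergy G c h Λ
  let E' := edgeEnergy G c h' Λ
  let g : (Λ → FourSpins) → ℝ := fun x => -E' (σ₁ x) + -E' (σ₂ x) + -E (σ₃ x) + -E (σ₄ x)
  have hg : g ∈ C := by
    -- In the rotated variables the field coefficients are `(h' + h) / 2` and `(h' - h) / 2`. Their
    -- nonnegativity is where `0 ≤ h` and `h ≤ h'` are needed.
    have e1 : g = (∑ e ∈ edgesMeeting G Λ, fun x => c e * (bondProduct (σ₁ x) e +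
        bondProduct (σ₂ x) e + bondProduct (σ₃ x) e + bondProduct (σ₄ x) e)) +
        ∑ v ∈ Λ, ((fun _ => (h' v + h v) / 2) * A v + (fun _ => (h' v - h v) / 2) * B v) := by
      funext x
      simp only [g, E, E', edgeEnergy, Pi.add_apply, Finset.sum_apply, Pi.mul_apply, A, B]
      have : ∀ v, (h' v + h v) / 2 * (spin (σ₁ x v) + spin (σ₂ x v) + spin (σ₃ x v) +
          spin (σ₄ x v)) + (h' v - h v) / 2 * (spin (σ₁ x v) + spin (σ₂ x v) - spin (σ₃ x v) -
          spin (σ₄ x v)) = h' v * spin (σ₁ x v) + h' v * spin (σ₂ x v) + h v * spin (σ₃ x v) +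
          h v * spin (σ₄ x v) := fun v => by ring
      simp only [this]
      simp only [mul_add, Finset.sum_add_distrib]
      ring
    rw [e1]
    refine C.add_mem (C.sum_mem fun e _ => ?_) (C.sum_mem fun v hv => ?_)
    · induction e with
      | _ u v =>
        -- The sign matrix of the four combinations is twice an orthogonal matrix, so the sum of the
        -- four bond products is diagonal in the new variables.
        have : (fun x => c s(u, v) * (bondProduct (σ₁ x) s(u, v) + bondProduct (σ₂ x) s(u, v) +
            bondProduct (σ₃ x) s(u, v) + bondProduct (σ₄ x) s(u, v))) =
            (fun _ => c s(u, v) / 4) * (A u * A v + B u * B v + Γ u * Γ v + Δ u * Δ v) := by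
          funext x
          simp only [bondProduct_mk, Pi.mul_apply, Pi.add_apply, A, B, Γ, Δ]
          ring
        rw [this]
        obtain ⟨a1, a2, a3, a4⟩ := hmem u
        obtain ⟨b1, b2, b3, b4⟩ := hmem v
        exact C.mul_mem (const_mem_siteCone _ (div_nonneg (hc _) (by norm_num)))
          (C.add_mem (C.add_mem (C.add_mem (C.mul_mem a1 b1) (C.mul_mem a2 b2))
            (C.mul_mem a3 b3)) (C.mul_mem a4 b4))
    · have := h0 v hv
      have := hh v hv
      exact C.add_mem (C.mul_mem (const_mem_siteCone _ (by linarith)) (hmem v).1)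
        (C.mul_mem (const_mem_siteCone _ (by linarith)) (hmem v).2.1)
  have key := sum_mul_exp_nonneg (fun q hq => sum_fourMonomials_nonneg hq) (hmem i).2.2.2 hg
  rw [sum_fourSpins] at key
  set p := plusConfig V
  set m := minusConfig V
  let s : Config V → ℝ := fun σ => spin (σ i)
  have e2 : (∑ τ₁ : Λ → Bool, ∑ τ₂ : Λ → Bool, ∑ τ₃ : Λ → Bool, ∑ τ₄ : Λ → Bool,
      Δ i (fun i => (τ₁ i, τ₂ i, τ₃ i, τ₄ i)) * Real.exp (g fun i => (τ₁ i, τ₂ i, τ₃ i, τ₄ i))) =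
      -(boltzSum E' Λ p s * (partitionFn E' Λ m * (partitionFn E Λ p * partitionFn E Λ m))) +
      partitionFn E' Λ p * (boltzSum E' Λ m s * (partitionFn E Λ p * partitionFn E Λ m)) +
      partitionFn E' Λ p * (partitionFn E' Λ m * (boltzSum E Λ p s * partitionFn E Λ m)) -
      partitionFn E' Λ p * (partitionFn E' Λ m * (partitionFn E Λ p * boltzSum E Λ m s)) := by
    have prod4 : ∀ f₁ f₂ f₃ f₄ : (Λ → Bool) → ℝ,
        (∑ τ, f₁ τ) * ((∑ τ, f₂ τ) * ((∑ τ, f₃ τ) * ∑ τ, f₄ τ)) =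
        ∑ τ₁, ∑ τ₂, ∑ τ₃, ∑ τ₄, f₁ τ₁ * (f₂ τ₂ * (f₃ τ₃ * f₄ τ₄)) := by
      intros
      simp only [← Finset.mul_sum, ← Finset.sum_mul]
    simp only [boltzSum, partitionFn, prod4, ← Finset.sum_add_distrib, ← Finset.sum_sub_distrib,
      ← Finset.sum_neg_distrib]
    refine Finset.sum_congr rfl fun τ₁ _ => Finset.sum_congr rfl fun τ₂ _ =>
      Finset.sum_congr rfl fun τ₃ _ => Finset.sum_congr rfl fun τ₄ _ => ?_
    simp only [g, Real.exp_add, Δ, σ₁, σ₂, σ₃, σ₄, s]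
    ring
  rw [e2] at key
  have z1 := partitionFn_pos E' Λ p
  have z2 := partitionFn_pos E' Λ m
  have z3 := partitionFn_pos E Λ p
  have z4 := partitionFn_pos E Λ m
  have e3 : -(gibbsAvg E' Λ p s) + gibbsAvg E' Λ m s + gibbsAvg E Λ p s - gibbsAvg E Λ m s =
      (-(boltzSum E' Λ p s * (partitionFn E' Λ m * (partitionFn E Λ p * partitionFn E Λ m))) +
      partitionFn E' Λ p * (boltzSum E' Λ m s * (partitionFn E Λ p * partitionFn E Λ m)) +
      partitionFn E' Λ p * (partitionFn E' Λ m * (boltzSum E Λ p s * partitionFn E Λ m)) -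
      partitionFn E' Λ p * (partitionFn E' Λ m * (partitionFn E Λ p * boltzSum E Λ m s))) /
      (partitionFn E' Λ p * partitionFn E' Λ m * partitionFn E Λ p * partitionFn E Λ m) := by
    simp only [gibbsAvg]
    field_simp
  have e4 := div_nonneg key (mul_pos (mul_pos (mul_pos z1 z2) z3) z4).le
  rw [← e3] at e4
  simp only [s, E, E'] at e4
  linarith

end

end Replicas

/-! ### Derivatives of the free energy -/

section Derivative

open scoped Classical

noncomputable section

variable {V : Type}

lemma hasDerivAt_log_partitionFn (E B : Config V → ℝ) (Λ : Finset V) (η : Config V) (t : ℝ) :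
    HasDerivAt (fun t => Real.log (partitionFn (fun σ => E σ - t * B σ) Λ η))
      (gibbsAvg (fun σ => E σ - t * B σ) Λ η B) t := by
  have h1 : HasDerivAt (fun t => partitionFn (fun σ => E σ - t * B σ) Λ η)
      (boltzSum (fun σ => E σ - t * B σ) Λ η B) t := by
    unfold partitionFn boltzSum
    refine HasDerivAt.fun_sum fun τ _ => ?_
    have h2 : HasDerivAt (fun t => -(E (glue Λ η τ) - t * B (glue Λ η τ)))
        (B (glue Λ η τ)) t := by
      simpa using (hasDerivAt_id' t).mul_const (B (glue Λ η τ))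
    exact h2.exp
  exact h1.log (partitionFn_pos _ _ _).ne'

lemma continuous_gibbsAvg (E B f : Config V → ℝ) (Λ : Finset V) (η : Config V) :
    Continuous fun t : ℝ => gibbsAvg (fun σ => E σ - t * B σ) Λ η f := by
  unfold gibbsAvg
  refine Continuous.div ?_ ?_ fun t => (partitionFn_pos _ _ _).ne'
  · unfold boltzSum; fun_prop
  · unfold partitionFn; fun_prop

lemma log_partitionFn_sub (E B : Config V → ℝ) (Λ : Finset V) (η : Config V) (a b : ℝ) :
    Real.log (partitionFn (fun σ => E σ - b * B σ) Λ η) -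
      Real.log (partitionFn (fun σ => E σ - a * B σ) Λ η) =
      ∫ t in a..b, gibbsAvg (fun σ => E σ - t * B σ) Λ η B :=
  (intervalIntegral.integral_eq_sub_of_hasDerivAt
    (fun t _ => hasDerivAt_log_partitionFn E B Λ η t)
    ((continuous_gibbsAvg E B B Λ η).intervalIntegrable a b)).symm

variable (G : SimpleGraph V) [G.LocallyFinite]

lemma edgeEnergy_add_field (c : Sym2 V → ℝ) (h k : V → ℝ) (t : ℝ) (Λ : Finset V) :
    edgeEnergy G c (fun i => h i + t * k i) Λ =
      fun σ => edgeEnergy G c h Λ σ - t * ∑ i ∈ Λ, k i * spin (σ i) := by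
  funext σ
  simp only [edgeEnergy, add_mul, Finset.sum_add_distrib, Finset.mul_sum, mul_assoc]
  ring

lemma edgeEnergy_add_coupling (c c' : Sym2 V → ℝ) (h : V → ℝ) (t : ℝ) (Λ : Finset V) :
    edgeEnergy G (fun e => c e + t * c' e) h Λ =
      fun σ => edgeEnergy G c h Λ σ - t * ∑ e ∈ edgesMeeting G Λ, c' e * bondProduct σ e := by
  funext σ
  simp only [edgeEnergy, add_mul, Finset.sum_add_distrib, Finset.mul_sum, mul_assoc]
  ring

lemma continuous_gibbsAvg_field (c : Sym2 V → ℝ) (h k : V → ℝ) (Λ : Finset V) (η : Config V)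
    (f : Config V → ℝ) :
    Continuous fun t : ℝ => gibbsAvg (edgeEnergy G c (fun i => h i + t * k i) Λ) Λ η f := by
  simp only [edgeEnergy_add_field]
  exact continuous_gibbsAvg _ _ _ _ _

/-- The logarithm of the ratio of the partition functions with plus and minus boundary
conditions. -/
def logRatio (c : Sym2 V → ℝ) (h : V → ℝ) (Λ : Finset V) : ℝ :=
  Real.log (partitionFn (edgeEnergy G c h Λ) Λ (plusConfig V)) -
    Real.log (partitionFn (edgeEnergy G c h Λ) Λ (minusConfig V))

/-- The difference of the magnetisations at `i` under plus and minus boundary conditions. -/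
def magGap (c : Sym2 V → ℝ) (h : V → ℝ) (Λ : Finset V) (i : V) : ℝ :=
  gibbsAvg (edgeEnergy G c h Λ) Λ (plusConfig V) (fun σ => spin (σ i)) -
    gibbsAvg (edgeEnergy G c h Λ) Λ (minusConfig V) (fun σ => spin (σ i))

lemma magGap_nonneg {c : Sym2 V → ℝ} (hc : ∀ e, 0 ≤ c e) (h : V → ℝ) (Λ : Finset V) (i : V) :
    0 ≤ magGap G c h Λ i :=
  sub_nonneg.2 (gibbsAvg_mono G hc (fun _ _ => le_rfl) (le_plusConfig _)
    (monotone_spin_apply i))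

lemma abs_magGap_le (c : Sym2 V → ℝ) (h : V → ℝ) (Λ : Finset V) (i : V) :
    |magGap G c h Λ i| ≤ 2 := by
  have h1 := abs_le.1 (abs_gibbsAvg_spin_le (edgeEnergy G c h Λ) Λ (plusConfig V) i)
  have h2 := abs_le.1 (abs_gibbsAvg_spin_le (edgeEnergy G c h Λ) Λ (minusConfig V) i)
  rw [magGap, abs_le]
  constructor <;> linarith [h1.1, h1.2, h2.1, h2.2]

/-- This fixes the constant of integration, so `logRatio` is exactly an integral of magnetisation
gaps. -/
lemma logRatio_zero (c : Sym2 V → ℝ) (Λ : Finset V) : logRatio G c 0 Λ = 0 := by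
  rw [logRatio, partitionFn_minus_eq_plus, sub_self]

lemma log_partitionFn_field_sub (c : Sym2 V → ℝ) (h k : V → ℝ) (Λ : Finset V) (η : Config V)
    (a b : ℝ) :
    Real.log (partitionFn (edgeEnergy G c (fun i => h i + b * k i) Λ) Λ η) -
      Real.log (partitionFn (edgeEnergy G c (fun i => h i + a * k i) Λ) Λ η) =
      ∫ t in a..b, ∑ i ∈ Λ, k i *
        gibbsAvg (edgeEnergy G c (fun i => h i + t * k i) Λ) Λ η (fun σ => spin (σ i)) := by
  simp only [edgeEnergy_add_field, ← gibbsAvg_mul_left, ← gibbsAvg_sum]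
  exact log_partitionFn_sub _ _ _ _ _ _

lemma logRatio_sub (c : Sym2 V → ℝ) (h k : V → ℝ) (Λ : Finset V) (a b : ℝ) :
    logRatio G c (fun i => h i + b * k i) Λ - logRatio G c (fun i => h i + a * k i) Λ =
      ∫ t in a..b, ∑ i ∈ Λ, k i * magGap G c (fun i => h i + t * k i) Λ i := by
  have h1 := log_partitionFn_field_sub G c h k Λ (plusConfig V) a b
  have h2 := log_partitionFn_field_sub G c h k Λ (minusConfig V) a b
  simp only [magGap, mul_sub, Finset.sum_sub_distrib]
  rw [intervalIntegral.integral_sub, ← h1, ← h2, logRatio, logRatio]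
  · ring
  all_goals
    refine Continuous.intervalIntegrable ?_ _ _
    exact continuous_finsetSum _ fun i _ =>
      continuous_const.mul (continuous_gibbsAvg_field G c h k Λ _ _)

/-- A lower bound for the increase of `logRatio` along a nonnegative change of the field. -/
lemma sum_magGap_le_logRatio_sub {c : Sym2 V → ℝ} (hc : ∀ e, 0 ≤ c e) {h k : V → ℝ}
    (h0 : ∀ i, 0 ≤ h i) (k0 : ∀ i, 0 ≤ k i) (Λ : Finset V) :
    ∑ i ∈ Λ, k i * magGap G c (fun i => h i + k i) Λ i ≤
      logRatio G c (fun i => h i + k i) Λ - logRatio G c h Λ := by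
  have e := logRatio_sub G c h k Λ 0 1
  simp only [one_mul, zero_mul, add_zero] at e
  rw [e]
  have h1 : ∫ _t in (0 : ℝ)..1, ∑ i ∈ Λ, k i * magGap G c (fun i => h i + k i) Λ i =
      ∑ i ∈ Λ, k i * magGap G c (fun i => h i + k i) Λ i := by simp
  rw [← h1]
  refine intervalIntegral.integral_mono_on zero_le_one (by simp) ?_ fun t ht => ?_
  · refine Continuous.intervalIntegrable ?_ _ _
    exact continuous_finsetSum _ fun i _ => continuous_const.mul
      ((continuous_gibbsAvg_field G c h k Λ _ _).sub (continuous_gibbsAvg_field G c h k Λ _ _))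
  -- The gap is smallest at the strongest field `h + k`, so the integrand is bounded below by its
  -- value at `t = 1`.
  · refine Finset.sum_le_sum fun i _ => mul_le_mul_of_nonneg_left ?_ (k0 i)
    refine gibbsAvg_plus_sub_minus_antitone G hc (fun j _ => ?_) (fun j _ => ?_) i
    · exact add_nonneg (h0 j) (mul_nonneg ht.1 (k0 j))
    · nlinarith [ht.2, k0 j]

end

end Derivative

/-! ### Transport along embeddings of graphs -/

section Transport

open scoped Classical

noncomputable section

variable {V V' : Type}

/-- The energies are compared only on configurations equal to `η'` off the image. A bond to a frozen
spin can thus be turned into a field, as in `partitionFn_liftUp`. -/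
lemma boltzSum_map (ψ : V ↪ V') (Λ : Finset V) (η' : Config V') {E : Config V → ℝ}
    {E' : Config V' → ℝ} {a : ℝ}
    (hE : ∀ σ' : Config V', (∀ i, i ∉ Λ.map ψ → σ' i = η' i) →
      E' σ' = E (fun i => σ' (ψ i)) + a) (f : Config V → ℝ) :
    boltzSum E' (Λ.map ψ) η' (fun σ' => f fun i => σ' (ψ i)) =
      Real.exp (-a) * boltzSum E Λ (fun i => η' (ψ i)) f := by
  rw [boltzSum, boltzSum, Finset.mul_sum]
  let φ : Λ ≃ Λ.map ψ := Equiv.ofBijective (fun i => ⟨ψ i, Finset.mem_map_of_mem ψ i.2⟩)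
    ⟨fun i j hij => Subtype.ext (ψ.injective (congrArg Subtype.val hij)), fun j => by
      obtain ⟨i, hi, hij⟩ := Finset.mem_map.1 j.2
      exact ⟨⟨i, hi⟩, Subtype.ext hij⟩⟩
  refine Fintype.sum_equiv (φ.symm.arrowCongr (Equiv.refl Bool)) _ _ fun τ' => ?_
  have h1 : (fun i => glue (Λ.map ψ) η' τ' (ψ i)) = glue Λ (fun i => η' (ψ i))
      (φ.symm.arrowCongr (Equiv.refl Bool) τ') := by
    funext i
    by_cases hi : i ∈ Λ
    · rw [glue_of_mem (Finset.mem_map_of_mem ψ hi), glue_of_mem hi]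
      rfl
    · rw [glue_of_notMem hi, glue_of_notMem]
      simpa using hi
  rw [hE _ fun i hi => glue_of_notMem hi, h1, neg_add, Real.exp_add]
  ring

lemma partitionFn_map (ψ : V ↪ V') (Λ : Finset V) (η' : Config V') {E : Config V → ℝ}
    {E' : Config V' → ℝ} {a : ℝ}
    (hE : ∀ σ' : Config V', (∀ i, i ∉ Λ.map ψ → σ' i = η' i) →
      E' σ' = E (fun i => σ' (ψ i)) + a) :
    partitionFn E' (Λ.map ψ) η' = Real.exp (-a) * partitionFn E Λ (fun i => η' (ψ i)) := by
  rw [← boltzSum_one, ← boltzSum_one]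
  exact boltzSum_map ψ Λ η' hE fun _ => 1

lemma gibbsAvg_map (ψ : V ↪ V') (Λ : Finset V) (η' : Config V') {E : Config V → ℝ}
    {E' : Config V' → ℝ} {a : ℝ}
    (hE : ∀ σ' : Config V', (∀ i, i ∉ Λ.map ψ → σ' i = η' i) →
      E' σ' = E (fun i => σ' (ψ i)) + a) (f : Config V → ℝ) :
    gibbsAvg E' (Λ.map ψ) η' (fun σ' => f fun i => σ' (ψ i)) =
      gibbsAvg E Λ (fun i => η' (ψ i)) f := by
  rw [gibbsAvg, gibbsAvg, boltzSum_map ψ Λ η' hE, partitionFn_map ψ Λ η' hE,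
    mul_div_mul_left _ _ (Real.exp_pos _).ne']

variable (G : SimpleGraph V) [G.LocallyFinite] (G' : SimpleGraph V') [G'.LocallyFinite]

/-- The edges meeting the image of `Λ` under an induced embedding whose only edges leaving the
image are the edges from `ψ i` to `θ i` for `i` in `wall`. -/
lemma sum_edgesMeeting_map (ψ : V ↪ V') (hadj : ∀ i j, G'.Adj (ψ i) (ψ j) ↔ G.Adj i j)
    (Λ : Finset V) (wall : V → Prop) (θ : V → V')
    (hout : ∀ i ∈ Λ, ∀ w, G'.Adj (ψ i) w → w ∉ Set.range ψ → wall i ∧ w = θ i)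
    (hθ : ∀ i ∈ Λ, wall i → G'.Adj (ψ i) (θ i) ∧ θ i ∉ Set.range ψ) (F : Sym2 V' → ℝ) :
    ∑ e ∈ edgesMeeting G' (Λ.map ψ), F e =
      ∑ e ∈ edgesMeeting G Λ, F (e.map ψ) + ∑ i ∈ Λ with wall i, F s(ψ i, θ i) := by
  have hdisj : Disjoint ((edgesMeeting G Λ).image (Sym2.map ψ))
      ((Λ.filter wall).image fun i => s(ψ i, θ i)) := by
    rw [Finset.disjoint_left]
    intro e he he'
    simp only [Finset.mem_image, Finset.mem_filter] at he he'
    obtain ⟨e', -, rfl⟩ := he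
    obtain ⟨i, ⟨hi, hw⟩, he'⟩ := he'
    have : θ i ∈ Sym2.map ψ e' := by rw [← he']; simp
    rw [Sym2.mem_map] at this
    obtain ⟨j, -, hj⟩ := this
    exact (hθ i hi hw).2 ⟨j, hj⟩
  have hset : edgesMeeting G' (Λ.map ψ) = (edgesMeeting G Λ).image (Sym2.map ψ) ∪
      (Λ.filter wall).image fun i => s(ψ i, θ i) := by
    ext e
    simp only [Finset.mem_union, Finset.mem_image, Finset.mem_filter]
    constructor
    · intro he
      rw [mem_edgesMeeting] at he
      obtain ⟨he, v, hv, hve⟩ := he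
      obtain ⟨i, hi, rfl⟩ := Finset.mem_map.1 hv
      obtain ⟨w, rfl⟩ := Sym2.mem_iff_exists.1 hve
      have he' : G'.Adj (ψ i) w := he
      by_cases hw : w ∈ Set.range ψ
      · obtain ⟨j, rfl⟩ := hw
        refine Or.inl ⟨s(i, j), ?_, rfl⟩
        rw [mem_edgesMeeting]
        exact ⟨(hadj i j).1 he', i, hi, by simp⟩
      · obtain ⟨h1, rfl⟩ := hout i hi w he' hw
        exact Or.inr ⟨i, ⟨hi, h1⟩, rfl⟩
    · rintro (⟨e', he', rfl⟩ | ⟨i, ⟨hi, hw⟩, rfl⟩)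
      · rw [mem_edgesMeeting] at he' ⊢
        obtain ⟨h1, i, hi, hie⟩ := he'
        refine ⟨?_, ψ i, Finset.mem_map_of_mem ψ hi, Sym2.mem_map.2 ⟨i, hie, rfl⟩⟩
        induction e' with | _ u v => exact (hadj u v).2 h1
      · rw [mem_edgesMeeting]
        exact ⟨(hθ i hi hw).1, ψ i, Finset.mem_map_of_mem ψ hi, by simp⟩
  rw [hset, Finset.sum_union hdisj, Finset.sum_image, Finset.sum_image]
  · intro i hi j hj hij
    simp only [Finset.coe_filter, Set.mem_ofPred_eq] at hi hj
    have := Sym2.eq_iff.1 hij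
    rcases this with h | h
    · exact ψ.injective h.1
    · exact absurd ⟨j, h.2.symm⟩ (hθ i hi.1 hi.2).2
  · exact (Sym2.map.injective ψ.injective).injOn

lemma bondProduct_map (ψ : V → V') (σ' : Config V') (e : Sym2 V) :
    bondProduct σ' (e.map ψ) = bondProduct (fun i => σ' (ψ i)) e := by
  induction e with | _ u v => rfl

lemma edgeEnergy_map (ψ : V ↪ V') (hadj : ∀ i j, G'.Adj (ψ i) (ψ j) ↔ G.Adj i j)
    (Λ : Finset V) (wall : V → Prop) (θ : V → V')
    (hout : ∀ i ∈ Λ, ∀ w, G'.Adj (ψ i) w → w ∉ Set.range ψ → wall i ∧ w = θ i)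
    (hθ : ∀ i ∈ Λ, wall i → G'.Adj (ψ i) (θ i) ∧ θ i ∉ Set.range ψ)
    (c' : Sym2 V' → ℝ) (h' : V' → ℝ) (σ' : Config V') :
    edgeEnergy G' c' h' (Λ.map ψ) σ' =
      edgeEnergy G (fun e => c' (e.map ψ)) (fun i => h' (ψ i)) Λ (fun i => σ' (ψ i)) -
        ∑ i ∈ Λ with wall i, c' s(ψ i, θ i) * (spin (σ' (ψ i)) * spin (σ' (θ i))) := by
  simp only [edgeEnergy]
  rw [sum_edgesMeeting_map G G' ψ hadj Λ wall θ hout hθ, Finset.sum_map]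
  simp only [bondProduct_map, bondProduct_mk]
  ring

/-- Transport along an isomorphism of graphs. -/
lemma gibbsAvg_equiv (ψ : V ≃ V') (hadj : ∀ i j, G'.Adj (ψ i) (ψ j) ↔ G.Adj i j)
    (Λ : Finset V) (c' : Sym2 V' → ℝ) (h' : V' → ℝ) (η' : Config V') (f : Config V → ℝ) :
    gibbsAvg (edgeEnergy G' c' h' (Λ.map ψ.toEmbedding)) (Λ.map ψ.toEmbedding) η'
        (fun σ' => f fun i => σ' (ψ i)) =
      gibbsAvg (edgeEnergy G (fun e => c' (e.map ψ)) (fun i => h' (ψ i)) Λ) Λ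
        (fun i => η' (ψ i)) f := by
  refine gibbsAvg_map (a := 0) ψ.toEmbedding Λ η' (fun σ' _ => ?_) f
  rw [edgeEnergy_map G G' ψ.toEmbedding hadj Λ (fun _ => False) ψ
    (fun i _ w _ hw => absurd (ψ.surjective w) hw) (fun _ _ h => h.elim)]
  simp

end

end Transport

/-! ### Weak convergence of finite-volume measures -/

section WeakConvergence

open scoped Classical

noncomputable section

variable {V : Type}

/-- The indicator function of the event that all spins in `A` are `+1`. -/
def plusInd (A : Finset V) (σ : Config V) : ℝ := if ∀ i ∈ A, σ i = true then 1 else 0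

lemma plusInd_nonneg (A : Finset V) (σ : Config V) : 0 ≤ plusInd A σ := by
  unfold plusInd; split_ifs <;> norm_num

lemma plusInd_le_one (A : Finset V) (σ : Config V) : plusInd A σ ≤ 1 := by
  unfold plusInd; split_ifs <;> norm_num

lemma plusInd_monotone (A : Finset V) : Monotone (plusInd A) := by
  intro σ σ' h
  by_cases hσ : ∀ i ∈ A, σ i = true
  · have : ∀ i ∈ A, σ' i = true := fun i hi => by
      have := h i
      rw [hσ i hi] at this
      exact Bool.eq_true_of_true_le this
    rw [plusInd, plusInd, if_pos hσ, if_pos this]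
  · rw [plusInd, if_neg hσ]
    exact plusInd_nonneg _ _

/-- The indicator can rise only if some spin of `A` flips from minus to plus, which raises the
half-sum by at least `1`. By FKG, magnetisation gaps then control the difference of the expectations
of `plusInd A`. -/
lemma monotone_sum_spin_sub_plusInd (A : Finset V) :
    Monotone fun σ : Config V => (∑ i ∈ A, (1 / 2) * spin (σ i)) - plusInd A σ := by
  intro σ σ' h
  have hs : ∀ i ∈ A, (1 / 2) * spin (σ i) ≤ (1 / 2) * spin (σ' i) := fun i _ =>
    mul_le_mul_of_nonneg_left (spin_mono (h i)) (by norm_num)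
  have h1 := Finset.sum_le_sum hs
  by_cases hσ' : ∀ i ∈ A, σ' i = true
  · by_cases hσ : ∀ i ∈ A, σ i = true
    · simp only [plusInd, if_pos hσ, if_pos hσ']
      linarith
    · push Not at hσ
      obtain ⟨j, hj, hjσ⟩ := hσ
      have h2 : ∑ i ∈ A, ((1 / 2) * spin (σ i) + if i = j then 1 else 0) ≤
          ∑ i ∈ A, (1 / 2) * spin (σ' i) := by
        refine Finset.sum_le_sum fun i hi => ?_
        by_cases hij : i = j
        · subst hij
          rw [hσ' i hi, eq_false_of_ne_true hjσ]
          norm_num [spin]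
        · simpa [hij] using hs i hi
      rw [Finset.sum_add_distrib, Finset.sum_ite_eq' A j, if_pos hj] at h2
      have h3 := plusInd_le_one A σ'
      have h4 := plusInd_nonneg A σ
      linarith
  · have h3 := plusInd_nonneg A σ
    have : plusInd A σ' = 0 := by rw [plusInd, if_neg hσ']
    simp only [this]
    linarith

lemma continuous_plusInd (A : Finset V) : Continuous (plusInd A) := by
  have h : plusInd A = fun σ => ∏ i ∈ A, (if σ i = true then (1 : ℝ) else 0) := by
    funext σ
    rw [plusInd]
    split_ifs with hA
    · exact (Finset.prod_eq_one fun i hi => if_pos (hA i hi)).symm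
    · push Not at hA
      obtain ⟨i, hi, hiσ⟩ := hA
      exact (Finset.prod_eq_zero hi (if_neg hiσ)).symm
  rw [h]
  refine continuous_finsetProd _ fun i _ => ?_
  exact (continuous_of_discreteTopology (f := fun b : Bool => if b = true then (1 : ℝ) else 0)).comp
    (continuous_apply i)

/-- `plusInd A` as a bounded continuous function. -/
def plusIndBCF (A : Finset V) : BoundedContinuousFunction (Config V) ℝ :=
  BoundedContinuousFunction.mkOfCompact ⟨plusInd A, continuous_plusInd A⟩

lemma plusSets_generate : (MeasurableSpace.pi : MeasurableSpace (Config V)) =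
    MeasurableSpace.generateFrom
      {s | ∃ A : Finset V, s = {σ : Config V | ∀ i ∈ A, σ i = true}} := by
  apply le_antisymm
  · refine iSup_le fun i => ?_
    rw [← measurable_iff_comap_le]
    refine measurable_to_bool ?_
    exact MeasurableSpace.measurableSet_generateFrom ⟨{i}, by ext; simp⟩
  · refine MeasurableSpace.generateFrom_le ?_
    rintro _ ⟨A, rfl⟩
    have : {σ : Config V | ∀ i ∈ A, σ i = true} = ⋂ i ∈ A, {σ | σ i = true} := by ext; simp
    rw [this]
    refine Finset.measurableSet_biInter _ fun i _ => ?_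
    have hi : Measurable fun σ : Config V => σ i := measurable_pi_apply i
    exact hi (MeasurableSet.singleton true)

lemma integral_plusInd (A : Finset V) (μ : Measure (Config V)) :
    ∫ σ, plusInd A σ ∂μ = μ.real {σ | ∀ i ∈ A, σ i = true} := by
  have hm : MeasurableSet {σ : Config V | ∀ i ∈ A, σ i = true} := by
    rw [plusSets_generate]
    exact MeasurableSpace.measurableSet_generateFrom ⟨A, rfl⟩
  rw [← integral_indicator_one hm]
  congr 1
  funext σ
  simp [plusInd, Set.indicator]

variable [Countable V]

lemma integral_gibbsMeasure (E : Config V → ℝ) (Λ : Finset V) (η : Config V) (f : Config V → ℝ) :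
    ∫ σ, f σ ∂(gibbsMeasure E Λ η : Measure (Config V)) = gibbsAvg E Λ η f := by
  have h : (gibbsMeasure E Λ η : Measure (Config V)) = gibbsMeasureAux E Λ η := rfl
  rw [h, gibbsMeasureAux, integral_finsetSum_measure]
  · simp only [integral_smul_measure, integral_dirac, smul_eq_mul]
    rw [gibbsAvg, boltzSum, Finset.sum_div]
    refine Finset.sum_congr rfl fun τ _ => ?_
    rw [ENNReal.toReal_ofReal (div_nonneg (Real.exp_pos _).le (partitionFn_pos _ _ _).le)]
    ring
  · intro τ _
    exact (integrable_dirac (by simp)).smul_measure ENNReal.ofReal_ne_top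

/-- The events that all spins of a finite set are plus form a π-system, intersections corresponding
to unions of the finite sets, and they generate the `σ`-algebra. -/
lemma probabilityMeasure_ext_plusInd {μ ν : ProbabilityMeasure (Config V)}
    (h : ∀ A : Finset V, ∫ σ, plusInd A σ ∂(μ : Measure (Config V)) =
      ∫ σ, plusInd A σ ∂(ν : Measure (Config V))) : μ = ν := by
  apply Subtype.ext
  have := μ.2
  have := ν.2
  refine ext_of_generate_finite _ plusSets_generate ?_ ?_ (by simp)
  · rintro _ ⟨A, rfl⟩ _ ⟨B, rfl⟩ _
    refine ⟨A ∪ B, ?_⟩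
    ext σ
    simp only [Set.mem_inter_iff, Set.mem_ofPred_eq, Finset.mem_union]
    constructor
    · rintro ⟨h1, h2⟩ i (hi | hi)
      exacts [h1 i hi, h2 i hi]
    · exact fun h => ⟨fun i hi => h i (Or.inl hi), fun i hi => h i (Or.inr hi)⟩
  · rintro _ ⟨A, rfl⟩
    have := h A
    rw [integral_plusInd, integral_plusInd] at this
    exact (measureReal_eq_measureReal_iff).1 this

lemma tendsto_integral_plusInd {ι : Type*} {l : Filter ι} {u : ι → ProbabilityMeasure (Config V)}
    {μ : ProbabilityMeasure (Config V)} (h : Tendsto u l (𝓝 μ)) (A : Finset V) :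
    Tendsto (fun n => ∫ σ, plusInd A σ ∂(u n : Measure (Config V))) l
      (𝓝 (∫ σ, plusInd A σ ∂(μ : Measure (Config V)))) :=
  ProbabilityMeasure.tendsto_iff_forall_integral_tendsto.1 h (plusIndBCF A)

/-- The probability measures on the compact configuration space form a compact space, and the limits
of the `plusInd` integrals determine every cluster point. -/
lemma exists_tendsto_of_plusInd {u : ℕ → ProbabilityMeasure (Config V)}
    (h : ∀ A : Finset V, ∃ a : ℝ,
      Tendsto (fun n => ∫ σ, plusInd A σ ∂(u n : Measure (Config V))) atTop (𝓝 a)) :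
    ∃ μ, Tendsto u atTop (𝓝 μ) := by
  choose a ha using h
  obtain ⟨μ, -, hμ⟩ := isCompact_univ.exists_clusterPt (X := ProbabilityMeasure (Config V))
    (f := map u atTop) (by simp)
  refine ⟨μ, isCompact_univ.tendsto_nhds_of_unique_mapClusterPt (by simp) fun ν _ hν => ?_⟩
  have key : ∀ ρ, MapClusterPt ρ atTop u →
      ∀ A, ∫ σ, plusInd A σ ∂(ρ : Measure (Config V)) = a A := by
    intro ρ hρ A
    obtain ⟨U, hU, hUρ⟩ := mapClusterPt_iff_ultrafilter.1 hρ
    exact tendsto_nhds_unique (tendsto_integral_plusInd hUρ A) ((ha A).mono_left hU)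
  exact probabilityMeasure_ext_plusInd fun A => by rw [key ν hν, key μ hμ]

end

end WeakConvergence

/-! ### Thermodynamic limits -/

section Limits

open scoped Classical

noncomputable section

variable {V : Type} (G : SimpleGraph V) [G.LocallyFinite]

lemma Invades.tendsto {Λ : ℕ → Finset V} (h : Invades Λ) : Tendsto Λ atTop atTop := by
  refine tendsto_atTop.2 fun A => ?_
  obtain ⟨N, hN⟩ := h A
  filter_upwards [eventually_gt_atTop N] with n hn using hN n hn

/-- The infinite-volume expectation with plus boundary condition of an increasing function. -/
def plusLim (c : Sym2 V → ℝ) (h : V → ℝ) (f : Config V → ℝ) : ℝ :=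
  ⨅ Λ : Finset V, gibbsAvg (edgeEnergy G c h Λ) Λ (plusConfig V) f

/-- The infinite-volume expectation with minus boundary condition of an increasing function. -/
def minusLim (c : Sym2 V → ℝ) (h : V → ℝ) (f : Config V → ℝ) : ℝ :=
  ⨆ Λ : Finset V, gibbsAvg (edgeEnergy G c h Λ) Λ (minusConfig V) f

lemma tendsto_plusLim {c : Sym2 V → ℝ} (hc : ∀ e, 0 ≤ c e) (h : V → ℝ) {f : Config V → ℝ}
    (hf : Monotone f) :
    Tendsto (fun Λ : Finset V => gibbsAvg (edgeEnergy G c h Λ) Λ (plusConfig V) f) atTop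
      (𝓝 (plusLim G c h f)) := by
  refine tendsto_atTop_ciInf (fun Λ Λ' hΛ => gibbsAvg_plus_antitone G hc h hΛ hf)
    ⟨f (minusConfig V), ?_⟩
  rintro _ ⟨Λ, rfl⟩
  rw [← gibbsAvg_const (edgeEnergy G c h Λ) Λ (plusConfig V) (f (minusConfig V))]
  exact gibbsAvg_mono_fun _ _ _ fun σ => hf (minusConfig_le σ)

lemma tendsto_minusLim {c : Sym2 V → ℝ} (hc : ∀ e, 0 ≤ c e) (h : V → ℝ) {f : Config V → ℝ}
    (hf : Monotone f) :
    Tendsto (fun Λ : Finset V => gibbsAvg (edgeEnergy G c h Λ) Λ (minusConfig V) f) atTop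
      (𝓝 (minusLim G c h f)) := by
  refine tendsto_atTop_ciSup (fun Λ Λ' hΛ => gibbsAvg_minus_monotone G hc h hΛ hf)
    ⟨f (plusConfig V), ?_⟩
  rintro _ ⟨Λ, rfl⟩
  rw [← gibbsAvg_const (edgeEnergy G c h Λ) Λ (minusConfig V) (f (plusConfig V))]
  exact gibbsAvg_mono_fun _ _ _ fun σ => hf (le_plusConfig σ)

lemma plusLim_le {c : Sym2 V → ℝ} (hc : ∀ e, 0 ≤ c e) (h : V → ℝ) {f : Config V → ℝ}
    (hf : Monotone f) (Λ : Finset V) :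
    plusLim G c h f ≤ gibbsAvg (edgeEnergy G c h Λ) Λ (plusConfig V) f :=
  Antitone.le_of_tendsto (fun _ _ hΛ => gibbsAvg_plus_antitone G hc h hΛ hf)
    (tendsto_plusLim G hc h hf) Λ

lemma le_minusLim {c : Sym2 V → ℝ} (hc : ∀ e, 0 ≤ c e) (h : V → ℝ) {f : Config V → ℝ}
    (hf : Monotone f) (Λ : Finset V) :
    gibbsAvg (edgeEnergy G c h Λ) Λ (minusConfig V) f ≤ minusLim G c h f :=
  Monotone.ge_of_tendsto (fun _ _ hΛ => gibbsAvg_minus_monotone G hc h hΛ hf)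
    (tendsto_minusLim G hc h hf) Λ

/-- The difference of the magnetisations at `i` of the plus and the minus state. -/
def gapLim (c : Sym2 V → ℝ) (h : V → ℝ) (i : V) : ℝ :=
  plusLim G c h (fun σ => spin (σ i)) - minusLim G c h (fun σ => spin (σ i))

lemma tendsto_gapLim {c : Sym2 V → ℝ} (hc : ∀ e, 0 ≤ c e) (h : V → ℝ) (i : V) :
    Tendsto (fun Λ : Finset V => magGap G c h Λ i) atTop (𝓝 (gapLim G c h i)) :=
  (tendsto_plusLim G hc h (monotone_spin_apply i)).sub
    (tendsto_minusLim G hc h (monotone_spin_apply i))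

lemma gapLim_le {c : Sym2 V → ℝ} (hc : ∀ e, 0 ≤ c e) (h : V → ℝ) (i : V) (Λ : Finset V) :
    gapLim G c h i ≤ magGap G c h Λ i :=
  sub_le_sub (plusLim_le G hc h (monotone_spin_apply i) Λ)
    (le_minusLim G hc h (monotone_spin_apply i) Λ)

lemma gapLim_nonneg {c : Sym2 V → ℝ} (hc : ∀ e, 0 ≤ c e) (h : V → ℝ) (i : V) :
    0 ≤ gapLim G c h i :=
  ge_of_tendsto' (tendsto_gapLim G hc h i) fun Λ => magGap_nonneg G hc h Λ i

lemma gapLim_le_two {c : Sym2 V → ℝ} (hc : ∀ e, 0 ≤ c e) (h : V → ℝ) (i : V) :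
    gapLim G c h i ≤ 2 :=
  (gapLim_le G hc h i ∅).trans (abs_le.1 (abs_magGap_le G c h ∅ i)).2

lemma gapLim_antitone {c : Sym2 V → ℝ} (hc : ∀ e, 0 ≤ c e) {h h' : V → ℝ} (h0 : ∀ i, 0 ≤ h i)
    (hh : ∀ i, h i ≤ h' i) (i : V) : gapLim G c h' i ≤ gapLim G c h i :=
  le_of_tendsto_of_tendsto' (tendsto_gapLim G hc h' i) (tendsto_gapLim G hc h i) fun _ =>
    gibbsAvg_plus_sub_minus_antitone G hc (fun j _ => h0 j) (fun j _ => hh j) i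

/-- If the magnetisation gap vanishes everywhere, then the expectation of `plusInd A` has the same
limit for every boundary condition. -/
lemma tendsto_gibbsAvg_plusInd {c : Sym2 V → ℝ} (hc : ∀ e, 0 ≤ c e) (h : V → ℝ)
    (hgap : ∀ i, gapLim G c h i = 0) (η : Config V) (A : Finset V) :
    Tendsto (fun Λ : Finset V => gibbsAvg (edgeEnergy G c h Λ) Λ η (plusInd A)) atTop
      (𝓝 (plusLim G c h (plusInd A))) := by
  have hp := tendsto_plusLim G hc h (plusInd_monotone A)
  have h0 : Tendsto (fun Λ : Finset V => ∑ i ∈ A, (1 / 2) * magGap G c h Λ i) atTop (𝓝 0) := by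
    have := tendsto_finsetSum A fun i _ => (tendsto_gapLim G hc h i).const_mul (1 / 2)
    simpa [hgap] using this
  have hl := hp.sub h0
  rw [sub_zero] at hl
  refine tendsto_of_tendsto_of_tendsto_of_le_of_le hl hp (fun Λ => ?_) (fun Λ => ?_)
  -- FKG for half the sum of the spins minus `plusInd A` bounds the plus-minus difference of
  -- `plusInd A` by half the sum of the gaps. The condition `η` lies between plus and minus.
  · have h1 := gibbsAvg_mono G hc (Λ := Λ) (fun i _ => le_refl (h i)) (minusConfig_le (plusConfig V))
      (monotone_sum_spin_sub_plusInd A)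
    simp only [gibbsAvg_sub, gibbsAvg_sum, gibbsAvg_mul_left] at h1
    have h2 := gibbsAvg_mono G hc (Λ := Λ) (fun i _ => le_refl (h i)) (minusConfig_le η)
      (plusInd_monotone A)
    simp only [magGap, mul_sub, Finset.sum_sub_distrib]
    linarith
  · exact gibbsAvg_mono G hc (fun i _ => le_rfl) (le_plusConfig η) (plusInd_monotone A)

variable [Countable V]

lemma exists_tendsto_gibbsMeasure_plus {c : Sym2 V → ℝ} (hc : ∀ e, 0 ≤ c e) (h : V → ℝ)
    {Λ : ℕ → Finset V} (hΛ : Invades Λ) :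
    ∃ μ, Tendsto (fun n => gibbsMeasure (edgeEnergy G c h (Λ n)) (Λ n) (plusConfig V)) atTop
      (𝓝 μ) := by
  refine exists_tendsto_of_plusInd fun A => ⟨plusLim G c h (plusInd A), ?_⟩
  simp only [integral_gibbsMeasure]
  exact (tendsto_plusLim G hc h (plusInd_monotone A)).comp hΛ.tendsto

lemma exists_tendsto_gibbsMeasure_minus {c : Sym2 V → ℝ} (hc : ∀ e, 0 ≤ c e) (h : V → ℝ)
    {Λ : ℕ → Finset V} (hΛ : Invades Λ) :
    ∃ μ, Tendsto (fun n => gibbsMeasure (edgeEnergy G c h (Λ n)) (Λ n) (minusConfig V)) atTop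
      (𝓝 μ) := by
  refine exists_tendsto_of_plusInd fun A => ⟨minusLim G c h (plusInd A), ?_⟩
  simp only [integral_gibbsMeasure]
  exact (tendsto_minusLim G hc h (plusInd_monotone A)).comp hΛ.tendsto

/-- Equality of the limits with plus and minus boundary conditions forces the magnetisation gap
to vanish. -/
lemma gapLim_eq_zero_of_tendsto {c : Sym2 V → ℝ} (hc : ∀ e, 0 ≤ c e) (h : V → ℝ)
    {Λ : ℕ → Finset V} (hΛ : Invades Λ) {μ : ProbabilityMeasure (Config V)}
    (hp : Tendsto (fun n => gibbsMeasure (edgeEnergy G c h (Λ n)) (Λ n) (plusConfig V)) atTop (𝓝 μ))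
    (hm : Tendsto (fun n => gibbsMeasure (edgeEnergy G c h (Λ n)) (Λ n) (minusConfig V)) atTop
      (𝓝 μ)) (i : V) : gapLim G c h i = 0 := by
  have hs : ∀ σ : Config V, spin (σ i) = 2 * plusInd {i} σ + -1 := fun σ => by
    cases hσ : σ i <;> simp [plusInd, spin, hσ]; norm_num
  have h1 := tendsto_integral_plusInd hp {i}
  have h2 := tendsto_integral_plusInd hm {i}
  simp only [integral_gibbsMeasure] at h1 h2
  have h3 := (h1.sub h2).const_mul 2
  rw [sub_self, mul_zero] at h3
  refine tendsto_nhds_unique ((tendsto_gapLim G hc h i).comp hΛ.tendsto) (h3.congr fun n => ?_)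
  simp only [Function.comp, magGap, hs, gibbsAvg_add, gibbsAvg_mul_left, gibbsAvg_const]
  ring

lemma limit_unique_of_gapLim_eq_zero {c : Sym2 V → ℝ} (hc : ∀ e, 0 ≤ c e) (h : V → ℝ)
    (hgap : ∀ i, gapLim G c h i = 0) {Λ Λ' : ℕ → Finset V} (hΛ : Invades Λ) (hΛ' : Invades Λ')
    {η η' : Config V} {μ μ' : ProbabilityMeasure (Config V)}
    (hμ : Tendsto (fun n => gibbsMeasure (edgeEnergy G c h (Λ n)) (Λ n) η) atTop (𝓝 μ))
    (hμ' : Tendsto (fun n => gibbsMeasure (edgeEnergy G c h (Λ' n)) (Λ' n) η') atTop (𝓝 μ')) :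
    μ = μ' := by
  refine probabilityMeasure_ext_plusInd fun A => ?_
  have h1 := tendsto_integral_plusInd hμ A
  have h2 := tendsto_integral_plusInd hμ' A
  simp only [integral_gibbsMeasure] at h1 h2
  rw [tendsto_nhds_unique h1 ((tendsto_gibbsAvg_plusInd G hc h hgap η A).comp hΛ.tendsto),
    tendsto_nhds_unique h2 ((tendsto_gibbsAvg_plusInd G hc h hgap η' A).comp hΛ'.tendsto)]

end

end Limits

/-! ### Spatial averages -/

section Averages

open scoped Classical

noncomputable section

/-- The cube `[-n, n]^k`. -/
def cube (k n : ℕ) : Finset (Fin k → ℤ) :=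
  Finset.Icc (fun _ => -(n : ℤ)) (fun _ => (n : ℤ))

lemma mem_cube {k n : ℕ} {x : Fin k → ℤ} : x ∈ cube k n ↔ ∀ j, |x j| ≤ n := by
  simp only [cube, Finset.mem_Icc, Pi.le_def, abs_le, forall_and]

lemma card_cube (k n : ℕ) : ((cube k n).card : ℝ) = (2 * (n : ℝ) + 1) ^ k := by
  rw [cube, Pi.card_Icc]
  simp only [Int.card_Icc, Finset.prod_const, Finset.card_univ, Fintype.card_fin]
  have : ((n : ℤ) + 1 - -(n : ℤ)).toNat = 2 * n + 1 := by omega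
  rw [this]
  push_cast
  rfl

lemma card_cube_pos (k n : ℕ) : (0 : ℝ) < (cube k n).card := by
  rw [card_cube]; positivity

lemma cube_mono (k : ℕ) {m n : ℕ} (h : m ≤ n) : cube k m ⊆ cube k n := by
  intro x hx
  rw [mem_cube] at hx ⊢
  exact fun j => (hx j).trans (by exact_mod_cast h)

lemma tendsto_card_cube_ratio (k m : ℕ) :
    Tendsto (fun n => ((cube k (n - m)).card : ℝ) / (cube k n).card) atTop (𝓝 1) := by
  simp only [card_cube, ← div_pow]
  have h1 : Tendsto (fun n : ℕ => (2 * ((n - m : ℕ) : ℝ) + 1) / (2 * (n : ℝ) + 1)) atTop (𝓝 1) := by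
    have h2 : Tendsto (fun n : ℕ => 1 - (m : ℝ) * ((2 * (n : ℝ) + 1)⁻¹ * 2)) atTop
        (𝓝 (1 - (m : ℝ) * (0 * 2))) := by
      refine tendsto_const_nhds.sub (Tendsto.const_mul _ (Tendsto.mul_const _ ?_))
      refine tendsto_inv_atTop_zero.comp ?_
      exact tendsto_atTop_add_const_right _ _
        (tendsto_natCast_atTop_atTop.const_mul_atTop (by norm_num))
    simp only [zero_mul, mul_zero, sub_zero] at h2
    refine h2.congr' ?_
    filter_upwards [eventually_ge_atTop m] with n hn
    rw [Nat.cast_sub hn]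
    field_simp
    ring
  simpa using h1.pow k

/-- For fixed `m` the sites within `m` of the boundary are a vanishing fraction of the cube, and a
uniform bound suffices for them. -/
lemma tendsto_cube_avg {k : ℕ} {a : ℕ → (Fin k → ℤ) → ℝ} {C L : ℝ} (hC : ∀ n x, |a n x| ≤ C)
    (h : ∀ ε > 0, ∃ m : ℕ, ∀ᶠ n in atTop, ∀ x ∈ cube k (n - m), |a n x - L| ≤ ε) :
    Tendsto (fun n => (∑ x ∈ cube k n, a n x) / (cube k n).card) atTop (𝓝 L) := by
  rw [Metric.tendsto_atTop']
  intro ε hε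
  obtain ⟨m, hm⟩ := h (ε / 2) (by positivity)
  have h1 : Tendsto (fun n => (C + |L|) * (1 - ((cube k (n - m)).card : ℝ) / (cube k n).card))
      atTop (𝓝 0) := by
    simpa using ((tendsto_card_cube_ratio k m).const_sub 1).const_mul (C + |L|)
  obtain ⟨N, hN⟩ := eventually_atTop.1 (hm.and (h1.eventually_lt_const (half_pos hε)))
  refine ⟨N, fun n hn => ?_⟩
  obtain ⟨h2, h3⟩ := hN n hn.le
  have hp := card_cube_pos k n
  have e1 : (∑ x ∈ cube k n, a n x) / (cube k n).card - L =
      (∑ x ∈ cube k n, (a n x - L)) / (cube k n).card := by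
    rw [Finset.sum_sub_distrib, Finset.sum_const, nsmul_eq_mul]
    field_simp
  have hsub := cube_mono k (Nat.sub_le n m)
  have e2 : ∑ x ∈ cube k n, |a n x - L| ≤
      ((cube k n).card - (cube k (n - m)).card : ℝ) * (C + |L|) +
        (cube k (n - m)).card * (ε / 2) := by
    rw [← Finset.sum_sdiff hsub]
    refine add_le_add ?_ ?_
    · have := Finset.sum_le_card_nsmul (cube k n \ cube k (n - m)) (fun x => |a n x - L|)
        (C + |L|) fun x _ => (abs_sub _ _).trans (add_le_add (hC n x) le_rfl)
      rwa [nsmul_eq_mul, Finset.card_sdiff_of_subset hsub,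
        Nat.cast_sub (Finset.card_le_card hsub)] at this
    · have := Finset.sum_le_card_nsmul (cube k (n - m)) (fun x => |a n x - L|) (ε / 2) h2
      rwa [nsmul_eq_mul] at this
  have hle : ((cube k (n - m)).card : ℝ) ≤ (cube k n).card := by
    exact_mod_cast Finset.card_le_card hsub
  rw [Real.dist_eq, e1, abs_div, abs_of_pos hp, div_lt_iff₀ hp]
  have h4 := Finset.abs_sum_le_sum_abs (fun x => a n x - L) (cube k n)
  have h5 : (C + |L|) * (1 - ((cube k (n - m)).card : ℝ) / (cube k n).card) * (cube k n).card =
      ((cube k n).card - (cube k (n - m)).card : ℝ) * (C + |L|) := by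
    field_simp
  have h6 := mul_lt_mul_of_pos_right h3 hp
  rw [h5] at h6
  nlinarith

/-- Averages of a translation covariant function that decreases with the volume. -/
lemma tendsto_cube_avg_of_antitone {V : Type} {k : ℕ} (T : (Fin k → ℤ) → V ≃ V)
    {φ : Finset V → (Fin k → ℤ) → ℝ} {C L : ℝ} (hC : ∀ Λ x, |φ Λ x| ≤ C)
    (hφ : ∀ {Λ Λ' : Finset V}, Λ ⊆ Λ' → ∀ x, φ Λ' x ≤ φ Λ x)
    (hT : ∀ Λ v x, φ (Λ.map (T v).toEmbedding) (x + v) = φ Λ x)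
    (hL : Tendsto (fun Λ => φ Λ 0) atTop (𝓝 L)) {B : ℕ → Finset V}
    (hB : ∀ A : Finset V, ∃ m : ℕ, ∀ᶠ n in atTop, ∀ x ∈ cube k (n - m),
      A.map (T x).toEmbedding ⊆ B n) :
    Tendsto (fun n => (∑ x ∈ cube k n, φ (B n) x) / (cube k n).card) atTop (𝓝 L) := by
  -- Translating `x` to the origin gives the value at the origin in another volume, which by
  -- monotonicity is at least the limit.
  have hlow : ∀ Λ x, L ≤ φ Λ x := fun Λ x => by
    have h1 := hT Λ (-x) x
    rw [add_neg_cancel] at h1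
    rw [← h1]
    exact Antitone.le_of_tendsto (f := fun Λ => φ Λ 0) (fun Λ Λ' h => hφ h 0) hL _
  refine tendsto_cube_avg (fun n x => hC (B n) x) fun ε hε => ?_
  -- One finite volume `A` is already within `ε` of the limit at the origin. Away from the boundary
  -- a translate of `A` fits inside `B n`, which gives the upper bound.
  obtain ⟨A, hA⟩ := (hL.eventually_lt_const (lt_add_of_pos_right L hε)).exists
  obtain ⟨m, hm⟩ := hB A
  refine ⟨m, ?_⟩
  filter_upwards [hm] with n hn x hx
  have h1 := hφ (hn x hx) x
  have h2 := hT A x 0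
  rw [zero_add] at h2
  rw [abs_of_nonneg (sub_nonneg.2 (hlow _ _))]
  linarith

end

end Averages

/-! ### Geometry of the half-space -/

section Geometry

open scoped Classical

noncomputable section

/-- Horizontal translation of the lattice. -/
def latticeShift (d : ℕ) (v : Fin (d - 1) → ℤ) : Lattice d ≃ Lattice d :=
  (Equiv.addRight v).prodCongr (Equiv.refl ℤ)

/-- Horizontal translation of the half-space. -/
def halfShift (d : ℕ) (v : Fin (d - 1) → ℤ) : HalfSpace d ≃ HalfSpace d :=
  (latticeShift d v).subtypeEquiv fun _ => Iff.rfl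

lemma latticeShift_apply (d : ℕ) (v : Fin (d - 1) → ℤ) (i : Lattice d) :
    latticeShift d v i = (i.1 + v, i.2) := rfl

lemma halfShift_val (d : ℕ) (v : Fin (d - 1) → ℤ) (i : HalfSpace d) :
    (halfShift d v i).1 = (i.1.1 + v, i.1.2) := rfl

lemma latticeGraph_adj {d : ℕ} {i j : Lattice d} :
    (latticeGraph d).Adj i j ↔ (∑ k, |i.1 k - j.1 k|) + |i.2 - j.2| = 1 := Iff.rfl

lemma halfGraph_adj {d : ℕ} {i j : HalfSpace d} :
    (halfGraph d).Adj i j ↔ (latticeGraph d).Adj i.1 j.1 := Iff.rfl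

lemma latticeShift_adj (d : ℕ) (v : Fin (d - 1) → ℤ) (i j : Lattice d) :
    (latticeGraph d).Adj (latticeShift d v i) (latticeShift d v j) ↔ (latticeGraph d).Adj i j := by
  simp [latticeGraph_adj, latticeShift_apply]

lemma halfShift_adj (d : ℕ) (v : Fin (d - 1) → ℤ) (i j : HalfSpace d) :
    (halfGraph d).Adj (halfShift d v i) (halfShift d v j) ↔ (halfGraph d).Adj i j := by
  simp [halfGraph_adj, latticeGraph_adj, halfShift_val]

/-- The box `[-n, n]^(d-1) × [1, k]`. -/
def halfBox (d n k : ℕ) : Finset (HalfSpace d) :=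
  Finset.subtype (fun i : Lattice d => 1 ≤ i.2) (cube (d - 1) n ×ˢ Finset.Icc (1 : ℤ) k)

lemma box_eq_halfBox (d n : ℕ) : box d n = halfBox d n n := rfl

lemma mem_halfBox {d n k : ℕ} {i : HalfSpace d} :
    i ∈ halfBox d n k ↔ (∀ j, |i.1.1 j| ≤ n) ∧ i.1.2 ≤ k := by
  have := i.2
  simp [halfBox, mem_cube, this]

lemma mem_doubleBox {d n : ℕ} {i : Lattice d} :
    i ∈ doubleBox d n ↔ (∀ j, |i.1 j| ≤ n) ∧ 1 - (n : ℤ) ≤ i.2 ∧ i.2 ≤ n := by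
  rw [← mem_cube]
  simp [doubleBox, cube]

lemma card_wallBox (d n : ℕ) : (wallBox d n).card = (cube (d - 1) n).card := by
  simp [wallBox, cube]

/-- The site `(x, ℓ + 1)` of the half-space. -/
def site {d : ℕ} (x : Fin (d - 1) → ℤ) (ℓ : ℕ) : HalfSpace d := ⟨(x, (ℓ : ℤ) + 1), by simp⟩

lemma site_injective {d : ℕ} {x y : Fin (d - 1) → ℤ} {ℓ m : ℕ} :
    (site x ℓ : HalfSpace d) = site y m ↔ x = y ∧ ℓ = m := by
  simp [site]

lemma exists_eq_site {d : ℕ} (i : HalfSpace d) : ∃ x ℓ, i = site x ℓ := by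
  obtain ⟨⟨x, z⟩, hz⟩ := i
  have hz' : (1 : ℤ) ≤ z := hz
  exact ⟨x, (z - 1).toNat, by simp [site]; omega⟩

lemma site_mem_halfBox {d n k : ℕ} {x : Fin (d - 1) → ℤ} {ℓ : ℕ} :
    (site x ℓ : HalfSpace d) ∈ halfBox d n k ↔ x ∈ cube (d - 1) n ∧ ℓ < k := by
  rw [mem_halfBox, mem_cube]
  simp only [site]
  constructor
  · rintro ⟨h1, h2⟩; exact ⟨h1, by omega⟩
  · rintro ⟨h1, h2⟩; exact ⟨h1, by omega⟩

lemma halfShift_site {d : ℕ} (v x : Fin (d - 1) → ℤ) (ℓ : ℕ) :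
    halfShift d v (site x ℓ) = site (x + v) ℓ := rfl

lemma sum_halfBox (d n k : ℕ) (F : HalfSpace d → ℝ) :
    ∑ i ∈ halfBox d n k, F i = ∑ ℓ ∈ Finset.range k, ∑ x ∈ cube (d - 1) n, F (site x ℓ) := by
  rw [← Finset.sum_product']
  symm
  refine Finset.sum_bij (fun p _ => site p.2 p.1) ?_ ?_ ?_ ?_
  · rintro ⟨ℓ, x⟩ h
    simp only [Finset.mem_product, Finset.mem_range] at h
    exact site_mem_halfBox.2 ⟨h.2, h.1⟩
  · rintro ⟨ℓ, x⟩ _ ⟨m, y⟩ _ h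
    obtain ⟨rfl, rfl⟩ := site_injective.1 h
    rfl
  · intro i hi
    obtain ⟨x, ℓ, rfl⟩ := exists_eq_site i
    obtain ⟨h1, h2⟩ := site_mem_halfBox.1 hi
    exact ⟨(ℓ, x), by simp [h1, h2], rfl⟩
  · intros; rfl

lemma exists_bound {d : ℕ} (A : Finset (Lattice d)) :
    ∃ m : ℕ, ∀ i ∈ A, (∀ j, |i.1 j| ≤ m) ∧ |i.2| ≤ m := by
  refine ⟨A.sup fun i => (∑ j, (i.1 j).natAbs) + i.2.natAbs, fun i hi => ?_⟩
  have h1 := Finset.le_sup (f := fun i : Lattice d => (∑ j, (i.1 j).natAbs) + i.2.natAbs) hi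
  refine ⟨fun j => ?_, ?_⟩
  · have h2 := Finset.single_le_sum (f := fun j => (i.1 j).natAbs) (fun _ _ => Nat.zero_le _)
      (Finset.mem_univ j)
    rw [Int.abs_eq_natAbs]
    omega
  · rw [Int.abs_eq_natAbs]
    omega

lemma exists_bound_half {d : ℕ} (A : Finset (HalfSpace d)) :
    ∃ m : ℕ, ∀ i ∈ A, (∀ j, |i.1.1 j| ≤ m) ∧ i.1.2 ≤ m := by
  obtain ⟨m, hm⟩ := exists_bound (A.map (Function.Embedding.subtype _))
  refine ⟨m, fun i hi => ?_⟩
  have := hm i.1 (Finset.mem_map_of_mem (Function.Embedding.subtype _) hi)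
  exact ⟨this.1, (le_abs_self _).trans this.2⟩

lemma abs_add_le_of_mem_cube {k n m : ℕ} (hn : m ≤ n) {x y : Fin k → ℤ} (hx : x ∈ cube k (n - m))
    (hy : ∀ j, |y j| ≤ m) (j : Fin k) : |(y + x) j| ≤ n := by
  have h1 := mem_cube.1 hx j
  have h2 := abs_add_le (y j) (x j)
  have h3 := hy j
  rw [Nat.cast_sub hn] at h1
  simp only [Pi.add_apply]
  linarith

lemma exists_halfShift_subset {d : ℕ} {K : ℕ → ℕ} (hK : Tendsto K atTop atTop)
    (A : Finset (HalfSpace d)) : ∃ m : ℕ, ∀ᶠ n in atTop, ∀ x ∈ cube (d - 1) (n - m),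
      A.map (halfShift d x).toEmbedding ⊆ halfBox d n (K n) := by
  obtain ⟨m, hm⟩ := exists_bound_half A
  refine ⟨m, ?_⟩
  filter_upwards [eventually_ge_atTop m, hK.eventually_ge_atTop m] with n hn hkn x hx
  intro i hi
  obtain ⟨j, hj, rfl⟩ := Finset.mem_map.1 hi
  refine mem_halfBox.2 ⟨fun l => abs_add_le_of_mem_cube hn hx (hm j hj).1 l, ?_⟩
  exact (hm j hj).2.trans (by exact_mod_cast hkn)

lemma exists_latticeShift_subset {d : ℕ} (A : Finset (Lattice d)) :
    ∃ m : ℕ, ∀ᶠ n in atTop, ∀ x ∈ cube (d - 1) (n - m),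
      A.map (latticeShift d x).toEmbedding ⊆ doubleBox d n := by
  obtain ⟨m, hm⟩ := exists_bound A
  refine ⟨m, ?_⟩
  filter_upwards [eventually_ge_atTop (m + 1)] with n hn x hx
  intro i hi
  obtain ⟨j, hj, rfl⟩ := Finset.mem_map.1 hi
  have h2 := abs_le.1 (hm j hj).2
  refine mem_doubleBox.2
    ⟨fun l => abs_add_le_of_mem_cube (by omega) hx (hm j hj).1 l, ?_, ?_⟩
  · simp only [Equiv.coe_toEmbedding, latticeShift_apply]; omega
  · simp only [Equiv.coe_toEmbedding, latticeShift_apply]; omega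

lemma invades_box (d : ℕ) : Invades (box d) := by
  intro A
  obtain ⟨m, hm⟩ := exists_bound_half A
  refine ⟨m, fun n hn i hi => ?_⟩
  rw [box_eq_halfBox, mem_halfBox]
  have h := hm i hi
  exact ⟨fun j => (h.1 j).trans (by omega), h.2.trans (by omega)⟩

/-- A field that depends only on the layer: `f ℓ` on the layer `i_d = ℓ + 1`. -/
def layerField (d : ℕ) (f : ℕ → ℝ) (i : HalfSpace d) : ℝ := f (i.1.2 - 1).toNat

lemma layerField_site {d : ℕ} (f : ℕ → ℝ) (x : Fin (d - 1) → ℤ) (ℓ : ℕ) :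
    layerField d f (site x ℓ) = f ℓ := by
  simp [layerField, site]

lemma decayField_eq_layerField (d : ℕ) (δ lam : ℝ) :
    decayField d δ lam = layerField d fun ℓ => lam * (1 / ((ℓ : ℝ) + 1) ^ δ) := by
  funext i
  obtain ⟨x, ℓ, rfl⟩ := exists_eq_site i
  rw [layerField_site]
  simp [decayField, site, div_eq_mul_inv]

/-- Expectations in the half-space are covariant under horizontal translations. -/
lemma gibbsAvg_halfShift {d : ℕ} (J : ℝ) (f : ℕ → ℝ) (Λ : Finset (HalfSpace d))
    (v : Fin (d - 1) → ℤ) (b : Bool) (x : Fin (d - 1) → ℤ) (ℓ : ℕ) :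
    gibbsAvg (edgeEnergy (halfGraph d) (fun _ => J) (layerField d f)
        (Λ.map (halfShift d v).toEmbedding)) (Λ.map (halfShift d v).toEmbedding) (fun _ => b)
        (fun σ => spin (σ (site (x + v) ℓ))) =
      gibbsAvg (edgeEnergy (halfGraph d) (fun _ => J) (layerField d f) Λ) Λ (fun _ => b)
        (fun σ => spin (σ (site x ℓ))) :=
  gibbsAvg_equiv (halfGraph d) (halfGraph d) (halfShift d v) (halfShift_adj d v) Λ (fun _ => J)
    (layerField d f) (fun _ => b) (fun σ => spin (σ (site x ℓ)))

/-- The height `K n` need only diverge. Boxes of heights `n` and `n + L` therefore share the same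
limit, as required in `gapLim_eq_zero_of_finite_layers`. -/
lemma tendsto_avg_plus {d : ℕ} {J : ℝ} (hJ : 0 ≤ J) (f : ℕ → ℝ) (ℓ : ℕ) {K : ℕ → ℕ}
    (hK : Tendsto K atTop atTop) :
    Tendsto (fun n => (∑ x ∈ cube (d - 1) n, gibbsAvg (edgeEnergy (halfGraph d) (fun _ => J)
        (layerField d f) (halfBox d n (K n))) (halfBox d n (K n)) (plusConfig _)
        (fun σ => spin (σ (site x ℓ)))) / (cube (d - 1) n).card) atTop
      (𝓝 (plusLim (halfGraph d) (fun _ => J) (layerField d f) fun σ => spin (σ (site 0 ℓ)))) :=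
  tendsto_cube_avg_of_antitone (halfShift d)
    (φ := fun Λ x => gibbsAvg (edgeEnergy (halfGraph d) (fun _ => J) (layerField d f) Λ) Λ
      (plusConfig _) (fun σ => spin (σ (site x ℓ)))) (C := 1)
    (fun _ _ => abs_gibbsAvg_spin_le _ _ _ _)
    (fun hΛ _ => gibbsAvg_plus_antitone _ (fun _ => hJ) _ hΛ (monotone_spin_apply _))
    (fun Λ v x => gibbsAvg_halfShift J f Λ v true x ℓ)
    (tendsto_plusLim _ (fun _ => hJ) _ (monotone_spin_apply _))
    (exists_halfShift_subset hK)

lemma tendsto_avg_minus {d : ℕ} {J : ℝ} (hJ : 0 ≤ J) (f : ℕ → ℝ) (ℓ : ℕ) {K : ℕ → ℕ}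
    (hK : Tendsto K atTop atTop) :
    Tendsto (fun n => (∑ x ∈ cube (d - 1) n, gibbsAvg (edgeEnergy (halfGraph d) (fun _ => J)
        (layerField d f) (halfBox d n (K n))) (halfBox d n (K n)) (minusConfig _)
        (fun σ => spin (σ (site x ℓ)))) / (cube (d - 1) n).card) atTop
      (𝓝 (minusLim (halfGraph d) (fun _ => J) (layerField d f)
        fun σ => spin (σ (site 0 ℓ)))) := by
  have := tendsto_cube_avg_of_antitone (halfShift d)
    (φ := fun Λ x => -gibbsAvg (edgeEnergy (halfGraph d) (fun _ => J) (layerField d f) Λ) Λ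
      (minusConfig _) (fun σ => spin (σ (site x ℓ)))) (C := 1)
    (fun _ _ => by rw [abs_neg]; exact abs_gibbsAvg_spin_le _ _ _ _)
    (fun hΛ _ => neg_le_neg
      (gibbsAvg_minus_monotone _ (fun _ => hJ) _ hΛ (monotone_spin_apply _)))
    (fun Λ v x => congrArg Neg.neg (gibbsAvg_halfShift J f Λ v false x ℓ))
    (tendsto_minusLim _ (fun _ => hJ) _ (monotone_spin_apply _)).neg
    (exists_halfShift_subset hK)
  simpa [neg_div] using this.neg

lemma tendsto_avg_gap {d : ℕ} {J : ℝ} (hJ : 0 ≤ J) (f : ℕ → ℝ) (ℓ : ℕ) {K : ℕ → ℕ}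
    (hK : Tendsto K atTop atTop) :
    Tendsto (fun n => (∑ x ∈ cube (d - 1) n, magGap (halfGraph d) (fun _ => J)
        (layerField d f) (halfBox d n (K n)) (site x ℓ)) / (cube (d - 1) n).card) atTop
      (𝓝 (gapLim (halfGraph d) (fun _ => J) (layerField d f) (site 0 ℓ))) := by
  have := (tendsto_avg_plus (d := d) hJ f ℓ hK).sub (tendsto_avg_minus (d := d) hJ f ℓ hK)
  simp only [← sub_div, ← Finset.sum_sub_distrib] at this
  exact this

end

end Geometry

/-! ### Comparison with a smaller box -/

section Comparison

open scoped Classical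

noncomputable section

variable {V : Type} (G : SimpleGraph V) [G.LocallyFinite]

lemma boltzSum_congr (E : Config V → ℝ) (Λ : Finset V) {η η' : Config V}
    (h : ∀ i, i ∉ Λ → η i = η' i) (f : Config V → ℝ) :
    boltzSum E Λ η f = boltzSum E Λ η' f := by
  simp only [boltzSum, glue_congr h]

/-- Equal to `+1` on `A` and to `η` elsewhere. -/
def plusOn (A : Finset V) (η : Config V) : Config V := fun i => if i ∈ A then true else η i

lemma boltzSum_plusInd (c : Sym2 V → ℝ) (h : V → ℝ) {Λ Λ' : Finset V} (hΛ : Λ' ⊆ Λ)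
    (η : Config V) :
    boltzSum (edgeEnergy G c h Λ) Λ η (plusInd (Λ \ Λ')) =
      Real.exp (-restEnergy G c h Λ' Λ (plusOn (Λ \ Λ') η)) *
        partitionFn (edgeEnergy G c h Λ') Λ' (plusOn (Λ \ Λ') η) := by
  rw [← boltzSum_one, ← boltzSum_restrict G c h hΛ,
    boltzSum_congr _ Λ (η := η) (η' := plusOn (Λ \ Λ') η)]
  · congr 1
    funext σ
    simp only [plusInd]
    refine if_congr ?_ rfl rfl
    simp only [Finset.mem_sdiff]
    constructor
    · intro H i hi hi'
      simp [plusOn, hi, hi', H i ⟨hi, hi'⟩]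
    · rintro H i ⟨hi, hi'⟩
      simpa [plusOn, hi, hi'] using H i hi hi'
  · intro i hi
    simp [plusOn, hi]

/-- By FKG the event that `Λ \ Λ'` is all plus is at least as likely under plus as under minus
boundary conditions. Each probability is a frozen Boltzmann factor times a partition function in
`Λ'`, divided by one in `Λ`; the bound is the logarithm of this comparison. -/
lemma logRatio_le {c : Sym2 V → ℝ} (hc : ∀ e, 0 ≤ c e) (h : V → ℝ) {Λ Λ' : Finset V}
    (hΛ : Λ' ⊆ Λ) :
    logRatio G c h Λ ≤
      Real.log (partitionFn (edgeEnergy G c h Λ') Λ' (plusOn (Λ \ Λ') (plusConfig V))) -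
      Real.log (partitionFn (edgeEnergy G c h Λ') Λ' (plusOn (Λ \ Λ') (minusConfig V))) +
      (restEnergy G c h Λ' Λ (plusOn (Λ \ Λ') (minusConfig V)) -
        restEnergy G c h Λ' Λ (plusOn (Λ \ Λ') (plusConfig V))) := by
  have h1 := gibbsAvg_mono G hc (Λ := Λ) (fun i _ => le_refl (h i)) (minusConfig_le (plusConfig V))
    (plusInd_monotone (Λ \ Λ'))
  rw [gibbsAvg, gibbsAvg, boltzSum_plusInd G c h hΛ, boltzSum_plusInd G c h hΛ] at h1
  have hp : ∀ (Λ : Finset V) (η : Config V), 0 < partitionFn (edgeEnergy G c h Λ) Λ η :=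
    fun _ _ => partitionFn_pos _ _ _
  have h2 := Real.log_le_log (div_pos (mul_pos (Real.exp_pos _) (hp _ _)) (hp _ _)) h1
  rw [Real.log_div (mul_pos (Real.exp_pos _) (hp _ _)).ne' (hp _ _).ne',
    Real.log_div (mul_pos (Real.exp_pos _) (hp _ _)).ne' (hp _ _).ne',
    Real.log_mul (Real.exp_pos _).ne' (hp _ _).ne',
    Real.log_mul (Real.exp_pos _).ne' (hp _ _).ne', Real.log_exp, Real.log_exp] at h2
  rw [logRatio]
  linarith

/-- The boundary contribution is controlled by the sites of `Λ \ Λ'` adjacent to the complement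
of `Λ`. -/
lemma restEnergy_sub_le {J : ℝ} (hJ : 0 ≤ J) (h : V → ℝ) (Λ Λ' : Finset V) (S : Finset V)
    (hS : ∀ i ∈ Λ \ Λ', ∀ j, G.Adj i j → j ∉ Λ → i ∈ S) :
    restEnergy G (fun _ => J) h Λ' Λ (plusOn (Λ \ Λ') (minusConfig V)) -
        restEnergy G (fun _ => J) h Λ' Λ (plusOn (Λ \ Λ') (plusConfig V)) ≤
      2 * J * ∑ i ∈ S, (G.degree i : ℝ) := by
  set ηp := plusOn (Λ \ Λ') (plusConfig V)
  set ηm := plusOn (Λ \ Λ') (minusConfig V)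
  have hpm : ∀ i ∈ Λ \ Λ', ηm i = ηp i := fun i hi => by
    simp only [ηp, ηm, plusOn, if_pos hi]
  have h1 : ∑ i ∈ Λ \ Λ', h i * spin (ηm i) = ∑ i ∈ Λ \ Λ', h i * spin (ηp i) :=
    Finset.sum_congr rfl fun i hi => by rw [hpm i hi]
  set X := edgesMeeting G Λ \ edgesMeeting G Λ'
  -- The edges of `X` do not meet `Λ'`, and both configurations are plus on `Λ \ Λ'`. Only edges
  -- leaving `Λ` can differ, each by at most `2`, and their inner endpoint lies in `S`.
  have h2 : ∀ e ∈ X, bondProduct ηp e - bondProduct ηm e ≤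
      if e ∈ S.biUnion fun i => G.incidenceFinset i then 2 else 0 := by
    intro e he
    split_ifs with heS
    · have h3 := abs_le.1 (abs_bondProduct ηp e).le
      have h4 := abs_le.1 (abs_bondProduct ηm e).le
      linarith
    · rw [Finset.mem_sdiff, mem_edgesMeeting, mem_edgesMeeting] at he
      obtain ⟨⟨heG, i, hi, hie⟩, he'⟩ := he
      have hi' : i ∈ Λ \ Λ' := Finset.mem_sdiff.2 ⟨hi, fun hi' => he' ⟨heG, i, hi', hie⟩⟩
      obtain ⟨j, rfl⟩ := Sym2.mem_iff_exists.1 hie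
      by_cases hj : j ∈ Λ
      · have hj' : j ∈ Λ \ Λ' :=
          Finset.mem_sdiff.2 ⟨hj, fun hj' => he' ⟨heG, j, hj', by simp⟩⟩
        rw [bondProduct_mk, bondProduct_mk, hpm i hi', hpm j hj', sub_self]
      · exfalso
        refine heS (Finset.mem_biUnion.2 ⟨i, hS i hi' j heG hj, ?_⟩)
        rw [SimpleGraph.mem_incidenceFinset]
        exact ⟨heG, by simp⟩
  have h5 : ∑ e ∈ X, (bondProduct ηp e - bondProduct ηm e) ≤ 2 * ∑ i ∈ S, (G.degree i : ℝ) := by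
    refine (Finset.sum_le_sum h2).trans ?_
    rw [← Finset.sum_filter, Finset.sum_const, nsmul_eq_mul, mul_comm]
    refine mul_le_mul_of_nonneg_left ?_ (by norm_num)
    have h6 : (X.filter fun e => e ∈ S.biUnion fun i => G.incidenceFinset i).card ≤
        ∑ i ∈ S, G.degree i := by
      refine (Finset.card_le_card fun e he => (Finset.mem_filter.1 he).2).trans
        (Finset.card_biUnion_le.trans (Finset.sum_le_sum fun i _ => ?_))
      rw [G.card_incidenceFinset_eq_degree]
    exact_mod_cast h6
  have h7 : restEnergy G (fun _ => J) h Λ' Λ ηm - restEnergy G (fun _ => J) h Λ' Λ ηp =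
      J * ∑ e ∈ X, (bondProduct ηp e - bondProduct ηm e) := by
    simp only [restEnergy, h1, Finset.sum_sub_distrib, mul_sub, ← Finset.mul_sum]
    ring
  rw [h7]
  nlinarith

lemma logRatio_le_add {J : ℝ} (hJ : 0 ≤ J) (h : V → ℝ) {Λ Λ' T S : Finset V} (hΛ : Λ' ⊆ Λ)
    (hT : ∀ i, i ∈ T ↔ i ∈ Λ ∧ i ∉ Λ') (hS : ∀ i ∈ T, ∀ j, G.Adj i j → j ∉ Λ → i ∈ S) :
    logRatio G (fun _ => J) h Λ ≤
      Real.log (partitionFn (edgeEnergy G (fun _ => J) h Λ') Λ' (plusOn T fun _ => true)) -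
      Real.log (partitionFn (edgeEnergy G (fun _ => J) h Λ') Λ' (plusOn T fun _ => false)) +
      2 * J * ∑ i ∈ S, (G.degree i : ℝ) := by
  obtain rfl : T = Λ \ Λ' := by
    ext i
    rw [hT, Finset.mem_sdiff]
  exact (logRatio_le G (fun _ => hJ) h hΛ).trans
    (add_le_add le_rfl (restEnergy_sub_le G hJ h Λ Λ' S hS))

end

end Comparison

/-! ### Vertical translation -/

section Vertical

open scoped Classical

noncomputable section

/-- Translation of the half-space by `L` upwards. -/
def liftUp (d L : ℕ) : HalfSpace d ↪ HalfSpace d where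
  toFun i := ⟨(i.1.1, i.1.2 + L), by have := i.2; simp only; omega⟩
  inj' i j h := by
    have h1 := congrArg Subtype.val h
    simp only [Prod.mk.injEq, add_left_inj] at h1
    exact Subtype.ext (Prod.ext h1.1 h1.2)

lemma liftUp_val {d L : ℕ} (i : HalfSpace d) : (liftUp d L i).1 = (i.1.1, i.1.2 + (L : ℤ)) := rfl

lemma liftUp_site {d L : ℕ} (x : Fin (d - 1) → ℤ) (ℓ : ℕ) :
    liftUp d L (site x ℓ) = site x (ℓ + L) := by
  apply Subtype.ext
  rw [liftUp_val]
  simp only [site, Nat.cast_add, Prod.mk.injEq, true_and]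
  ring

lemma liftUp_adj {d L : ℕ} (i j : HalfSpace d) :
    (halfGraph d).Adj (liftUp d L i) (liftUp d L j) ↔ (halfGraph d).Adj i j := by
  simp [halfGraph_adj, latticeGraph_adj, liftUp_val]

/-- An edge that changes the last coordinate by at least one is vertical. -/
lemma eq_of_latticeGraph_adj {d : ℕ} {i j : Lattice d} (h : (latticeGraph d).Adj i j)
    (h2 : j.2 + 1 ≤ i.2) : j.1 = i.1 ∧ j.2 + 1 = i.2 := by
  rw [latticeGraph_adj] at h
  have h0 : 0 ≤ ∑ k, |i.1 k - j.1 k| := Finset.sum_nonneg fun _ _ => abs_nonneg _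
  have h3 : i.2 - j.2 ≤ |i.2 - j.2| := le_abs_self _
  have h4 : ∑ k, |i.1 k - j.1 k| = 0 := by omega
  rw [Finset.sum_eq_zero_iff_of_nonneg fun _ _ => abs_nonneg _] at h4
  refine ⟨funext fun k => ?_, by omega⟩
  have := abs_eq_zero.1 (h4 k (Finset.mem_univ k))
  omega

lemma latticeGraph_adj_vertical {d : ℕ} (x : Fin (d - 1) → ℤ) (z : ℤ) :
    (latticeGraph d).Adj (x, z + 1) (x, z) := by
  simp [latticeGraph_adj]

lemma abs_sub_le_of_latticeGraph_adj {d : ℕ} {i j : Lattice d} (h : (latticeGraph d).Adj i j) :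
    (∀ k, |i.1 k - j.1 k| ≤ 1) ∧ |i.2 - j.2| ≤ 1 := by
  rw [latticeGraph_adj] at h
  have h0 : 0 ≤ ∑ k, |i.1 k - j.1 k| := Finset.sum_nonneg fun _ _ => abs_nonneg _
  have h1 := abs_nonneg (i.2 - j.2)
  refine ⟨fun k => ?_, by linarith⟩
  have := Finset.single_le_sum (f := fun k => |i.1 k - j.1 k|)
    (fun _ _ => abs_nonneg _) (Finset.mem_univ k)
  linarith

/-- Used to write the boundary cost in `logRatio_halfBox_le` as a constant times the number of
boundary columns. -/
lemma degree_site {d : ℕ} (x : Fin (d - 1) → ℤ) (ℓ : ℕ) :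
    (halfGraph d).degree (site x ℓ) = (halfGraph d).degree (site 0 ℓ) := by
  let φ : halfGraph d ≃g halfGraph d := ⟨halfShift d x, fun {i j} => halfShift_adj d x i j⟩
  have h1 : φ (site 0 ℓ) = site x ℓ := by
    change halfShift d x (site 0 ℓ) = _
    rw [halfShift_site, zero_add]
  rw [← h1, SimpleGraph.Iso.degree_eq]

lemma liftUp_halfBox_subset {d n k L : ℕ} :
    (halfBox d n k).map (liftUp d L) ⊆ halfBox d n (k + L) := by
  intro i hi
  obtain ⟨j, hj, rfl⟩ := Finset.mem_map.1 hi
  obtain ⟨x, ℓ, rfl⟩ := exists_eq_site j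
  rw [liftUp_site, site_mem_halfBox]
  rw [site_mem_halfBox] at hj
  exact ⟨hj.1, by omega⟩

lemma site_mem_bottom {d n k L : ℕ} {x : Fin (d - 1) → ℤ} {ℓ : ℕ} :
    (site x ℓ : HalfSpace d) ∈ halfBox d n (k + L) ∧
      site x ℓ ∉ (halfBox d n k).map (liftUp d L) ↔ x ∈ cube (d - 1) n ∧ ℓ < k + L ∧ ℓ < L := by
  rw [site_mem_halfBox, Finset.mem_map]
  constructor
  · rintro ⟨⟨h1, h2⟩, h3⟩
    refine ⟨h1, h2, ?_⟩
    by_contra h4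
    refine h3 ⟨site x (ℓ - L), site_mem_halfBox.2 ⟨h1, by omega⟩, ?_⟩
    rw [liftUp_site]
    congr 1
    omega
  · rintro ⟨h1, h2, h3⟩
    refine ⟨⟨h1, h2⟩, ?_⟩
    rintro ⟨j, hj, hjx⟩
    obtain ⟨y, m, rfl⟩ := exists_eq_site j
    rw [liftUp_site] at hjx
    have := (site_injective.1 hjx).2
    omega

/-- The field `s` on the first layer. -/
def wallField (s : ℝ) : ℕ → ℝ := fun ℓ => if ℓ = 0 then s else 0

/-- With plus spins on the lowest `L` layers, the remaining box sees the wall field `J`. -/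
lemma partitionFn_liftUp {d n k L : ℕ} (hL : 0 < L) (J : ℝ) {g : ℕ → ℝ}
    (hg : ∀ ℓ, L ≤ ℓ → g ℓ = 0) (b : Bool) {η : Config (HalfSpace d)}
    (hη₁ : ∀ x ∈ cube (d - 1) n, η (site x (L - 1)) = true)
    (hη₂ : ∀ x ℓ, η (site x (ℓ + L)) = b) :
    partitionFn (edgeEnergy (halfGraph d) (fun _ => J) (layerField d g)
        ((halfBox d n k).map (liftUp d L))) ((halfBox d n k).map (liftUp d L)) η =
      partitionFn (edgeEnergy (halfGraph d) (fun _ => J) (layerField d (wallField J))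
        (halfBox d n k)) (halfBox d n k) fun _ => b := by
  set Λ' := (halfBox d n k).map (liftUp d L)
  -- The site just below the lifted first layer. Its value at sites off the first layer is
  -- irrelevant.
  let θ : HalfSpace d → HalfSpace d := fun i => site i.1.1 (L - 1)
  have hθr : ∀ x, (site x (L - 1) : HalfSpace d) ∉ Set.range (liftUp d L) := by
    rintro x ⟨j, hj⟩
    obtain ⟨y, m, rfl⟩ := exists_eq_site j
    rw [liftUp_site] at hj
    have := (site_injective.1 hj).2
    omega
  have hη : (fun i => η (liftUp d L i)) = fun _ => b := by
    funext i
    obtain ⟨x, ℓ, rfl⟩ := exists_eq_site i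
    rw [liftUp_site, hη₂]
  have key := partitionFn_map (a := 0) (liftUp d L) (halfBox d n k) η
    (E := edgeEnergy (halfGraph d) (fun _ => J) (layerField d (wallField J)) (halfBox d n k))
    (E' := edgeEnergy (halfGraph d) (fun _ => J) (layerField d g) Λ') ?_
  · rw [key, hη]
    simp
  · intro σ' hσ'
    rw [edgeEnergy_map (halfGraph d) (halfGraph d) (liftUp d L) liftUp_adj (halfBox d n k)
      (fun i => i.1.2 = 1) θ]
    · have h1 : ∀ i, layerField d g (liftUp d L i) = 0 := by
        intro i
        obtain ⟨x, ℓ, rfl⟩ := exists_eq_site i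
        rw [liftUp_site, layerField_site, hg _ (Nat.le_add_left _ _)]
      have h2 : ∀ i ∈ (halfBox d n k).filter fun i => i.1.2 = 1, σ' (θ i) = true := by
        intro i hi
        obtain ⟨hi1, hi2⟩ := Finset.mem_filter.1 hi
        obtain ⟨x, ℓ, rfl⟩ := exists_eq_site i
        rw [site_mem_halfBox] at hi1
        have hm := (site_mem_bottom (d := d) (k := k)).2
          ⟨hi1.1, (by omega : L - 1 < k + L), (by omega : L - 1 < L)⟩
        change σ' (site x (L - 1)) = true
        rw [hσ' _ hm.2]
        exact hη₁ x hi1.1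
      simp only [edgeEnergy, h1]
      -- A bond of strength `J` to a frozen plus spin contributes `J` times the upper spin, exactly
      -- as a wall field `J` does.
      have h3 : ∑ i ∈ halfBox d n k, layerField d (wallField J) i * spin (σ' (liftUp d L i)) =
          ∑ i ∈ halfBox d n k with i.1.2 = 1, J * (spin (σ' (liftUp d L i)) * spin (σ' (θ i))) := by
        rw [Finset.sum_filter]
        refine Finset.sum_congr rfl fun i hi => ?_
        split_ifs with hw
        · rw [h2 i (Finset.mem_filter.2 ⟨hi, hw⟩), spin_true, mul_one]
          obtain ⟨x, ℓ, rfl⟩ := exists_eq_site i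
          simp only [site] at hw
          have : ℓ = 0 := by omega
          subst this
          rw [layerField_site, wallField, if_pos rfl]
        · obtain ⟨x, ℓ, rfl⟩ := exists_eq_site i
          simp only [site] at hw
          have : ℓ ≠ 0 := by rintro rfl; simp at hw
          rw [layerField_site, wallField, if_neg this, zero_mul]
      rw [h3]
      simp only [zero_mul, Finset.sum_const_zero]
      ring_nf
    · intro i _ w hw hwr
      obtain ⟨x, ℓ, rfl⟩ := exists_eq_site i
      obtain ⟨y, m, rfl⟩ := exists_eq_site w
      have hmL : m < L := by
        by_contra hm
        exact hwr ⟨site y (m - L), by rw [liftUp_site]; congr 1; omega⟩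
      rw [liftUp_site, halfGraph_adj] at hw
      obtain ⟨h1, h2⟩ := eq_of_latticeGraph_adj hw (by simp only [site]; push_cast; omega)
      simp only [site, Nat.cast_add] at h1 h2
      subst h1
      refine ⟨by simp only [site]; omega, ?_⟩
      change _ = site y (L - 1)
      congr 1
      omega
    · intro i _ hi
      refine ⟨?_, hθr _⟩
      obtain ⟨x, ℓ, rfl⟩ := exists_eq_site i
      simp only [site] at hi
      have : ℓ = 0 := by omega
      subst this
      rw [liftUp_site, halfGraph_adj]
      have := latticeGraph_adj_vertical (d := d) x ((L - 1 : ℕ) + 1 : ℤ)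
      convert! this using 2
      simp only [site]
      push_cast
      omega

/-- Forcing the lowest `L` layers to be plus erases the field `g`, which lives there, and replaces
it by the wall field `J`. Whatever the size of `g`, the cost is of the order of the lateral
boundary, negligible against the wall area. -/
lemma logRatio_halfBox_le {d : ℕ} {J : ℝ} (hJ : 0 ≤ J) {L : ℕ} (hL : 0 < L) {g : ℕ → ℝ}
    (hg : ∀ ℓ, L ≤ ℓ → g ℓ = 0) {n k : ℕ} (hn : 0 < n) (hk : 0 < k) :
    logRatio (halfGraph d) (fun _ => J) (layerField d g) (halfBox d n (k + L)) ≤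
      logRatio (halfGraph d) (fun _ => J) (layerField d (wallField J)) (halfBox d n k) +
      2 * J * (∑ ℓ ∈ Finset.range L, ((halfGraph d).degree (site 0 ℓ) : ℝ)) *
        ((cube (d - 1) n).card - (cube (d - 1) (n - 1)).card) := by
  have hsub := cube_mono (d - 1) (Nat.sub_le n 1)
  -- Edges leave the box from the lowest `L` layers only through the lateral faces: the half-space
  -- ends below, and `0 < k` keeps the top face out of reach.
  let S : Finset (HalfSpace d) :=
    (Finset.range L ×ˢ (cube (d - 1) n \ cube (d - 1) (n - 1))).image fun p => site p.2 p.1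
  obtain ⟨T, hT⟩ : ∃ T : Finset (HalfSpace d), ∀ i, i ∈ T ↔
      i ∈ halfBox d n (k + L) ∧ i ∉ (halfBox d n k).map (liftUp d L) :=
    ⟨halfBox d n (k + L) \ (halfBox d n k).map (liftUp d L), fun _ => Finset.mem_sdiff⟩
  have h1 := logRatio_le_add (halfGraph d) hJ (layerField d g) (S := S)
    (liftUp_halfBox_subset (d := d) (n := n) (k := k) (L := L)) hT ?_
  · have h3 : ∑ i ∈ S, ((halfGraph d).degree i : ℝ) =
        (∑ ℓ ∈ Finset.range L, ((halfGraph d).degree (site 0 ℓ) : ℝ)) *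
          ((cube (d - 1) n).card - (cube (d - 1) (n - 1)).card) := by
      rw [Finset.sum_image, Finset.sum_product, Finset.sum_mul]
      · refine Finset.sum_congr rfl fun ℓ _ => ?_
        simp only [degree_site]
        rw [Finset.sum_const, nsmul_eq_mul, Finset.card_sdiff_of_subset hsub,
          Nat.cast_sub (Finset.card_le_card hsub), mul_comm]
      · rintro ⟨ℓ, x⟩ _ ⟨m, y⟩ _ h
        obtain ⟨rfl, rfl⟩ := site_injective.1 h
        rfl
    rw [h3] at h1
    have h4 : ∀ b, ∀ x ∈ cube (d - 1) n, plusOn T (fun _ => b) (site x (L - 1)) = true := by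
      intro b x hx
      rw [plusOn, if_pos]
      rw [hT, site_mem_bottom]
      exact ⟨hx, by omega, by omega⟩
    have h5 : ∀ b x ℓ, plusOn T (fun _ => b) (site x (ℓ + L)) = b := by
      intro b x ℓ
      rw [plusOn, if_neg]
      rw [hT, site_mem_bottom]
      omega
    have e1 := partitionFn_liftUp (k := k) hL J hg true (h4 true) (h5 true)
    have e2 := partitionFn_liftUp (k := k) hL J hg false (h4 false) (h5 false)
    have e3 : logRatio (halfGraph d) (fun _ => J) (layerField d (wallField J)) (halfBox d n k) =
      Real.log (partitionFn (edgeEnergy (halfGraph d) (fun _ => J) (layerField d (wallField J))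
        (halfBox d n k)) (halfBox d n k) fun _ => true) -
      Real.log (partitionFn (edgeEnergy (halfGraph d) (fun _ => J) (layerField d (wallField J))
        (halfBox d n k)) (halfBox d n k) fun _ => false) := rfl
    rw [e3, ← e1, ← e2]
    rwa [mul_assoc]
  · intro i hi j hij hj
    obtain ⟨x, ℓ, rfl⟩ := exists_eq_site i
    obtain ⟨y, m, rfl⟩ := exists_eq_site j
    obtain ⟨hx, -, hℓ⟩ := site_mem_bottom.1 ((hT _).1 hi)
    refine Finset.mem_image.2 ⟨(ℓ, x), ?_, rfl⟩
    simp only [Finset.mem_product, Finset.mem_range, Finset.mem_sdiff]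
    refine ⟨hℓ, hx, fun hx' => hj (site_mem_halfBox.2 ?_)⟩
    obtain ⟨h4, h5⟩ := abs_sub_le_of_latticeGraph_adj hij
    simp only [site] at h4 h5
    rw [abs_le] at h5
    refine ⟨mem_cube.2 fun q => ?_, by omega⟩
    have h6 := abs_le.1 (h4 q)
    have h7 := abs_le.1 (mem_cube.1 hx' q)
    rw [Nat.cast_sub hn] at h7
    push_cast at h7
    rw [abs_le]
    constructor <;> linarith [h6.1, h6.2, h7.1, h7.2]

end

end Vertical

/-! ### Limits of free energies -/

section FreeEnergy

open scoped Classical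

noncomputable section

/-- Dominated convergence twice: over the layers with majorant `f ℓ * C`, and over the field
strength with a constant majorant. -/
lemma tendsto_integral_layers {f : ℕ → ℝ} (hf : Summable f) (f0 : ∀ ℓ, 0 ≤ f ℓ)
    {A : ℕ → ℝ → ℕ → ℝ} {M : ℝ → ℕ → ℝ} {C : ℝ} {K : ℕ → ℕ} (hK : Tendsto K atTop atTop)
    (hc : ∀ n ℓ, Continuous fun t => A n t ℓ) (hb : ∀ n t ℓ, |A n t ℓ| ≤ C)
    (hl : ∀ t ℓ, Tendsto (fun n => A n t ℓ) atTop (𝓝 (M t ℓ))) (a b : ℝ) :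
    Tendsto (fun n => ∫ t in a..b, ∑ ℓ ∈ Finset.range (K n), f ℓ * A n t ℓ) atTop
      (𝓝 (∫ t in a..b, ∑' ℓ, f ℓ * M t ℓ)) := by
  have hC : 0 ≤ C := (abs_nonneg _).trans (hb 0 0 0)
  have hterm : ∀ n t ℓ, |f ℓ * A n t ℓ| ≤ f ℓ * C := fun n t ℓ => by
    rw [abs_mul, abs_of_nonneg (f0 ℓ)]
    exact mul_le_mul_of_nonneg_left (hb n t ℓ) (f0 ℓ)
  refine intervalIntegral.tendsto_integral_filter_of_dominated_convergence
    (fun _ => (∑' ℓ, f ℓ) * C) ?_ ?_ ?_ ?_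
  · refine Eventually.of_forall fun n => Continuous.aestronglyMeasurable ?_
    exact continuous_finsetSum _ fun ℓ _ => continuous_const.mul (hc n ℓ)
  · refine Eventually.of_forall fun n => Eventually.of_forall fun t _ => ?_
    rw [Real.norm_eq_abs]
    refine (Finset.abs_sum_le_sum_abs _ _).trans
      ((Finset.sum_le_sum fun ℓ _ => hterm n t ℓ).trans ?_)
    rw [← Finset.sum_mul]
    exact mul_le_mul_of_nonneg_right (hf.sum_le_tsum _ fun ℓ _ => f0 ℓ) hC
  · exact intervalIntegrable_const
  · refine Eventually.of_forall fun t _ => ?_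
    have h1 : ∀ n, ∑ ℓ ∈ Finset.range (K n), f ℓ * A n t ℓ =
        ∑' ℓ, if ℓ < K n then f ℓ * A n t ℓ else 0 := fun n => by
      rw [tsum_eq_sum (s := Finset.range (K n))]
      · exact Finset.sum_congr rfl fun ℓ hℓ => (if_pos (Finset.mem_range.1 hℓ)).symm
      · exact fun ℓ hℓ => if_neg fun h => hℓ (Finset.mem_range.2 h)
    simp only [h1]
    refine tendsto_tsum_of_dominated_convergence (hf.mul_right C) (fun ℓ => ?_)
      (Eventually.of_forall fun n ℓ => ?_)
    · refine ((hl t ℓ).const_mul (f ℓ)).congr' ?_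
      filter_upwards [hK.eventually_gt_atTop ℓ] with n hn
      rw [if_pos hn]
    · split_ifs
      · exact hterm n t ℓ
      · simpa using mul_nonneg (f0 ℓ) hC

/-- A volume sum is normalised by an area. Grouped by layers, it becomes a sum of horizontal
averages with summable weights. -/
lemma tendsto_integral_halfBox {d : ℕ} {f : ℕ → ℝ} (hf : Summable f) (f0 : ∀ ℓ, 0 ≤ f ℓ)
    {X : ℕ → ℝ → HalfSpace d → ℝ} {M : ℝ → ℕ → ℝ} {C : ℝ} {K : ℕ → ℕ}
    (hK : Tendsto K atTop atTop) (hc : ∀ n i, Continuous fun t => X n t i)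
    (hb : ∀ n t i, |X n t i| ≤ C)
    (hl : ∀ t ℓ, Tendsto (fun n => (∑ x ∈ cube (d - 1) n, X n t (site x ℓ)) /
      (cube (d - 1) n).card) atTop (𝓝 (M t ℓ))) (a b : ℝ) :
    Tendsto (fun n => (∫ t in a..b, ∑ i ∈ halfBox d n (K n), layerField d f i * X n t i) /
      (cube (d - 1) n).card) atTop (𝓝 (∫ t in a..b, ∑' ℓ, f ℓ * M t ℓ)) := by
  have key := tendsto_integral_layers hf f0 hK
    (A := fun n t ℓ => (∑ x ∈ cube (d - 1) n, X n t (site x ℓ)) / (cube (d - 1) n).card) (C := C)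
    (fun n ℓ => (continuous_finsetSum _ fun x _ => hc n _).div_const _)
    (fun n t ℓ => by
      have hp := card_cube_pos (d - 1) n
      rw [abs_div, abs_of_pos hp, div_le_iff₀ hp]
      refine (Finset.abs_sum_le_sum_abs _ _).trans ((Finset.sum_le_card_nsmul _ _ C
        fun x _ => hb n t _).trans_eq ?_)
      rw [nsmul_eq_mul, mul_comm]) hl a b
  refine key.congr fun n => ?_
  rw [← intervalIntegral.integral_div]
  refine intervalIntegral.integral_congr fun t _ => ?_
  simp only [sum_halfBox, layerField_site, ← Finset.mul_sum, Finset.sum_div, mul_div_assoc]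

lemma layerField_mul {d : ℕ} (f : ℕ → ℝ) (t : ℝ) :
    layerField d (fun ℓ => t * f ℓ) = fun i => (0 : HalfSpace d → ℝ) i + t * layerField d f i := by
  funext i
  simp [layerField]

lemma layerField_zero_mul {d : ℕ} (f : ℕ → ℝ) :
    layerField d (fun ℓ => 0 * f ℓ) = 0 := by
  funext i
  simp [layerField]

lemma continuous_gibbsAvg_layerField {d : ℕ} (J : ℝ) (f : ℕ → ℝ) (Λ : Finset (HalfSpace d))
    (η : Config (HalfSpace d)) (F : Config (HalfSpace d) → ℝ) :
    Continuous fun t : ℝ =>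
      gibbsAvg (edgeEnergy (halfGraph d) (fun _ => J) (layerField d fun ℓ => t * f ℓ) Λ) Λ η F := by
  simp only [layerField_mul]
  exact continuous_gibbsAvg_field _ _ _ _ _ _ _

lemma log_partitionFn_layerField (d : ℕ) (J : ℝ) (f : ℕ → ℝ) (Λ : Finset (HalfSpace d))
    (η : Config (HalfSpace d)) (lam : ℝ) :
    Real.log (partitionFn (edgeEnergy (halfGraph d) (fun _ => J)
        (layerField d fun ℓ => lam * f ℓ) Λ) Λ η) -
      Real.log (partitionFn (edgeEnergy (halfGraph d) (fun _ => J) 0 Λ) Λ η) =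
      ∫ t in (0 : ℝ)..lam, ∑ i ∈ Λ, layerField d f i *
        gibbsAvg (edgeEnergy (halfGraph d) (fun _ => J) (layerField d fun ℓ => t * f ℓ) Λ) Λ η
          (fun σ => spin (σ i)) := by
  rw [← layerField_zero_mul f]
  simp only [layerField_mul]
  exact log_partitionFn_field_sub _ _ _ _ _ _ _ _

lemma tendsto_log_partitionFn_plus {d : ℕ} {J : ℝ} (hJ : 0 ≤ J) {f : ℕ → ℝ} (hf : Summable f)
    (f0 : ∀ ℓ, 0 ≤ f ℓ) {K : ℕ → ℕ} (hK : Tendsto K atTop atTop) (lam : ℝ) :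
    Tendsto (fun n => (Real.log (partitionFn (edgeEnergy (halfGraph d) (fun _ => J)
        (layerField d fun ℓ => lam * f ℓ) (halfBox d n (K n))) (halfBox d n (K n))
        (plusConfig _)) -
      Real.log (partitionFn (edgeEnergy (halfGraph d) (fun _ => J) 0 (halfBox d n (K n)))
        (halfBox d n (K n)) (plusConfig _))) / (cube (d - 1) n).card) atTop
      (𝓝 (∫ t in (0 : ℝ)..lam, ∑' ℓ, f ℓ * plusLim (halfGraph d) (fun _ => J)
        (layerField d fun ℓ => t * f ℓ) fun σ => spin (σ (site 0 ℓ)))) := by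
  simp only [log_partitionFn_layerField]
  exact tendsto_integral_halfBox (C := 1) hf f0 hK
    (X := fun n t i => gibbsAvg (edgeEnergy (halfGraph d) (fun _ => J)
      (layerField d fun ℓ => t * f ℓ) (halfBox d n (K n))) (halfBox d n (K n)) (plusConfig _)
      fun σ => spin (σ i))
    (fun n i => continuous_gibbsAvg_layerField _ _ _ _ _)
    (fun n t i => abs_gibbsAvg_spin_le _ _ _ _)
    (fun t ℓ => tendsto_avg_plus hJ (fun ℓ => t * f ℓ) ℓ hK) _ _

lemma tendsto_log_partitionFn_minus {d : ℕ} {J : ℝ} (hJ : 0 ≤ J) {f : ℕ → ℝ} (hf : Summable f)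
    (f0 : ∀ ℓ, 0 ≤ f ℓ) {K : ℕ → ℕ} (hK : Tendsto K atTop atTop) (lam : ℝ) :
    Tendsto (fun n => (Real.log (partitionFn (edgeEnergy (halfGraph d) (fun _ => J)
        (layerField d fun ℓ => lam * f ℓ) (halfBox d n (K n))) (halfBox d n (K n))
        (minusConfig _)) -
      Real.log (partitionFn (edgeEnergy (halfGraph d) (fun _ => J) 0 (halfBox d n (K n)))
        (halfBox d n (K n)) (minusConfig _))) / (cube (d - 1) n).card) atTop
      (𝓝 (∫ t in (0 : ℝ)..lam, ∑' ℓ, f ℓ * minusLim (halfGraph d) (fun _ => J)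
        (layerField d fun ℓ => t * f ℓ) fun σ => spin (σ (site 0 ℓ)))) := by
  simp only [log_partitionFn_layerField]
  exact tendsto_integral_halfBox (C := 1) hf f0 hK
    (X := fun n t i => gibbsAvg (edgeEnergy (halfGraph d) (fun _ => J)
      (layerField d fun ℓ => t * f ℓ) (halfBox d n (K n))) (halfBox d n (K n)) (minusConfig _)
      fun σ => spin (σ i))
    (fun n i => continuous_gibbsAvg_layerField _ _ _ _ _)
    (fun n t i => abs_gibbsAvg_spin_le _ _ _ _)
    (fun t ℓ => tendsto_avg_minus hJ (fun ℓ => t * f ℓ) ℓ hK) _ _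

/-- The limit does not involve `K`. Convergence needs no separate zero-field input, since `logRatio`
vanishes there. -/
lemma tendsto_logRatio {d : ℕ} {J : ℝ} (hJ : 0 ≤ J) {f : ℕ → ℝ} (hf : Summable f)
    (f0 : ∀ ℓ, 0 ≤ f ℓ) {K : ℕ → ℕ} (hK : Tendsto K atTop atTop) (lam : ℝ) :
    Tendsto (fun n => logRatio (halfGraph d) (fun _ => J) (layerField d fun ℓ => lam * f ℓ)
        (halfBox d n (K n)) / (cube (d - 1) n).card) atTop
      (𝓝 (∫ t in (0 : ℝ)..lam, ∑' ℓ, f ℓ * gapLim (halfGraph d) (fun _ => J)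
        (layerField d fun ℓ => t * f ℓ) (site 0 ℓ))) := by
  have h1 : ∀ Λ : Finset (HalfSpace d), logRatio (halfGraph d) (fun _ => J)
      (layerField d fun ℓ => lam * f ℓ) Λ = ∫ t in (0 : ℝ)..lam, ∑ i ∈ Λ, layerField d f i *
        magGap (halfGraph d) (fun _ => J) (layerField d fun ℓ => t * f ℓ) Λ i := by
    intro Λ
    simp only [layerField_mul]
    rw [← logRatio_sub]
    have : (fun i => (0 : HalfSpace d → ℝ) i + 0 * layerField d f i) = 0 := by funext; simp
    rw [this, logRatio_zero, sub_zero]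
  simp only [h1]
  exact tendsto_integral_halfBox (C := 2) hf f0 hK
    (X := fun n t i => magGap (halfGraph d) (fun _ => J) (layerField d fun ℓ => t * f ℓ)
      (halfBox d n (K n)) i)
    (fun n i => (continuous_gibbsAvg_layerField _ _ _ _ _).sub
      (continuous_gibbsAvg_layerField _ _ _ _ _))
    (fun n t i => abs_magGap_le _ _ _ _ _) (fun t ℓ => tendsto_avg_gap hJ (fun ℓ => t * f ℓ) ℓ hK) _ _

/-! ### Vanishing of the gap for strong fields -/

/-- Translating `Λ` by `x - y` carries the finite-volume gap at `y` to one at `x`, and every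
finite-volume gap bounds the limit from above. -/
lemma gapLim_site_le {d : ℕ} {J : ℝ} (hJ : 0 ≤ J) (f : ℕ → ℝ) (Λ : Finset (HalfSpace d))
    (x y : Fin (d - 1) → ℤ) (ℓ : ℕ) :
    gapLim (halfGraph d) (fun _ => J) (layerField d f) (site x ℓ) ≤
      magGap (halfGraph d) (fun _ => J) (layerField d f) Λ (site y ℓ) := by
  refine (gapLim_le (halfGraph d) (fun _ => hJ) _ _
    (Λ.map (halfShift d (x - y)).toEmbedding)).trans_eq ?_
  have h1 := gibbsAvg_halfShift J f Λ (x - y) true y ℓ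
  have h2 := gibbsAvg_halfShift J f Λ (x - y) false y ℓ
  rw [add_sub_cancel] at h1 h2
  exact congrArg₂ (· - ·) h1 h2

lemma gapLim_site {d : ℕ} {J : ℝ} (hJ : 0 ≤ J) (f : ℕ → ℝ) (x : Fin (d - 1) → ℤ) (ℓ : ℕ) :
    gapLim (halfGraph d) (fun _ => J) (layerField d f) (site x ℓ) =
      gapLim (halfGraph d) (fun _ => J) (layerField d f) (site 0 ℓ) :=
  le_antisymm
    (ge_of_tendsto' (tendsto_gapLim (halfGraph d) (fun _ => hJ) _ _) fun Λ =>
      gapLim_site_le hJ f Λ x 0 ℓ)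
    (ge_of_tendsto' (tendsto_gapLim (halfGraph d) (fun _ => hJ) _ _) fun Λ =>
      gapLim_site_le hJ f Λ 0 x ℓ)

/-- A wall field `J` together with a positive field on finitely many layers closes the gap on these
layers. -/
lemma gapLim_eq_zero_of_finite_layers {d : ℕ} {J : ℝ} (hJ : 0 ≤ J) {s : ℝ} (hs : 0 < s) (ℓ₀ : ℕ) :
    gapLim (halfGraph d) (fun _ => J)
      (layerField d fun ℓ => wallField J ℓ + if ℓ < ℓ₀ + 1 then s else 0) (site 0 ℓ₀) = 0 := by
  set L := ℓ₀ + 1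
  set g : ℕ → ℝ := fun ℓ => wallField J ℓ + if ℓ < L then s else 0
  set w := layerField d (wallField J)
  set k := layerField d fun ℓ => if ℓ < L then s else 0
  set γ := gapLim (halfGraph d) (fun _ => J) (layerField d g) (site 0 ℓ₀)
  have hg : ∀ ℓ, L ≤ ℓ → g ℓ = 0 := by
    intro ℓ hℓ
    have h1 : ℓ ≠ 0 := by omega
    have h2 : ¬ ℓ < L := by omega
    simp [g, wallField, h1, h2]
  have hgk : layerField d g = fun i => w i + k i := rfl
  set D := ∑ ℓ ∈ Finset.range L, ((halfGraph d).degree (site 0 ℓ) : ℝ)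
  set N : ℕ → ℝ := fun n => ((cube (d - 1) n).card : ℝ)
  set R : ℕ → ℕ → ℝ := fun n m => logRatio (halfGraph d) (fun _ => J) w (halfBox d n m)
  -- On the box of height `n + L`, adding `k` to `w` raises `logRatio` by at least `s * γ` per wall
  -- site, already from the layer `ℓ₀`. Freezing the `L` lowest layers bounds the raised value by `R
  -- n n` plus a lateral term.
  have hbound : ∀ n, 0 < n → s * γ ≤ R n n / N n + 2 * J * D * (1 - N (n - 1) / N n) -
      R n (n + L) / N n := by
    intro n hn
    have hN : 0 < N n := card_cube_pos _ _
    have h1 := sum_magGap_le_logRatio_sub (halfGraph d) (c := fun _ => J) (fun _ => hJ)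
      (h := w) (k := k) (fun i => by simp only [w, layerField, wallField]; split_ifs <;> simp [hJ])
      (fun i => by simp only [k, layerField]; split_ifs <;> simp [hs.le]) (halfBox d n (n + L))
    rw [← hgk] at h1
    have h2 := logRatio_halfBox_le (d := d) hJ (Nat.succ_pos ℓ₀) hg hn hn
    have h3 : s * γ * N n ≤ ∑ i ∈ halfBox d n (n + L),
        k i * magGap (halfGraph d) (fun _ => J) (layerField d g) (halfBox d n (n + L)) i := by
      rw [sum_halfBox]
      have h4 : s * γ * N n ≤ ∑ x ∈ cube (d - 1) n, k (site x ℓ₀) *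
          magGap (halfGraph d) (fun _ => J) (layerField d g) (halfBox d n (n + L))
            (site x ℓ₀) := by
        have h5 := Finset.card_nsmul_le_sum (cube (d - 1) n) (fun x => k (site x ℓ₀) *
          magGap (halfGraph d) (fun _ => J) (layerField d g) (halfBox d n (n + L))
            (site x ℓ₀)) (s * γ) fun x _ => by
              simp only [k, layerField_site]
              rw [if_pos (Nat.lt_succ_self ℓ₀)]
              exact mul_le_mul_of_nonneg_left (gapLim_site_le hJ g _ 0 x ℓ₀) hs.le
        rwa [nsmul_eq_mul, mul_comm] at h5
      refine h4.trans (Finset.single_le_sum (f := fun ℓ => ∑ x ∈ cube (d - 1) n, k (site x ℓ) *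
          magGap (halfGraph d) (fun _ => J) (layerField d g) (halfBox d n (n + L)) (site x ℓ))
          (fun ℓ _ => Finset.sum_nonneg fun x _ => mul_nonneg ?_
            (magGap_nonneg _ (fun _ => hJ) _ _ _)) (Finset.mem_range.2 (by omega)))
      simp only [k, layerField_site]
      split_ifs <;> simp [hs.le]
    have h6 : s * γ * N n ≤ (R n n / N n + 2 * J * D * (1 - N (n - 1) / N n) -
        R n (n + L) / N n) * N n := by
      have : (R n n / N n + 2 * J * D * (1 - N (n - 1) / N n) - R n (n + L) / N n) * N n =
          R n n + 2 * J * D * (N n - N (n - 1)) - R n (n + L) := by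
        field_simp
      rw [this]
      exact h3.trans (h1.trans (sub_le_sub_right h2 _))
    exact le_of_mul_le_mul_right h6 hN
  have hw : layerField d (fun ℓ => J * wallField 1 ℓ) = w := by
    funext i
    simp [w, layerField, wallField]
  have hsum : Summable (wallField 1) :=
    summable_of_ne_finset_zero (s := {0}) fun ℓ hℓ => by
      simp only [Finset.mem_singleton] at hℓ
      simp [wallField, hℓ]
  have hpos : ∀ ℓ, 0 ≤ wallField 1 ℓ := fun ℓ => by
    simp only [wallField]; split_ifs <;> norm_num
  have l1 := tendsto_logRatio (d := d) hJ hsum hpos (K := fun n => n) tendsto_id J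
  -- The heights `n` and `n + L` have the same limit, so the two `logRatio` terms cancel and only `s
  -- * γ ≤ 0` remains.
  have l2 := tendsto_logRatio (d := d) hJ hsum hpos (K := fun n => n + L)
    (tendsto_add_atTop_nat L) J
  rw [hw] at l1 l2
  have l3 := (tendsto_card_cube_ratio (d - 1) 1).const_sub 1
  have l4 := (l1.add (l3.const_mul (2 * J * D))).sub l2
  rw [sub_self, mul_zero, add_zero, sub_self] at l4
  have h7 : s * γ ≤ 0 := by
    refine ge_of_tendsto l4 ?_
    filter_upwards [eventually_gt_atTop 0] with n hn using hbound n hn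
  have h8 : 0 ≤ γ := gapLim_nonneg _ (fun _ => hJ) _ _
  nlinarith

/-- A strict excess over `J` on the first layer, and positivity on finitely many others, let the
field dominate one covered by `gapLim_eq_zero_of_finite_layers`. The gap decreases with the field.
-/
theorem gapLim_decayField_eq_zero {d : ℕ} {J : ℝ} (hJ : 0 < J) (δ : ℝ) {lam : ℝ} (hlam : J < lam)
    (i : HalfSpace d) : gapLim (halfGraph d) (fun _ => J) (decayField d δ lam) i = 0 := by
  obtain ⟨x, ℓ₀, rfl⟩ := exists_eq_site i
  rw [decayField_eq_layerField, gapLim_site hJ.le]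
  have hlam0 : 0 < lam := hJ.trans hlam
  set f : ℕ → ℝ := fun ℓ => lam * (1 / ((ℓ : ℝ) + 1) ^ δ)
  have hf : ∀ ℓ, 0 < f ℓ := fun ℓ => by positivity
  have hf0 : f 0 = lam := by simp [f]
  obtain ⟨s, hs, hs1, hs2⟩ : ∃ s, 0 < s ∧ s ≤ lam - J ∧ ∀ ℓ ∈ Finset.range (ℓ₀ + 1), s ≤ f ℓ := by
    obtain ⟨m, hm, hmin⟩ := Finset.exists_min_image (Finset.range (ℓ₀ + 1)) f ⟨0, by simp⟩
    exact ⟨min (lam - J) (f m), lt_min (sub_pos.2 hlam) (hf m), min_le_left _ _,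
      fun ℓ hℓ => (min_le_right _ _).trans (hmin ℓ hℓ)⟩
  refine le_antisymm ?_ (gapLim_nonneg _ (fun _ => hJ.le) _ _)
  rw [← gapLim_eq_zero_of_finite_layers (d := d) hJ.le hs ℓ₀]
  refine gapLim_antitone _ (fun _ => hJ.le) (fun j => ?_) (fun j => ?_) _
  · simp only [layerField, wallField]
    have := hs.le
    have := hJ.le
    split_ifs <;> linarith
  · simp only [layerField, wallField]
    generalize (j.1.2 - 1).toNat = ℓ
    have h1 := (hf ℓ).le
    split_ifs with h2 h3 h3
    · subst h2; linarith
    · omega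
    · simpa using hs2 ℓ (Finset.mem_range.2 h3)
    · simpa using h1

end

end FreeEnergy

/-! ### The full lattice with a weakened midplane -/

section Factorisation

open scoped Classical

noncomputable section

variable {V V' : Type}

lemma partitionFn_eq_sq (ψ₁ ψ₂ : V ↪ V') (Λ : Finset V) (Λ' : Finset V')
    (hdisj : ∀ i j, ψ₁ i ≠ ψ₂ j) (h₁ : ∀ i, ψ₁ i ∈ Λ' ↔ i ∈ Λ) (h₂ : ∀ i, ψ₂ i ∈ Λ' ↔ i ∈ Λ)
    (hcover : ∀ w, w ∈ Set.range ψ₁ ∨ w ∈ Set.range ψ₂) (b : Bool) {E : Config V → ℝ}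
    {E' : Config V' → ℝ}
    (hE : ∀ σ', E' σ' = E (fun i => σ' (ψ₁ i)) + E (fun i => σ' (ψ₂ i))) :
    partitionFn E' Λ' (fun _ => b) = partitionFn E Λ (fun _ => b) ^ 2 := by
  let φ : Λ ⊕ Λ ≃ Λ' := Equiv.ofBijective
    (Sum.elim (fun i => ⟨ψ₁ i, (h₁ i).2 i.2⟩) (fun i => ⟨ψ₂ i, (h₂ i).2 i.2⟩))
    ⟨by
      rintro (i | i) (j | j) h
      · exact congrArg Sum.inl (Subtype.ext (ψ₁.injective (congrArg Subtype.val h)))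
      · exact absurd (congrArg Subtype.val h) (hdisj i j)
      · exact absurd (congrArg Subtype.val h).symm (hdisj j i)
      · exact congrArg Sum.inr (Subtype.ext (ψ₂.injective (congrArg Subtype.val h))),
    by
      rintro ⟨w, hw⟩
      rcases hcover w with ⟨i, rfl⟩ | ⟨i, rfl⟩
      · exact ⟨Sum.inl ⟨i, (h₁ i).1 hw⟩, rfl⟩
      · exact ⟨Sum.inr ⟨i, (h₂ i).1 hw⟩, rfl⟩⟩
  rw [partitionFn, partitionFn, sq, Finset.sum_mul_sum, ← Fintype.sum_prod_type']
  refine Fintype.sum_equiv ((φ.symm.arrowCongr (Equiv.refl Bool)).trans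
    (Equiv.sumArrowEquivProdArrow Λ Λ Bool)) _ _ fun τ => ?_
  rw [hE, neg_add, Real.exp_add]
  congr 4
  · funext i
    by_cases hi : i ∈ Λ
    · rw [glue_of_mem hi, glue_of_mem ((h₁ i).2 hi)]
      rfl
    · rw [glue_of_notMem hi, glue_of_notMem fun h => hi ((h₁ i).1 h)]
  · funext i
    by_cases hi : i ∈ Λ
    · rw [glue_of_mem hi, glue_of_mem ((h₂ i).2 hi)]
      rfl
    · rw [glue_of_notMem hi, glue_of_notMem fun h => hi ((h₂ i).1 h)]

/-- Edges joining `A` to `B` are counted in both energies on the right, but they carry no coupling.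
-/
lemma edgeEnergy_union (G : SimpleGraph V) [G.LocallyFinite] (c : Sym2 V → ℝ) (h : V → ℝ)
    {Λ A B : Finset V} (hΛ : ∀ i, i ∈ Λ ↔ i ∈ A ∨ i ∈ B) (hdisj : ∀ i ∈ A, i ∉ B)
    (hc : ∀ i ∈ A, ∀ j ∈ B, c s(i, j) = 0) (σ : Config V) :
    edgeEnergy G c h Λ σ = edgeEnergy G c h A σ + edgeEnergy G c h B σ := by
  obtain rfl : Λ = A ∪ B := by ext i; rw [hΛ, Finset.mem_union]
  have h1 : edgesMeeting G (A ∪ B) = edgesMeeting G A ∪ edgesMeeting G B := by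
    ext e
    simp only [Finset.mem_union, mem_edgesMeeting, or_and_right, exists_or, and_or_left]
  have h2 := Finset.sum_union_inter (s₁ := edgesMeeting G A) (s₂ := edgesMeeting G B)
    (f := fun e => c e * bondProduct σ e)
  have h3 : ∑ e ∈ edgesMeeting G A ∩ edgesMeeting G B, c e * bondProduct σ e = 0 := by
    refine Finset.sum_eq_zero fun e he => ?_
    rw [Finset.mem_inter, mem_edgesMeeting, mem_edgesMeeting] at he
    obtain ⟨⟨-, i, hi, hie⟩, -, j, hj, hje⟩ := he
    have hij : i ≠ j := fun hij => hdisj i hi (hij ▸ hj)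
    rw [(Sym2.mem_and_mem_iff hij).1 ⟨hie, hje⟩, hc i hi j hj, zero_mul]
  have h4 := Finset.sum_union (f := fun i => h i * spin (σ i)) (Finset.disjoint_left.2 hdisj)
  simp only [edgeEnergy, h1]
  linarith

end

end Factorisation

/-! ### Interpolation of the coupling across the midplane. -/

section Midplane

open scoped Classical

noncomputable section

/-- The indicator function of the edges crossing the midplane between heights `0` and `1`. -/
def crossing (d : ℕ) : Sym2 (Lattice d) → ℝ :=
  Sym2.lift ⟨fun i j => if (1 ≤ i.2 ↔ 1 ≤ j.2) then 0 else 1, fun i j => by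
    simp only [Iff.comm]⟩

lemma crossing_mk {d : ℕ} (i j : Lattice d) :
    crossing d s(i, j) = if (1 ≤ i.2 ↔ 1 ≤ j.2) then 0 else 1 := rfl

lemma crossing_mem {d : ℕ} (e : Sym2 (Lattice d)) : 0 ≤ crossing d e ∧ crossing d e ≤ 1 := by
  induction e with | _ i j => rw [crossing_mk]; split_ifs <;> norm_num

/-- The coupling `J`, multiplied by `t` on the edges crossing the midplane. -/
def midCoupling (d : ℕ) (J t : ℝ) (e : Sym2 (Lattice d)) : ℝ :=
  J * (1 - crossing d e) + t * (J * crossing d e)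

lemma midCoupling_nonneg {d : ℕ} {J t : ℝ} (hJ : 0 ≤ J) (ht : 0 ≤ t) (e : Sym2 (Lattice d)) :
    0 ≤ midCoupling d J t e := by
  obtain ⟨h1, h2⟩ := crossing_mem e
  exact add_nonneg (mul_nonneg hJ (sub_nonneg.2 h2)) (mul_nonneg ht (mul_nonneg hJ h1))

lemma midCoupling_one (d : ℕ) (J : ℝ) : midCoupling d J 1 = fun _ => J := by
  funext e
  simp only [midCoupling]
  ring

lemma midCoupling_map {d : ℕ} (J t : ℝ) (v : Fin (d - 1) → ℤ) (e : Sym2 (Lattice d)) :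
    midCoupling d J t (e.map (latticeShift d v)) = midCoupling d J t e := by
  induction e with | _ i j => rfl

/-- The reflection of the half-space through the midplane. -/
def reflectDown (d : ℕ) : HalfSpace d ↪ Lattice d where
  toFun i := (i.1.1, 1 - i.1.2)
  inj' i j h := by
    simp only [Prod.mk.injEq, sub_right_inj] at h
    exact Subtype.ext (Prod.ext h.1 h.2)

lemma reflectDown_apply {d : ℕ} (i : HalfSpace d) : reflectDown d i = (i.1.1, 1 - i.1.2) := rfl

/-- The inclusion of the half-space. -/
def inclusion (d : ℕ) : HalfSpace d ↪ Lattice d := Function.Embedding.subtype _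

lemma inclusion_apply {d : ℕ} (i : HalfSpace d) : inclusion d i = i.1 := rfl

lemma mem_range_inclusion {d : ℕ} {w : Lattice d} : w ∈ Set.range (inclusion d) ↔ 1 ≤ w.2 :=
  ⟨by rintro ⟨i, rfl⟩; exact i.2, fun h => ⟨⟨w, h⟩, rfl⟩⟩

lemma mem_range_reflectDown {d : ℕ} {w : Lattice d} :
    w ∈ Set.range (reflectDown d) ↔ w.2 ≤ 0 := by
  constructor
  · rintro ⟨i, rfl⟩
    have := i.2
    rw [reflectDown_apply]
    simp only
    omega
  · intro h
    refine ⟨⟨(w.1, 1 - w.2), by simp only; omega⟩, ?_⟩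
    rw [reflectDown_apply]
    simp

lemma inclusion_mem_doubleBox {d n : ℕ} (i : HalfSpace d) :
    inclusion d i ∈ doubleBox d n ↔ i ∈ box d n := by
  have := i.2
  rw [mem_doubleBox, box_eq_halfBox, mem_halfBox, inclusion_apply]
  refine and_congr_right fun _ => ?_
  omega

lemma reflectDown_mem_doubleBox {d n : ℕ} (i : HalfSpace d) :
    reflectDown d i ∈ doubleBox d n ↔ i ∈ box d n := by
  have := i.2
  rw [mem_doubleBox, box_eq_halfBox, mem_halfBox, reflectDown_apply]
  refine and_congr_right fun _ => ?_
  simp only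
  omega

/-- The only edges leaving the half-space are the vertical ones below the first layer, and at `t =
0` they have coupling `0`. -/
lemma edgeEnergy_inclusion {d : ℕ} (J : ℝ) (Λ : Finset (HalfSpace d)) (σ : Config (Lattice d)) :
    edgeEnergy (latticeGraph d) (midCoupling d J 0) 0 (Λ.map (inclusion d)) σ =
      edgeEnergy (halfGraph d) (fun _ => J) 0 Λ fun i => σ (inclusion d i) := by
  rw [edgeEnergy_map (halfGraph d) (latticeGraph d) (inclusion d) (fun i j => Iff.rfl) Λ
    (fun i => i.1.2 = 1) (fun i => (i.1.1, 0))]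
  · have h1 : (fun e : Sym2 (HalfSpace d) => midCoupling d J 0 (e.map (inclusion d))) =
        fun _ => J := by
      funext e
      induction e with
      | _ i j =>
        have hi := i.2
        have hj := j.2
        simp [midCoupling, crossing_mk, inclusion_apply, hi, hj]
    rw [h1, Finset.sum_eq_zero, sub_zero]
    · rfl
    · intro i _
      have hi := i.2
      simp [midCoupling, crossing_mk, inclusion_apply, hi]
  · intro i _ w hw hwr
    rw [mem_range_inclusion] at hwr
    have hi := i.2
    rw [inclusion_apply] at hw
    obtain ⟨h1, h2⟩ := eq_of_latticeGraph_adj hw (by omega)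
    exact ⟨by omega, Prod.ext h1 (by simp only; omega)⟩
  · intro i _ hi
    refine ⟨?_, by rw [mem_range_inclusion]; simp⟩
    have := latticeGraph_adj_vertical (d := d) i.1.1 0
    rw [inclusion_apply]
    convert! this using 1
    exact Prod.ext rfl (by simp [hi])

lemma edgeEnergy_reflectDown {d : ℕ} (J : ℝ) (Λ : Finset (HalfSpace d))
    (σ : Config (Lattice d)) :
    edgeEnergy (latticeGraph d) (midCoupling d J 0) 0 (Λ.map (reflectDown d)) σ =
      edgeEnergy (halfGraph d) (fun _ => J) 0 Λ fun i => σ (reflectDown d i) := by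
  rw [edgeEnergy_map (halfGraph d) (latticeGraph d) (reflectDown d) (fun i j => ?_) Λ
    (fun i => i.1.2 = 1) (fun i => (i.1.1, 1))]
  · have h1 : (fun e : Sym2 (HalfSpace d) => midCoupling d J 0 (e.map (reflectDown d))) =
        fun _ => J := by
      funext e
      induction e with
      | _ i j =>
        have hi : ¬ i.1.2 ≤ 0 := by have := i.2; omega
        have hj : ¬ j.1.2 ≤ 0 := by have := j.2; omega
        simp [midCoupling, crossing_mk, reflectDown_apply, hi, hj]
    rw [h1, Finset.sum_eq_zero, sub_zero]
    · rfl
    · intro i _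
      have hi : ¬ i.1.2 ≤ 0 := by have := i.2; omega
      simp [midCoupling, crossing_mk, reflectDown_apply, hi]
  · intro i _ w hw hwr
    rw [mem_range_reflectDown] at hwr
    have hi := i.2
    rw [reflectDown_apply] at hw
    obtain ⟨h1, h2⟩ := eq_of_latticeGraph_adj hw.symm (by simp only; omega)
    simp only at h1 h2
    exact ⟨by omega, Prod.ext h1.symm (by simp only; omega)⟩
  · intro i _ hi
    refine ⟨?_, by rw [mem_range_reflectDown]; simp⟩
    have := latticeGraph_adj_vertical (d := d) i.1.1 0
    rw [reflectDown_apply, hi]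
    exact this.symm
  · simp only [halfGraph_adj, latticeGraph_adj, reflectDown_apply, sub_sub_sub_cancel_left]
    rw [abs_sub_comm j.1.2]

/-- Without coupling across the midplane the partition function factorises. -/
lemma partitionFn_midCoupling_zero (d n : ℕ) (J : ℝ) :
    partitionFn (edgeEnergy (latticeGraph d) (midCoupling d J 0) 0 (doubleBox d n))
        (doubleBox d n) (plusConfig _) =
      partitionFn (edgeEnergy (halfGraph d) (fun _ => J) 0 (box d n)) (box d n)
        (plusConfig _) ^ 2 := by
  refine partitionFn_eq_sq (inclusion d) (reflectDown d) (box d n) (doubleBox d n) ?_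
    inclusion_mem_doubleBox reflectDown_mem_doubleBox ?_ true ?_
  · intro i j h
    have h1 := mem_range_inclusion.1 ⟨i, rfl⟩
    have h2 := mem_range_reflectDown.1 ⟨j, rfl⟩
    rw [h] at h1
    omega
  · intro w
    rw [mem_range_inclusion, mem_range_reflectDown]
    omega
  · intro σ
    rw [← edgeEnergy_inclusion, ← edgeEnergy_reflectDown]
    have hA : ∀ i, i ∈ (box d n).map (inclusion d) → 1 ≤ i.2 := fun i hi => by
      obtain ⟨j, -, rfl⟩ := Finset.mem_map.1 hi
      exact j.2
    have hB : ∀ i, i ∈ (box d n).map (reflectDown d) → i.2 ≤ 0 := fun i hi => by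
      obtain ⟨j, -, rfl⟩ := Finset.mem_map.1 hi
      exact mem_range_reflectDown.1 ⟨j, rfl⟩
    refine edgeEnergy_union _ _ _ (fun i => ?_) (fun i hi hi' => ?_) (fun i hi j hj => ?_) σ
    · constructor
      · intro hi
        by_cases h : 1 ≤ i.2
        · refine Or.inl (Finset.mem_map.2 ⟨⟨i, h⟩, ?_, rfl⟩)
          rw [← inclusion_mem_doubleBox]
          exact hi
        · obtain ⟨j, rfl⟩ := mem_range_reflectDown.2 (by omega : i.2 ≤ 0)
          exact Or.inr (Finset.mem_map_of_mem _ (reflectDown_mem_doubleBox j |>.1 hi))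
      · rintro (hi | hi)
        · obtain ⟨j, hj, rfl⟩ := Finset.mem_map.1 hi
          exact (inclusion_mem_doubleBox j).2 hj
        · obtain ⟨j, hj, rfl⟩ := Finset.mem_map.1 hi
          exact (reflectDown_mem_doubleBox j).2 hj
    · have := hA i hi
      have := hB i hi'
      omega
    · have h1 := hA i hi
      have h2 := hB j hj
      have h3 : ¬ (1 ≤ j.2) := by omega
      simp [midCoupling, crossing_mk, h1, h3]

/-- A crossing edge is vertical between heights `0` and `1`. The case `n = 0` is excluded because
`doubleBox d 0` is empty while the cube is not. -/
lemma sum_crossing (d : ℕ) {n : ℕ} (hn : 0 < n) (F : Sym2 (Lattice d) → ℝ) :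
    ∑ e ∈ edgesMeeting (latticeGraph d) (doubleBox d n), crossing d e * F e =
      ∑ x ∈ cube (d - 1) n, F s((x, 1), (x, 0)) := by
  have hadj : ∀ x : Fin (d - 1) → ℤ, (latticeGraph d).Adj (x, 1) (x, 0) := fun x => by
    simpa using latticeGraph_adj_vertical (d := d) x 0
  symm
  have hinj : Set.InjOn (fun x : Fin (d - 1) → ℤ => s(((x, 1) : Lattice d), (x, 0)))
      (cube (d - 1) n) := by
    intro x _ y _ h
    rcases Sym2.eq_iff.1 h with h | h
    · exact (Prod.ext_iff.1 h.1).1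
    · exact (Prod.ext_iff.1 h.1).1
  rw [← Finset.sum_image (f := F) hinj]
  have h1 : ∀ e ∈ (cube (d - 1) n).image fun x => s(((x, 1) : Lattice d), (x, 0)),
      F e = crossing d e * F e := by
    intro e he
    obtain ⟨x, -, rfl⟩ := Finset.mem_image.1 he
    simp [crossing_mk]
  rw [Finset.sum_congr rfl h1]
  refine Finset.sum_subset ?_ ?_
  · intro e he
    obtain ⟨x, hx, rfl⟩ := Finset.mem_image.1 he
    rw [mem_edgesMeeting]
    exact ⟨hadj x, (x, 1), mem_doubleBox.2 ⟨mem_cube.1 hx, by omega, by omega⟩, by simp⟩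
  · have key : ∀ i j : Lattice d, (latticeGraph d).Adj i j → (i ∈ doubleBox d n ∨ j ∈ doubleBox d n) →
        1 ≤ i.2 → ¬ 1 ≤ j.2 →
        s(i, j) ∈ (cube (d - 1) n).image fun x => s(((x, 1) : Lattice d), (x, 0)) := by
      intro i j hij hm hi hj
      obtain ⟨h2, h3⟩ := eq_of_latticeGraph_adj hij (by omega)
      have h4 : i = (i.1, 1) := Prod.ext rfl (by simp only; omega)
      have h5 : j = (i.1, 0) := Prod.ext h2 (by simp only; omega)
      refine Finset.mem_image.2 ⟨i.1, mem_cube.2 ?_, by rw [← h4, ← h5]⟩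
      rcases hm with hm | hm
      · exact (mem_doubleBox.1 hm).1
      · rw [← h2]
        exact (mem_doubleBox.1 hm).1
    intro e he hne
    induction e with
    | _ i j =>
      rw [mem_edgesMeeting] at he
      obtain ⟨hij, v, hv, hve⟩ := he
      have hm : i ∈ doubleBox d n ∨ j ∈ doubleBox d n := by
        rcases Sym2.mem_iff.1 hve with rfl | rfl
        exacts [Or.inl hv, Or.inr hv]
      rw [crossing_mk]
      split_ifs with hc
      · rw [zero_mul]
      · exfalso
        by_cases hi : 1 ≤ i.2
        · exact hne (key i j hij hm hi fun hj => hc (iff_of_true hi hj))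
        · have hj : 1 ≤ j.2 := by
            by_contra hj
            exact hc (iff_of_false hi hj)
          rw [Sym2.eq_swap] at hne
          exact hne (key j i hij.symm hm.symm hj hi)

/-- Spatial averages in the full lattice of the translates of an increasing function. -/
lemma tendsto_avg_lattice {d : ℕ} {c : Sym2 (Lattice d) → ℝ} (hc : ∀ e, 0 ≤ c e)
    (hcs : ∀ (v : Fin (d - 1) → ℤ) e, c (e.map (latticeShift d v)) = c e)
    {f : Config (Lattice d) → ℝ} (hf : Monotone f) {C : ℝ} (hC : ∀ σ, |f σ| ≤ C) :
    Tendsto (fun n => (∑ x ∈ cube (d - 1) n, gibbsAvg (edgeEnergy (latticeGraph d) c 0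
        (doubleBox d n)) (doubleBox d n) (plusConfig _)
        (fun σ => f fun i => σ (latticeShift d x i))) / (cube (d - 1) n).card) atTop
      (𝓝 (plusLim (latticeGraph d) c 0 fun σ => f fun i => σ (latticeShift d 0 i))) := by
  have hmono : ∀ x, Monotone fun σ : Config (Lattice d) => f fun i => σ (latticeShift d x i) :=
    fun x σ σ' h => hf fun i => h _
  refine tendsto_cube_avg_of_antitone (latticeShift d)
    (φ := fun Λ x => gibbsAvg (edgeEnergy (latticeGraph d) c 0 Λ) Λ (plusConfig _)
      (fun σ => f fun i => σ (latticeShift d x i))) (C := C)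
    (fun Λ x => abs_gibbsAvg_le _ _ _ fun σ => hC _)
    (fun hΛ x => gibbsAvg_plus_antitone _ hc _ hΛ (hmono x))
    (fun Λ v x => ?_)
    (tendsto_plusLim _ hc _ (hmono 0))
    exists_latticeShift_subset
  have h1 := gibbsAvg_equiv (latticeGraph d) (latticeGraph d) (latticeShift d v)
    (latticeShift_adj d v) Λ c 0 (plusConfig _) (fun σ => f fun i => σ (latticeShift d x i))
  simp only [hcs] at h1
  refine Eq.trans ?_ h1
  congr 1
  funext σ
  congr 1
  funext i
  simp only [latticeShift_apply, add_assoc]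

/-- A bond product is not monotone, but it equals `(1 + σ_p) (1 + σ_q) - σ_p - σ_q - 1`, a
combination of increasing functions to which `tendsto_avg_lattice` applies. -/
lemma exists_tendsto_avg_bond {d : ℕ} {c : Sym2 (Lattice d) → ℝ} (hc : ∀ e, 0 ≤ c e)
    (hcs : ∀ (v : Fin (d - 1) → ℤ) e, c (e.map (latticeShift d v)) = c e) :
    ∃ M, Tendsto (fun n => (∑ x ∈ cube (d - 1) n, gibbsAvg (edgeEnergy (latticeGraph d) c 0
        (doubleBox d n)) (doubleBox d n) (plusConfig _)
        (fun σ => bondProduct σ s((x, 1), (x, 0)))) / (cube (d - 1) n).card) atTop (𝓝 M) := by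
  have habs : ∀ b : Bool, 0 ≤ 1 + spin b := fun b => by cases b <;> norm_num [spin]
  have habs' : ∀ b : Bool, 1 + spin b ≤ 2 := fun b => by cases b <;> norm_num [spin]
  let p : Lattice d := (0, 1)
  let q : Lattice d := (0, 0)
  have hf : Monotone fun σ : Config (Lattice d) => (1 + spin (σ p)) * (1 + spin (σ q)) := by
    intro σ σ' h
    refine mul_le_mul (add_le_add le_rfl (spin_mono (h p))) (add_le_add le_rfl (spin_mono (h q)))
      (habs _) (habs _)
  have l1 := tendsto_avg_lattice hc hcs hf (C := 4) fun σ => by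
    rw [abs_of_nonneg (mul_nonneg (habs _) (habs _))]
    have := mul_le_mul (habs' (σ p)) (habs' (σ q)) (habs _) (by norm_num)
    linarith
  have l2 := tendsto_avg_lattice hc hcs (monotone_spin_apply p) (C := 1) fun σ => (abs_spin _).le
  have l3 := tendsto_avg_lattice hc hcs (monotone_spin_apply q) (C := 1) fun σ => (abs_spin _).le
  refine ⟨_, (((l1.sub l2).sub l3).sub_const 1).congr fun n => ?_⟩
  have hN := card_cube_pos (d - 1) n
  have h2 : ∀ a b e N : ℝ, N ≠ 0 → a / N - b / N - e / N - 1 = (a - b - e - N) / N :=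
    fun a b e N h => by field_simp
  rw [h2 _ _ _ _ hN.ne']
  congr 1
  have h3 : ((cube (d - 1) n).card : ℝ) = ∑ x ∈ cube (d - 1) n, gibbsAvg (edgeEnergy
      (latticeGraph d) c 0 (doubleBox d n)) (doubleBox d n) (plusConfig _) fun _ => (1 : ℝ) := by
    simp [gibbsAvg_const]
  rw [h3, ← Finset.sum_sub_distrib, ← Finset.sum_sub_distrib, ← Finset.sum_sub_distrib]
  refine Finset.sum_congr rfl fun x _ => ?_
  rw [← gibbsAvg_sub, ← gibbsAvg_sub, ← gibbsAvg_sub]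
  congr 1
  funext σ
  simp only [p, q, latticeShift_apply, zero_add, bondProduct_mk]
  ring

/-- Existence of the surface free energy at zero field. -/
lemma exists_tendsto_zero_field (d : ℕ) {J : ℝ} (hJ : 0 ≤ J) :
    ∃ S, Tendsto (fun n => (Real.log (partitionFn (edgeEnergy (latticeGraph d) (fun _ => J) 0
        (doubleBox d n)) (doubleBox d n) (plusConfig _)) -
      2 * Real.log (partitionFn (edgeEnergy (halfGraph d) (fun _ => J) 0 (box d n)) (box d n)
        (plusConfig _))) / (cube (d - 1) n).card) atTop (𝓝 S) := by
  -- The couplings are ferromagnetic only for `t ≥ 0`. The value chosen for negative `t` plays no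
  -- role, since the integral runs over `[0, 1]`.
  have hlim : ∀ t : ℝ, ∃ M, 0 ≤ t → Tendsto (fun n => (∑ x ∈ cube (d - 1) n,
      gibbsAvg (edgeEnergy (latticeGraph d) (midCoupling d J t) 0
        (doubleBox d n)) (doubleBox d n) (plusConfig _)
        (fun σ => bondProduct σ s((x, 1), (x, 0)))) / (cube (d - 1) n).card) atTop (𝓝 M) := by
    intro t
    by_cases ht : 0 ≤ t
    · obtain ⟨M, hM⟩ := exists_tendsto_avg_bond (midCoupling_nonneg hJ ht)
        (midCoupling_map (d := d) J t)
      exact ⟨M, fun _ => hM⟩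
    · exact ⟨0, fun h => absurd h ht⟩
  choose M hM using hlim
  let A : ℕ → ℝ → ℝ := fun n t => (∑ x ∈ cube (d - 1) n,
      gibbsAvg (edgeEnergy (latticeGraph d) (midCoupling d J t) 0
        (doubleBox d n)) (doubleBox d n) (plusConfig _)
        (fun σ => bondProduct σ s((x, 1), (x, 0)))) / (cube (d - 1) n).card
  have hmid : ∀ n t, edgeEnergy (latticeGraph d) (midCoupling d J t) 0 (doubleBox d n) =
      fun σ => edgeEnergy (latticeGraph d) (fun e => J * (1 - crossing d e)) 0 (doubleBox d n) σ -
        t * ∑ e ∈ edgesMeeting (latticeGraph d) (doubleBox d n),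
          (J * crossing d e) * bondProduct σ e :=
    fun n t => edgeEnergy_add_coupling _ _ _ _ _ _
  refine ⟨∫ t in (0 : ℝ)..1, J * M t, Tendsto.congr' (f₁ := fun n => ∫ t in (0 : ℝ)..1, J * A n t)
    ?_ ?_⟩
  · filter_upwards [eventually_gt_atTop 0] with n hn
    have h1 := log_partitionFn_sub
      (edgeEnergy (latticeGraph d) (fun e => J * (1 - crossing d e)) 0 (doubleBox d n))
      (fun σ => ∑ e ∈ edgesMeeting (latticeGraph d) (doubleBox d n),
        (J * crossing d e) * bondProduct σ e) (doubleBox d n) (plusConfig _) 0 1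
    simp only [← hmid] at h1
    -- The endpoints of the interpolation: the homogeneous lattice at `t = 1`, two independent
    -- half-spaces at `t = 0`.
    rw [midCoupling_one, partitionFn_midCoupling_zero, Real.log_pow] at h1
    push_cast at h1
    rw [h1, ← intervalIntegral.integral_div]
    refine intervalIntegral.integral_congr fun t _ => ?_
    have h2 : (fun σ : Config (Lattice d) => ∑ e ∈ edgesMeeting (latticeGraph d) (doubleBox d n),
        (J * crossing d e) * bondProduct σ e) =
        fun σ => J * ∑ x ∈ cube (d - 1) n, bondProduct σ s((x, 1), (x, 0)) := by
      funext σ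
      rw [← sum_crossing d hn, Finset.mul_sum]
      exact Finset.sum_congr rfl fun e _ => by ring
    simp only [A, h2, gibbsAvg_mul_left, gibbsAvg_sum, mul_div_assoc]
  · refine intervalIntegral.tendsto_integral_filter_of_dominated_convergence (fun _ => J) ?_ ?_ ?_ ?_
    · refine Eventually.of_forall fun n => Continuous.aestronglyMeasurable ?_
      refine continuous_const.mul ((continuous_finsetSum _ fun x _ => ?_).div_const _)
      simp only [hmid]
      exact continuous_gibbsAvg _ _ _ _ _
    · refine Eventually.of_forall fun n => Eventually.of_forall fun t _ => ?_
      have hp := card_cube_pos (d - 1) n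
      have h3 : |A n t| ≤ 1 := by
        rw [abs_div, abs_of_pos hp, div_le_iff₀ hp]
        refine (Finset.abs_sum_le_sum_abs _ _).trans ((Finset.sum_le_card_nsmul _ _ 1
          fun x _ => abs_gibbsAvg_le _ _ _ fun σ => (abs_bondProduct σ _).le).trans_eq ?_)
        rw [nsmul_eq_mul, mul_comm]
      rw [Real.norm_eq_abs, abs_mul, abs_of_nonneg hJ]
      exact (mul_le_mul_of_nonneg_left h3 hJ).trans_eq (mul_one J)
    · exact intervalIntegrable_const
    · refine Eventually.of_forall fun t ht => ((hM t ?_).const_mul J)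
      rw [Set.uIoc_of_le zero_le_one] at ht
      exact ht.1.le

end

end Midplane

/-! ### The wall free energy of the decaying field -/

section Wall

open scoped Classical

noncomputable section

lemma hamiltonian_zero_wall (d : ℕ) (J : ℝ) (h : HalfSpace d → ℝ) (Λ : Finset (HalfSpace d)) :
    hamiltonian d J 0 h Λ = edgeEnergy (halfGraph d) (fun _ => J) h Λ := by
  funext σ
  simp [hamiltonian, isingHamiltonian, edgeEnergy]

lemma tendsto_plusState {d : ℕ} {J : ℝ} (hJ : 0 ≤ J) (h : HalfSpace d → ℝ) :
    Tendsto (fun n => halfGibbs d J 0 h (box d n) (plusConfig _)) atTop (𝓝 (plusState d J 0 h)) := by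
  refine tendsto_nhds_limUnder ?_
  simp only [halfGibbs, hamiltonian_zero_wall]
  exact exists_tendsto_gibbsMeasure_plus (halfGraph d) (fun _ => hJ) h (invades_box d)

lemma tendsto_minusState {d : ℕ} {J : ℝ} (hJ : 0 ≤ J) (h : HalfSpace d → ℝ) :
    Tendsto (fun n => halfGibbs d J 0 h (box d n) (minusConfig _)) atTop
      (𝓝 (minusState d J 0 h)) := by
  refine tendsto_nhds_limUnder ?_
  simp only [halfGibbs, hamiltonian_zero_wall]
  exact exists_tendsto_gibbsMeasure_minus (halfGraph d) (fun _ => hJ) h (invades_box d)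

lemma gapLim_eq_zero_of_plusState_eq {d : ℕ} {J : ℝ} (hJ : 0 ≤ J) {h : HalfSpace d → ℝ}
    (heq : plusState d J 0 h = minusState d J 0 h) (i : HalfSpace d) :
    gapLim (halfGraph d) (fun _ => J) h i = 0 := by
  have hp := tendsto_plusState hJ h
  have hm := tendsto_minusState hJ h
  rw [← heq] at hm
  simp only [halfGibbs, hamiltonian_zero_wall] at hp hm
  exact gapLim_eq_zero_of_tendsto (halfGraph d) (fun _ => hJ) h (invades_box d) hp hm i

lemma limitGibbs_eq_of_gapLim {d : ℕ} {J : ℝ} (hJ : 0 ≤ J) {h : HalfSpace d → ℝ}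
    (hgap : ∀ i, gapLim (halfGraph d) (fun _ => J) h i = 0) :
    limitGibbs d J 0 h = {plusState d J 0 h} := by
  refine Set.Subset.antisymm ?_ (Set.singleton_subset_iff.2
    ⟨_, box d, invades_box d, tendsto_plusState hJ h⟩)
  rintro μ ⟨η, Λ, hΛ, hμ⟩
  have hp := tendsto_plusState hJ h
  simp only [halfGibbs, hamiltonian_zero_wall] at hμ hp
  exact limit_unique_of_gapLim_eq_zero (halfGraph d) (fun _ => hJ) h hgap hΛ (invades_box d) hμ hp

lemma plusState_eq_minusState_of_gapLim {d : ℕ} {J : ℝ} (hJ : 0 ≤ J) {h : HalfSpace d → ℝ}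
    (hgap : ∀ i, gapLim (halfGraph d) (fun _ => J) h i = 0) :
    plusState d J 0 h = minusState d J 0 h := by
  have h1 : minusState d J 0 h ∈ limitGibbs d J 0 h :=
    ⟨_, box d, invades_box d, tendsto_minusState hJ h⟩
  rw [limitGibbs_eq_of_gapLim hJ hgap] at h1
  exact h1.symm

lemma gibbsSet_eq_of_gapLim {d : ℕ} {J : ℝ} (hJ : 0 ≤ J) {h : HalfSpace d → ℝ}
    (hgap : ∀ i, gapLim (halfGraph d) (fun _ => J) h i = 0) :
    gibbsSet d J 0 h = {plusState d J 0 h} := by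
  ext μ
  rw [gibbsSet, limitGibbs_eq_of_gapLim hJ hgap, Set.image_singleton, convexHull_singleton,
    closure_singleton]
  refine ⟨fun hμ => ?_, fun hμ => congrArg ProbabilityMeasure.toFiniteMeasure hμ⟩
  have h' : μ.toFiniteMeasure = (plusState d J 0 h).toFiniteMeasure := hμ
  exact Subtype.ext (congrArg (fun ν : FiniteMeasure _ => ν.1) h')

/-- The profile of the decaying field. -/
def decayProfile (δ : ℝ) (ℓ : ℕ) : ℝ := 1 / ((ℓ : ℝ) + 1) ^ δ

lemma decayProfile_pos (δ : ℝ) (ℓ : ℕ) : 0 < decayProfile δ ℓ := by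
  unfold decayProfile
  positivity

lemma summable_decayProfile {δ : ℝ} (hδ : 1 < δ) : Summable (decayProfile δ) := by
  have h := (summable_nat_add_iff 1).2 (Real.summable_one_div_nat_rpow.2 hδ)
  refine h.congr fun ℓ => ?_
  simp [decayProfile]

lemma decayField_eq (d : ℕ) (δ lam : ℝ) :
    decayField d δ lam = layerField d fun ℓ => lam * decayProfile δ ℓ :=
  decayField_eq_layerField d δ lam

/-- Splits the surface term into a zero-field part and a field part. The reference `Z₀` cancels and
may be arbitrary. -/
lemma neg_mul_log_sq_div {N Z Z₀ Q : ℝ} (hZ : 0 < Z) (hQ : 0 < Q) :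
    1 / 2 * ((Real.log Q - 2 * Real.log Z₀) / N) - (Real.log Z - Real.log Z₀) / N =
      -(1 / (2 * N)) * Real.log (Z ^ 2 / Q) := by
  rw [Real.log_div (pow_pos hZ 2).ne' hQ.ne', Real.log_pow, one_div_mul_eq_div, mul_comm 2 N]
  push_cast
  rcases eq_or_ne N 0 with rfl | hN
  · simp
  · field_simp
    ring

lemma tendsto_surfacePlus {d : ℕ} {J δ : ℝ} (hJ : 0 ≤ J) (hδ : 1 < δ) (lam : ℝ) :
    Tendsto (surfacePlusSeq d J 0 (decayField d δ lam)) atTop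
      (𝓝 (surfacePlus d J 0 (decayField d δ lam))) := by
  refine tendsto_nhds_limUnder ?_
  obtain ⟨S, hS⟩ := exists_tendsto_zero_field d hJ
  have h1 := tendsto_log_partitionFn_plus (d := d) hJ (summable_decayProfile hδ)
    (fun ℓ => (decayProfile_pos δ ℓ).le) tendsto_id lam
  refine ⟨_, ((hS.const_mul (1 / 2)).sub h1).congr fun n => ?_⟩
  simp only [surfacePlusSeq, halfPartition, fullPartition, hamiltonian_zero_wall, card_wallBox,
    decayField_eq]
  exact neg_mul_log_sq_div (partitionFn_pos _ _ _) (partitionFn_pos _ _ _)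

lemma tendsto_surfaceMinus {d : ℕ} {J δ : ℝ} (hJ : 0 ≤ J) (hδ : 1 < δ) (lam : ℝ) :
    Tendsto (surfaceMinusSeq d J 0 (decayField d δ lam)) atTop
      (𝓝 (surfaceMinus d J 0 (decayField d δ lam))) := by
  refine tendsto_nhds_limUnder ?_
  obtain ⟨S, hS⟩ := exists_tendsto_zero_field d hJ
  have h1 := tendsto_log_partitionFn_minus (d := d) hJ (summable_decayProfile hδ)
    (fun ℓ => (decayProfile_pos δ ℓ).le) tendsto_id lam
  -- At zero field both partition functions are invariant under spin flip, so the zero-field limit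
  -- is the same for minus boundary conditions.
  simp only [← partitionFn_minus_eq_plus] at hS
  refine ⟨_, ((hS.const_mul (1 / 2)).sub h1).congr fun n => ?_⟩
  simp only [surfaceMinusSeq, halfPartition, fullPartition, hamiltonian_zero_wall, card_wallBox,
    decayField_eq]
  exact neg_mul_log_sq_div (partitionFn_pos _ _ _) (partitionFn_pos _ _ _)

/-- The derivative of the wall free energy of the decaying field. -/
def wallGap (d : ℕ) (J δ t : ℝ) : ℝ :=
  ∑' ℓ, decayProfile δ ℓ * gapLim (halfGraph d) (fun _ => J) (decayField d δ t) (site 0 ℓ)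

lemma wallFreeEnergy_eq_integral {d : ℕ} {J δ : ℝ} (hJ : 0 ≤ J) (hδ : 1 < δ) (lam : ℝ) :
    wallFreeEnergy d J 0 (decayField d δ lam) = ∫ t in (0 : ℝ)..lam, wallGap d J δ t := by
  have h1 := tendsto_logRatio (d := d) hJ (summable_decayProfile hδ)
    (fun ℓ => (decayProfile_pos δ ℓ).le) tendsto_id lam
  have h2 := (tendsto_surfaceMinus (d := d) hJ hδ lam).sub (tendsto_surfacePlus (d := d) hJ hδ lam)
  simp only [← decayField_eq] at h1
  refine tendsto_nhds_unique h2 (h1.congr fun n => ?_)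
  simp only [surfacePlusSeq, surfaceMinusSeq, halfPartition, fullPartition, hamiltonian_zero_wall,
    card_wallBox]
  -- Equality of the full-lattice partition functions cancels the bulk terms and leaves `logRatio`
  -- per wall site. The reference `Z₀ = 1` drops out.
  have hQ := partitionFn_minus_eq_plus (latticeGraph d) (fun _ => J) (doubleBox d n)
  rw [← neg_mul_log_sq_div (Z₀ := 1) (partitionFn_pos _ _ _) (partitionFn_pos _ _ _),
    ← neg_mul_log_sq_div (Z₀ := 1) (partitionFn_pos _ _ _) (partitionFn_pos _ _ _)]
  have hQ' : partitionFn (isingHamiltonian (latticeGraph d) J 0 (doubleBox d n)) (doubleBox d n)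
      (minusConfig _) = partitionFn (isingHamiltonian (latticeGraph d) J 0 (doubleBox d n))
      (doubleBox d n) (plusConfig _) := hQ
  rw [hQ', Real.log_one, logRatio, box_eq_halfBox]
  simp only [id]
  ring

lemma decayField_mono {d : ℕ} {δ s t : ℝ} (hst : s ≤ t) (i : HalfSpace d) :
    decayField d δ s i ≤ decayField d δ t i :=
  div_le_div_of_nonneg_right hst
    (Real.rpow_nonneg (Int.cast_nonneg (zero_le_one.trans i.2)) _)

lemma decayField_nonneg {d : ℕ} {δ t : ℝ} (ht : 0 ≤ t) (i : HalfSpace d) :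
    0 ≤ decayField d δ t i := by
  have := decayField_mono (δ := δ) ht i
  rwa [decayField, zero_div] at this

lemma summable_wallGap (d : ℕ) {J δ : ℝ} (hJ : 0 ≤ J) (hδ : 1 < δ) (t : ℝ) :
    Summable fun ℓ => decayProfile δ ℓ *
      gapLim (halfGraph d) (fun _ => J) (decayField d δ t) (site 0 ℓ) :=
  Summable.of_nonneg_of_le
    (fun ℓ => mul_nonneg (decayProfile_pos δ ℓ).le (gapLim_nonneg _ (fun _ => hJ) _ _))
    (fun ℓ => mul_le_mul_of_nonneg_left (gapLim_le_two _ (fun _ => hJ) _ _) (decayProfile_pos δ ℓ).le)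
    ((summable_decayProfile hδ).mul_right 2)

lemma wallGap_nonneg (d : ℕ) {J : ℝ} (δ : ℝ) (hJ : 0 ≤ J) (t : ℝ) : 0 ≤ wallGap d J δ t :=
  tsum_nonneg fun ℓ => mul_nonneg (decayProfile_pos δ ℓ).le (gapLim_nonneg _ (fun _ => hJ) _ _)

/-- This is concavity of the wall free energy. The restriction to the half-line reflects the
nonnegative fields of the four-replica inequality. -/
lemma wallGap_antitoneOn (d : ℕ) {J δ : ℝ} (hJ : 0 ≤ J) (hδ : 1 < δ) :
    AntitoneOn (wallGap d J δ) (Set.Ici 0) := fun s hs t _ hst =>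
  (summable_wallGap d hJ hδ t).tsum_le_tsum
    (fun ℓ => mul_le_mul_of_nonneg_left (gapLim_antitone _ (fun _ => hJ) (decayField_nonneg hs)
      (decayField_mono hst) _) (decayProfile_pos δ ℓ).le) (summable_wallGap d hJ hδ s)

lemma intervalIntegrable_wallGap (d : ℕ) {J δ : ℝ} (hJ : 0 ≤ J) (hδ : 1 < δ) {a b : ℝ} (ha : 0 ≤ a)
    (hb : 0 ≤ b) : IntervalIntegrable (wallGap d J δ) volume a b :=
  ((wallGap_antitoneOn d hJ hδ).mono fun _ hx => (le_inf ha hb).trans hx.1).intervalIntegrable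

/-- The weights are strictly positive and the gaps nonnegative, so every layer must have zero gap;
translation invariance covers the whole layer. -/
lemma wallGap_eq_zero_iff (d : ℕ) {J δ : ℝ} (hJ : 0 ≤ J) (hδ : 1 < δ) (t : ℝ) :
    wallGap d J δ t = 0 ↔ ∀ i, gapLim (halfGraph d) (fun _ => J) (decayField d δ t) i = 0 := by
  constructor
  · intro h i
    obtain ⟨x, ℓ, rfl⟩ := exists_eq_site i
    have hs := (summable_wallGap d hJ hδ t).hasSum
    rw [← wallGap, h] at hs
    have h1 := (hasSum_zero_iff_of_nonneg fun ℓ => mul_nonneg (decayProfile_pos δ ℓ).le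
      (gapLim_nonneg (halfGraph d) (fun _ => hJ) (decayField d δ t) (site 0 ℓ))).1 hs
    have h2 := (mul_eq_zero.1 (congrFun h1 ℓ)).resolve_left (decayProfile_pos δ ℓ).ne'
    rw [decayField_eq] at h2 ⊢
    rw [gapLim_site hJ, h2]
  · intro h
    simp [wallGap, h]

lemma wallFreeEnergy_sub {d : ℕ} {J δ : ℝ} (hJ : 0 ≤ J) (hδ : 1 < δ) {s t : ℝ} (hs : 0 ≤ s)
    (ht : 0 ≤ t) : wallFreeEnergy d J 0 (decayField d δ t) -
      wallFreeEnergy d J 0 (decayField d δ s) = ∫ u in s..t, wallGap d J δ u := by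
  rw [wallFreeEnergy_eq_integral hJ hδ, wallFreeEnergy_eq_integral hJ hδ]
  exact intervalIntegral.integral_interval_sub_left
    (intervalIntegrable_wallGap d hJ hδ le_rfl ht) (intervalIntegrable_wallGap d hJ hδ le_rfl hs)

/-- The free energy is nondecreasing up to `lam`, and constant beyond because a nonnegative antitone
derivative that vanishes stays zero. -/
lemma mem_maximizers_of_wallGap_eq_zero {d : ℕ} {J δ lam : ℝ} (hJ : 0 ≤ J) (hδ : 1 < δ)
    (hlam : 0 ≤ lam) (h : wallGap d J δ lam = 0) : lam ∈ maximizers d J δ := by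
  refine ⟨hlam, fun s hs => sub_nonneg.1 ?_⟩
  rw [wallFreeEnergy_sub hJ hδ hs hlam]
  rcases le_total s lam with hsl | hsl
  · exact intervalIntegral.integral_nonneg hsl fun u _ => wallGap_nonneg d δ hJ u
  · rw [intervalIntegral.integral_symm]
    refine (neg_eq_zero.2 ?_).ge
    refine (intervalIntegral.integral_congr (g := fun _ => (0 : ℝ)) fun u hu => ?_).trans (by simp)
    rw [Set.uIcc_of_le hsl] at hu
    exact le_antisymm ((wallGap_antitoneOn d hJ hδ hlam (hlam.trans hu.1) hu.1).trans_eq h)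
      (wallGap_nonneg d δ hJ u)

/-- The integral of `wallGap` over `[s, lam]` is at most `0` by maximality and at least `(lam - s) *
wallGap d J δ lam` by antitonicity. -/
lemma wallGap_eq_zero_of_lt {d : ℕ} {J δ lam s : ℝ} (hJ : 0 ≤ J) (hδ : 1 < δ)
    (hs : s ∈ maximizers d J δ) (hlt : s < lam) : wallGap d J δ lam = 0 := by
  have h0 : 0 ≤ lam := hs.1.trans hlt.le
  have h1 := sub_nonpos.2 (hs.2 lam h0)
  rw [wallFreeEnergy_sub hJ hδ hs.1 h0] at h1
  have h2 : ∫ _ in s..lam, wallGap d J δ lam ≤ ∫ u in s..lam, wallGap d J δ u :=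
    intervalIntegral.integral_mono_on hlt.le intervalIntegrable_const
      (intervalIntegrable_wallGap d hJ hδ hs.1 h0) fun u hu =>
      wallGap_antitoneOn d hJ hδ (hs.1.trans hu.1) h0 hu.2
  rw [intervalIntegral.integral_const, smul_eq_mul] at h2
  exact le_antisymm (nonpos_of_mul_nonpos_right (h2.trans h1) (sub_pos.2 hlt))
    (wallGap_nonneg d δ hJ lam)

lemma criticalValue_le {d : ℕ} {J δ lam : ℝ} (h : lam ∈ maximizers d J δ) :
    criticalValue d J δ ≤ lam :=
  csInf_le ⟨0, fun _ hs => hs.1⟩ h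

lemma maximizers_nonempty (d : ℕ) {J δ : ℝ} (hJ : 0 < J) (hδ : 1 < δ) :
    (maximizers d J δ).Nonempty :=
  ⟨J + 1, mem_maximizers_of_wallGap_eq_zero hJ.le hδ (by positivity)
    ((wallGap_eq_zero_iff d hJ.le hδ _).2 (gapLim_decayField_eq_zero hJ δ (lt_add_one J)))⟩

end

end Wall

end SemiInfIsing

theorem mainTheorem4 (d : ℕ) (hd : 2 ≤ d) (J δ : ℝ) (hJ : 0 < J) (hδ : 1 < δ) :
    -- the plus and minus states and the surface free energies are well defined
    (∀ lam : ℝ, 0 ≤ lam →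
      Tendsto (fun n => SemiInfIsing.halfGibbs d J 0 (SemiInfIsing.decayField d δ lam)
          (SemiInfIsing.box d n) (SemiInfIsing.plusConfig _)) atTop
        (𝓝 (SemiInfIsing.plusState d J 0 (SemiInfIsing.decayField d δ lam))) ∧
      Tendsto (fun n => SemiInfIsing.halfGibbs d J 0 (SemiInfIsing.decayField d δ lam)
          (SemiInfIsing.box d n) (SemiInfIsing.minusConfig _)) atTop
        (𝓝 (SemiInfIsing.minusState d J 0 (SemiInfIsing.decayField d δ lam))) ∧
      Tendsto (SemiInfIsing.surfacePlusSeq d J 0 (SemiInfIsing.decayField d δ lam)) atTop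
        (𝓝 (SemiInfIsing.surfacePlus d J 0 (SemiInfIsing.decayField d δ lam))) ∧
      Tendsto (SemiInfIsing.surfaceMinusSeq d J 0 (SemiInfIsing.decayField d δ lam)) atTop
        (𝓝 (SemiInfIsing.surfaceMinus d J 0 (SemiInfIsing.decayField d δ lam)))) ∧
    -- the maximum in the definition of the critical value is attained
    (SemiInfIsing.maximizers d J δ).Nonempty ∧
    -- below the critical value the plus and minus states differ
    (∀ lam : ℝ, 0 ≤ lam → lam < SemiInfIsing.criticalValue d J δ →
      SemiInfIsing.plusState d J 0 (SemiInfIsing.decayField d δ lam) ≠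
        SemiInfIsing.minusState d J 0 (SemiInfIsing.decayField d δ lam)) ∧
    -- above the critical value they coincide and the Gibbs measure is unique
    (∀ lam : ℝ, SemiInfIsing.criticalValue d J δ < lam →
      SemiInfIsing.plusState d J 0 (SemiInfIsing.decayField d δ lam) =
        SemiInfIsing.minusState d J 0 (SemiInfIsing.decayField d δ lam) ∧
      ∃! μ, μ ∈ SemiInfIsing.gibbsSet d J 0 (SemiInfIsing.decayField d δ lam)) := by
  have hJ0 := hJ.le
  refine ⟨fun lam _ => ⟨SemiInfIsing.tendsto_plusState hJ0 _, SemiInfIsing.tendsto_minusState hJ0 _,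
    SemiInfIsing.tendsto_surfacePlus hJ0 hδ lam, SemiInfIsing.tendsto_surfaceMinus hJ0 hδ lam⟩,
    SemiInfIsing.maximizers_nonempty d hJ hδ, fun lam h0 hlt heq => ?_, fun lam hlt => ?_⟩
  -- Equal states close every gap, so `lam` would be a maximizer and could not lie below the
  -- infimum.
  · refine hlt.not_ge (SemiInfIsing.criticalValue_le
      (SemiInfIsing.mem_maximizers_of_wallGap_eq_zero hJ0 hδ h0 ?_))
    exact (SemiInfIsing.wallGap_eq_zero_iff d hJ0 hδ lam).2
      (SemiInfIsing.gapLim_eq_zero_of_plusState_eq hJ0 heq)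
  -- It is not needed that the infimum is itself a maximizer: some maximizer `s` strictly below
  -- `lam` suffices.
  · obtain ⟨s, hs, hsl⟩ := exists_lt_of_csInf_lt (SemiInfIsing.maximizers_nonempty d hJ hδ) hlt
    have hgap := (SemiInfIsing.wallGap_eq_zero_iff d hJ0 hδ lam).1
      (SemiInfIsing.wallGap_eq_zero_of_lt hJ0 hδ hs hsl)
    refine ⟨SemiInfIsing.plusState_eq_minusState_of_gapLim hJ0 hgap, ?_⟩
    rw [SemiInfIsing.gibbsSet_eq_of_gapLim hJ0 hgap]
    exact existsUnique_eq
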